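/- **Setting.** Let $1\le r\le p$, $0\le d\le r$, and let $A^*\in\mathbb R^{p\times p}$ have rank $r$, singular values $\sigma_1\ge\dots\ge\sigma_r>0$, $\kappa=\sigma_1/\sigma_r$, and spectral radius strictly less than one. Suppose $A^*=[C^*\ R^*]\,D^*\,[C^*\ P^*]^\top$, where $C^*\in\mathbb R^{p\times d}$, $R^*,P^*\in\mathbb R^{p\times(r-d)}$ and both $[C^*\ R^*]$ and $[C^*\ P^*]$ have orthonormal columns. Let $\theta_1=\arccos\sigma_1(R^{*\top}P^*)$ be the smallest canonical angle between the column spaces of $R^*$ and $P^*$, and suppose $\sin\theta_1\ge g_{\min}>0$ (for $d=r$ there is no such angle, and this is read as $0<g_{\min}\le1$). Let $(y_t)_{t\in\mathbb Z}$ be the strictly stationary solution of $y_t=A^*y_{t-1}+\varepsilon_t$, with $\varepsilon_t=\Sigma_\varepsilon^{1/2}\zeta_t$ and $\Sigma_\varepsilon$ positive definite, where the $\zeta_t$ are i.i.d. with mean $0$ and covariance $I_p$, and the entries $\zeta_{it}$ of $\zeta_t$ are mutually independent and satisfy $\mathbb E\,e^{\mu\zeta_{it}}\le e^{\tau^2\mu^2/2}$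 for all $\mu\in\mathbb R$. With $\mathcal A(z)=I_p-A^*z$ put $\mu_{\min}=\min_{|z|=1}\lambda_{\min}(\mathcal A(z)^\dagger\mathcal A(z))$, $\mu_{\max}=\max_{|z|=1}\lambda_{\max}(\mathcal A(z)^\dagger\mathcal A(z))$ and $$\alpha_{\rm RSC}=\frac{\lambda_{\min}(\Sigma_\varepsilon)}{2\mu_{\max}},\quad M_1=\frac{\lambda_{\max}(\Sigma_\varepsilon)}{\mu_{\min}^{1/2}},\quad M_2=\frac{\lambda_{\min}(\Sigma_\varepsilon)\,\mu_{\min}}{\lambda_{\max}(\Sigma_\varepsilon)\,\mu_{\max}},\quad d_{\rm RR}(p,r)=r(2p-r).$$ **Spectral initialization.** From $Y=[y_1\cdots y_T]$, $X=[y_0\cdots y_{T-1}]$ and a scaling $b>0$: (i) let $\widetilde A_{\rm RR}$ minimize $\|Y-AX\|_{\rm F}$ over all $A$ with $\operatorname{rank}A\le r$, with SVD $\widetilde A_{\rm RR}=\widetilde U\widetilde S\widetilde V^\top$, $\widetilde U,\widetilde V\in\mathbb R^{p\times r}$ with orthonormal columns; (ii) let $\widetilde R$, $\widetilde P$ consist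 of the top $r-d$ left singular vectors of $\widetilde U\widetilde U^\top(I-\widetilde V\widetilde V^\top)$ and of $\widetilde V\widetilde V^\top(I-\widetilde U\widetilde U^\top)$, respectively; (iii) let $\widetilde C$ consist of $d$ orthonormal top eigenvectors of $(I-\widetilde R\widetilde R^\top)(I-\widetilde P\widetilde P^\top)(\widetilde U\widetilde U^\top+\widetilde V\widetilde V^\top)(I-\widetilde R\widetilde R^\top)(I-\widetilde P\widetilde P^\top)$; (iv) let $\widetilde D=[\widetilde C\ \widetilde R]^\top\widetilde A_{\rm RR}[\widetilde C\ \widetilde P]$; (v) set $C^{(0)}=b\widetilde C$, $R^{(0)}=b\widetilde R$, $P^{(0)}=b\widetilde P$, $D^{(0)}=b^{-2}\widetilde D$ and $A^{(0)}=[C^{(0)}\ R^{(0)}]D^{(0)}[C^{(0)}\ P^{(0)}]^\top$. **Proposition.** There are absolute constants $C_0,C_2>0$ and, for every $s_0>0$, a constant $C_1>0$ depending only on $s_0$, such that in the above setting, whenever $\sigma_1\ge s_0$ and $T\ge C_0\max(\tau^4,\tau^2)M_2^{-2}p$, with probability at least $$1-2\exp[-C_2M_2^2\min(\tau^{-2},\tau^{-4})T]-\exp(-C_2p)$$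 every output $A^{(0)}$ of the spectral initialization satisfies $$\|A^{(0)}-A^*\|_{\rm F}\le C_1\,\sigma_1^{2/3}\kappa^2g_{\min}^{-2}\alpha_{\rm RSC}^{-1}\tau^2M_1\sqrt{\frac{d_{\rm RR}(p,r)}{T}}.$$ -/

import Mathlib

open MeasureTheory ProbabilityTheory Matrix
open scoped NNReal ENNReal

noncomputable section

namespace CommonVAR

/-! ### Matrix notions -/

/-- The Frobenius norm. -/
def frobNorm {m n : Type*} [Fintype m] [Fintype n] (M : Matrix m n ℝ) : ℝ :=
  Real.sqrt (∑ i, ∑ j, M i j ^ 2)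

/-- `W` has orthonormal columns, i.e. `Wᵀ W = I`. -/
def IsOrthonormal {m n : Type*} [Fintype m] [DecidableEq n] (W : Matrix m n ℝ) : Prop :=
  Wᵀ * W = 1

/-- The `i`-th largest singular value, indexed from zero: `sigma M 0` is the largest one,
`sigma M (r - 1)` the `r`-th largest one. -/
def sigma {m n : ℕ} (M : Matrix (Fin m) (Fin n) ℝ) (i : ℕ) : ℝ :=
  (Matrix.toEuclideanLin M).singularValues i

/-- The smallest real eigenvalue, used for Hermitian matrices (all eigenvalues are real). -/
def lambdaMin (𝕜 : Type*) [RCLike 𝕜] {p : ℕ} (M : Matrix (Fin p) (Fin p) 𝕜) : ℝ :=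
  sInf {t : ℝ | (t : 𝕜) ∈ spectrum 𝕜 M}

/-- The largest real eigenvalue, used for Hermitian matrices (all eigenvalues are real). -/
def lambdaMax (𝕜 : Type*) [RCLike 𝕜] {p : ℕ} (M : Matrix (Fin p) (Fin p) 𝕜) : ℝ :=
  sSup {t : ℝ | (t : 𝕜) ∈ spectrum 𝕜 M}

/-- The `i`-th canonical angle (indexed from zero, increasing) between the column spaces of two
matrices with orthonormal columns. If `k = 0` the value is `π / 2`. -/
def canonicalAngle {p k : ℕ} (R P : Matrix (Fin p) (Fin k) ℝ) (i : ℕ) : ℝ :=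
  Real.arccos (sigma (Rᵀ * P) i)

/-- The columns of `W` are top `k` eigenvectors of the square matrix `N`, in decreasing order of
the eigenvalues: they are orthonormal eigenvectors, their eigenvalues `lam` are part of the list of
all eigenvalues of `N` (counted with multiplicity), and none of the remaining eigenvalues
is larger. (For symmetric `N` all eigenvalues are real. The real part only matters because the
matrix in step (iii) below need not be symmetric in degenerate cases.) -/
def IsTopEigenvectors {p k : ℕ} (N : Matrix (Fin p) (Fin p) ℝ)
    (W : Matrix (Fin p) (Fin k) ℝ) : Prop :=
  IsOrthonormal W ∧ ∃ lam : Fin k → ℝ, Antitone lam ∧ N * W = W * Matrix.diagonal lam ∧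
    ∃ rest : Multiset ℂ,
      (N.map (algebraMap ℝ ℂ)).charpoly.roots
        = (Finset.univ : Finset (Fin k)).val.map (fun j => (lam j : ℂ)) + rest ∧
      ∀ z ∈ rest, ∀ j, z.re ≤ lam j

/-- The columns of `W` are top `k` left singular vectors of `M`, i.e. top eigenvectors of
`M Mᵀ`. -/
def IsTopLeftSingularVectors {p k : ℕ} (M : Matrix (Fin p) (Fin p) ℝ)
    (W : Matrix (Fin p) (Fin k) ℝ) : Prop :=
  IsTopEigenvectors (M * Mᵀ) W

/-- `M = U diag(s) Vᵀ` is a (thin, `r`-term) singular value decomposition. -/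
def IsSVD {p r : ℕ} (M : Matrix (Fin p) (Fin p) ℝ) (U : Matrix (Fin p) (Fin r) ℝ)
    (s : Fin r → ℝ) (V : Matrix (Fin p) (Fin r) ℝ) : Prop :=
  IsOrthonormal U ∧ IsOrthonormal V ∧ Antitone s ∧ (∀ i, 0 ≤ s i) ∧
    M = U * Matrix.diagonal s * Vᵀ

/-! ### The model -/

/-- The innovations `ζ_t`, `t ∈ ℤ`: i.i.d. random vectors with mean zero and identity covariance,
whose entries are mutually independent and `τ²`-sub-Gaussian. -/
structure IsInnovation {Ω : Type*} [MeasurableSpace Ω] (Pr : Measure Ω) {p : ℕ} (τ : ℝ≥0)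
    (ζ : ℤ → Ω → Fin p → ℝ) : Prop where
  measurable : ∀ t, Measurable (ζ t)
  indep : iIndepFun ζ Pr
  identDistrib : ∀ t, IdentDistrib (ζ t) (ζ 0) Pr Pr
  mean_zero : ∀ t i, ∫ ω, ζ t ω i ∂Pr = 0
  cov_one : ∀ t i j, ∫ ω, ζ t ω i * ζ t ω j ∂Pr = if i = j then 1 else 0
  indep_entries : ∀ t, iIndepFun (fun i ω => ζ t ω i) Pr
  subgaussian : ∀ t i, HasSubgaussianMGF (fun ω => ζ t ω i) (τ ^ 2) Pr

/-- `(y_t)_{t ∈ ℤ}` is a strictly stationary solution of `y_t = A y_{t-1} + H ζ_t`. -/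
structure IsStationaryVAR {Ω : Type*} [MeasurableSpace Ω] (Pr : Measure Ω) {p : ℕ}
    (A H : Matrix (Fin p) (Fin p) ℝ) (ζ y : ℤ → Ω → Fin p → ℝ) : Prop where
  measurable : ∀ t, Measurable (y t)
  recursion : ∀ t, ∀ᵐ ω ∂Pr, y t ω = A *ᵥ y (t - 1) ω + H *ᵥ ζ t ω
  stationary : ∀ h : ℤ, Pr.map (fun ω (t : ℤ) => y (t + h) ω) = Pr.map (fun ω (t : ℤ) => y t ω)

/-- `Y = [y_1 ⋯ y_T]`. -/
def dataY {Ω : Type*} {p : ℕ} (y : ℤ → Ω → Fin p → ℝ) (T : ℕ) (ω : Ω) :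
    Matrix (Fin p) (Fin T) ℝ :=
  Matrix.of fun i t => y ((t : ℤ) + 1) ω i

/-- `X = [y_0 ⋯ y_{T-1}]`. -/
def dataX {Ω : Type*} {p : ℕ} (y : ℤ → Ω → Fin p → ℝ) (T : ℕ) (ω : Ω) :
    Matrix (Fin p) (Fin T) ℝ :=
  Matrix.of fun i t => y (t : ℤ) ω i

/-- The matrix polynomial `𝒜(z) = I - A z`. -/
def matPoly {p : ℕ} (A : Matrix (Fin p) (Fin p) ℝ) (z : ℂ) : Matrix (Fin p) (Fin p) ℂ :=
  1 - z • A.map (algebraMap ℝ ℂ)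

/-- `μ_min(𝒜)`, the minimum over `|z| = 1` of `λ_min(𝒜(z)† 𝒜(z))`. -/
def muMin {p : ℕ} (A : Matrix (Fin p) (Fin p) ℝ) : ℝ :=
  ⨅ z : Circle, lambdaMin ℂ ((matPoly A z)ᴴ * matPoly A z)

/-- `μ_max(𝒜)`, the maximum over `|z| = 1` of `λ_max(𝒜(z)† 𝒜(z))`. -/
def muMax {p : ℕ} (A : Matrix (Fin p) (Fin p) ℝ) : ℝ :=
  ⨆ z : Circle, lambdaMax ℂ ((matPoly A z)ᴴ * matPoly A z)

/-- `α_RSC = λ_min(Σ) / (2 μ_max(𝒜))`. -/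
def alphaRSC {p : ℕ} (A Cov : Matrix (Fin p) (Fin p) ℝ) : ℝ :=
  lambdaMin ℝ Cov / (2 * muMax A)

/-- `M₁ = λ_max(Σ) / μ_min(𝒜)^{1/2}`. -/
def M₁ {p : ℕ} (A Cov : Matrix (Fin p) (Fin p) ℝ) : ℝ :=
  lambdaMax ℝ Cov / Real.sqrt (muMin A)

/-- `M₂ = λ_min(Σ) μ_min(𝒜) / (λ_max(Σ) μ_max(𝒜))`. -/
def M₂ {p : ℕ} (A Cov : Matrix (Fin p) (Fin p) ℝ) : ℝ :=
  (lambdaMin ℝ Cov * muMin A) / (lambdaMax ℝ Cov * muMax A)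

/-- `d_RR(p, r) = r (2p - r)`, the number of parameters of a rank-`r` matrix. -/
def dRR (p r : ℕ) : ℝ := (r : ℝ) * (2 * (p : ℝ) - (r : ℝ))

/-- The decomposition `A = [C R] D [C P]ᵀ` with `[C R]` and `[C P]` having orthonormal columns. -/
structure IsCommonDecomposition {p r d : ℕ} (A : Matrix (Fin p) (Fin p) ℝ)
    (C : Matrix (Fin p) (Fin d) ℝ) (R P : Matrix (Fin p) (Fin (r - d)) ℝ)
    (D : Matrix (Fin d ⊕ Fin (r - d)) (Fin d ⊕ Fin (r - d)) ℝ) : Prop where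
  orthonormal_response : IsOrthonormal (Matrix.fromCols C R)
  orthonormal_predictor : IsOrthonormal (Matrix.fromCols C P)
  eq_mul : A = Matrix.fromCols C R * D * (Matrix.fromCols C P)ᵀ

/-! ### The spectral initialization -/

/-- `A` is a reduced-rank least squares estimator: it minimizes `‖Y - A X‖_F` over all matrices of
rank at most `r`. -/
def IsReducedRankEstimator {p T : ℕ} (r : ℕ) (Y X : Matrix (Fin p) (Fin T) ℝ)
    (A : Matrix (Fin p) (Fin p) ℝ) : Prop :=
  A.rank ≤ r ∧ ∀ B : Matrix (Fin p) (Fin p) ℝ, B.rank ≤ r →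
    frobNorm (Y - A * X) ≤ frobNorm (Y - B * X)

/-- `A₀ = [C₀ R₀] D₀ [C₀ P₀]ᵀ` is an output of the spectral initialization with rank `r`, common
dimension `d` and scaling parameter `b`, applied to the data `Y`, `X`. -/
def IsSpectralInit {p T : ℕ} (r d : ℕ) (b : ℝ) (Y X : Matrix (Fin p) (Fin T) ℝ)
    (A₀ : Matrix (Fin p) (Fin p) ℝ) : Prop :=
  ∃ (ARR : Matrix (Fin p) (Fin p) ℝ) (U V : Matrix (Fin p) (Fin r) ℝ) (s : Fin r → ℝ)
    (R P : Matrix (Fin p) (Fin (r - d)) ℝ) (C : Matrix (Fin p) (Fin d) ℝ)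
    (D : Matrix (Fin d ⊕ Fin (r - d)) (Fin d ⊕ Fin (r - d)) ℝ),
    -- (i) the reduced-rank estimator and its singular value decomposition
    IsReducedRankEstimator r Y X ARR ∧
    IsSVD ARR U s V ∧
    -- (ii) the specific subspaces
    IsTopLeftSingularVectors (U * Uᵀ * (1 - V * Vᵀ)) R ∧
    IsTopLeftSingularVectors (V * Vᵀ * (1 - U * Uᵀ)) P ∧
    -- (iii) the common subspace
    IsTopEigenvectors
      ((1 - R * Rᵀ) * (1 - P * Pᵀ) * (U * Uᵀ + V * Vᵀ) * (1 - R * Rᵀ) * (1 - P * Pᵀ)) C ∧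
    -- (iv) the core matrix
    D = (Matrix.fromCols C R)ᵀ * ARR * Matrix.fromCols C P ∧
    -- (v) scaling
    A₀ = Matrix.fromCols (b • C) (b • R) * (((b ^ 2)⁻¹) • D) *
      (Matrix.fromCols (b • C) (b • P))ᵀ

end CommonVAR

end

/-! The proof splits into a deterministic bound on how the spectral initialization propagates the
error `Δ = ‖ARR - A‖_F` of the reduced-rank estimator, and a probabilistic bound on `Δ` itself.

Deterministic part. The core of `A` is invertible with inverse at most `1/σ_r`, so the projections
onto the column and row spaces of `ARR` are within `2Δ/σ_r` of the true ones. Then `UUᵀ(1 - VVᵀ)`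
estimates `RRᵀ(1 - PPᵀ)`, whose squared singular values on the range of `R` are at least `gmin²`;
this is where `gmin⁻²` enters. The compressed sum of projections in step (iii) estimates exactly
`2CCᵀ`, with gap 2. That matrix need not be symmetric, so a symmetric sin-theta theorem is not
enough. `frobNorm_compl_proj_mul_topEigenvectors_sq_le` replaces it: the eigenvector equation
handles large eigenvalues, and the counting bound `card_roots_re_le_of_quadForm_ge` limits how many
selected eigenvalues can be small. No smallness of the perturbation is required. The outcome is
`frobNorm_spectralInit_sub_le`, a multiple of `κ² gmin⁻² Δ`.

Probabilistic part. By `frobNorm_reducedRank_sub_le`, `Δ` is controlled by a lower bound on the Gram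
matrix and an upper bound on the operator norm of the noise-regressor products. Both come from
exponential supermartingales in a fixed direction and a union bound over lattice points. For the
lower bound, `v ⬝ᵥ y_t` is a predictable number plus a fresh innovation, and `E exp(-θ(b + Z)²) ≤
exp(-7θ/8)` for normalized `Z` whatever `b` is (`expMoment_neg_sqScale_mul_add_sq_le`). For upper
bounds, linear functionals of the process are sub-Gaussian: the adjoint recursion writes them in the
innovations, and Parseval with the symbol bound `muMin` controls the coefficients. Gaussian
averaging turns linear exponential moments into quadratic ones.

Causality of the stationary solution is not assumed. Moments are proved for the process started at
zero in the remote past, which is adapted, and passed to the limit by Fatou's lemma.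

The resulting bound has no factor `σ₁^(2/3)`; since `σ₁ ≥ s₀`, that factor is inserted at the price
of a constant depending on `s₀`. -/

set_option linter.unusedSectionVars false

/-! ### Schur form and counting eigenvalues of a non-normal perturbation. -/

namespace CommonVAR

/-- **Schur triangulation**: an endomorphism of a complex inner product space is upper triangular
in some orthonormal basis. -/
theorem exists_orthonormalBasis_upperTriangular (n : ℕ) :
    ∀ (E : Type) [NormedAddCommGroup E] [InnerProductSpace ℂ E] [FiniteDimensional ℂ E]
      (_ : Module.finrank ℂ E = n) (T : E →ₗ[ℂ] E),
      ∃ b : OrthonormalBasis (Fin n) ℂ E, ∀ i j, j < i → inner ℂ (b i) (T (b j)) = 0 := by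
  induction n with
  | zero =>
    intro E _ _ _ hE T
    exact ⟨(stdOrthonormalBasis ℂ E).reindex (finCongr hE), fun i => i.elim0⟩
  | succ n ih =>
    intro E _ _ _ hE T
    have : Nontrivial E := Module.nontrivial_of_finrank_pos (R := ℂ) (by omega)
    -- An eigenvector of the adjoint is used because its orthogonal complement is invariant under
    -- `T`. It becomes the last basis vector, after a triangularizing basis of the complement.
    obtain ⟨μ, hμ⟩ := Module.End.exists_eigenvalue (LinearMap.adjoint T)
    obtain ⟨v₀, hv₀⟩ := hμ.exists_hasEigenvector
    have hv₀0 : ‖v₀‖ ≠ 0 := norm_ne_zero_iff.2 hv₀.2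
    set v : E := ((‖v₀‖⁻¹ : ℝ) : ℂ) • v₀ with hv
    have hvn : ‖v‖ = 1 := by
      rw [hv, norm_smul]; simp [hv₀0]
    have hvT : LinearMap.adjoint T v = μ • v := by
      rw [hv, map_smul, hv₀.apply_eq_smul, smul_comm]
    set F : Submodule ℂ E := (ℂ ∙ v)ᗮ with hF
    have hmem : ∀ x, x ∈ F ↔ inner ℂ v x = 0 := fun x => Submodule.mem_orthogonal_singleton_iff_inner_right
    have hinv : ∀ x ∈ F, T x ∈ F := by
      intro x hx
      rw [hmem] at hx ⊢
      rw [← LinearMap.adjoint_inner_left, hvT, inner_smul_left, hx, mul_zero]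
    have hdim : Module.finrank ℂ F = n := by
      rw [hF]
      have := Submodule.finrank_add_finrank_orthogonal (K := (ℂ ∙ v))
      rw [finrank_span_singleton (by rintro h; simp [h] at hvn), hE] at this
      omega
    obtain ⟨b, hb⟩ := ih F hdim (T.restrict hinv)
    have hon : Orthonormal ℂ (Fin.snoc (fun i => (b i : E)) v : Fin (n + 1) → E) := by
      constructor
      · intro i
        refine Fin.lastCases ?_ (fun i => ?_) i
        · simpa using hvn
        · have := b.orthonormal.1 i
          rw [Fin.snoc_castSucc]
          exact this
      · intro i j
        refine Fin.lastCases ?_ (fun i => ?_) i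
        · refine Fin.lastCases ?_ (fun j => ?_) j
          · simp
          · intro _
            simpa using (hmem _).1 (b j).2
        · refine Fin.lastCases ?_ (fun j => ?_) j
          · intro _
            simpa using inner_eq_zero_symm.1 ((hmem _).1 (b i).2)
          · intro hij
            have := b.orthonormal.2 (i := i) (j := j) (by rintro rfl; exact hij rfl)
            simpa using this
    refine ⟨OrthonormalBasis.mk hon ?_, ?_⟩
    · have hli := hon.linearIndependent
      rw [hli.span_eq_top_of_card_eq_finrank' (by simp [hE])]
    · intro i j
      rw [OrthonormalBasis.coe_mk]
      refine Fin.lastCases ?_ (fun i => ?_) i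
      · refine Fin.lastCases ?_ (fun j => ?_) j
        · simp
        · intro _
          simpa using (hmem _).1 (hinv _ (b j).2)
      · refine Fin.lastCases ?_ (fun j => ?_) j
        · intro h
          exact absurd h (by simpa using (Fin.castSucc_lt_last i).le)
        · intro hij
          have := hb i j (by simpa using hij)
          simpa using this


/-- If a Hermitian matrix `N` has quadratic form at least `γ` on a `k`-dimensional subspace, then a
matrix `M` with `p - k + m` eigenvalues of real part at most `β < γ` is far from `N`. -/
theorem card_roots_re_le_of_quadForm_ge {p : ℕ} (M N : Matrix (Fin p) (Fin p) ℂ)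
    (hN : N.IsHermitian) (G : Submodule ℂ (EuclideanSpace ℂ (Fin p))) (γ β : ℝ) (hβ : β < γ)
    (hG : ∀ x ∈ G, γ * ‖x‖ ^ 2 ≤ (inner ℂ x (Matrix.toEuclideanLin N x)).re) :
    (((M.charpoly.roots.filter (fun z => z.re ≤ β)).card : ℝ) + Module.finrank ℂ G - p)
      * (γ - β) ^ 2 ≤ 2 * ∑ i, ∑ j, ‖(M - N) i j‖ ^ 2 := by
  classical
  obtain ⟨b, hb⟩ := exists_orthonormalBasis_upperTriangular p (EuclideanSpace ℂ (Fin p))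
    (by simp) (Matrix.toEuclideanLin M)
  set t : Fin p → Fin p → ℂ := fun i j => inner ℂ (b i) (Matrix.toEuclideanLin M (b j)) with ht
  set e : Fin p → Fin p → ℂ :=
    fun i j => inner ℂ (b i) (Matrix.toEuclideanLin (M - N) (b j)) with he
  -- the eigenvalues are the diagonal entries
  have hroots : M.charpoly.roots = (Finset.univ : Finset (Fin p)).val.map (fun i => t i i) := by
    have h1 : M.charpoly = (LinearMap.toMatrix b.toBasis b.toBasis
        (Matrix.toEuclideanLin M)).charpoly := by
      rw [LinearMap.charpoly_toMatrix, Matrix.toEuclideanLin, Matrix.toLpLin_eq_toLin,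
        Matrix.charpoly_toLin]
    have hent : ∀ i j, LinearMap.toMatrix b.toBasis b.toBasis (Matrix.toEuclideanLin M) i j
        = t i j := by
      intro i j
      rw [LinearMap.toMatrix_apply]
      simp [ht, OrthonormalBasis.repr_apply_apply]
    have h2 : (LinearMap.toMatrix b.toBasis b.toBasis
        (Matrix.toEuclideanLin M)).IsUpperTriangular := by
      intro i j hij
      rw [hent]
      exact hb i j hij
    rw [h1, Matrix.charpoly_of_isUpperTriangular _ h2]
    simp_rw [hent]
    exact Polynomial.roots_multiset_prod_X_sub_C (Finset.univ.val.map (fun i => t i i)) ▸ by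
      simp [Function.comp_def, Finset.prod]
  set B : Finset (Fin p) := Finset.univ.filter (fun i => (t i i).re ≤ β) with hB
  have hcard : (M.charpoly.roots.filter (fun z => z.re ≤ β)).card = B.card := by
    rw [hroots, Multiset.filter_map, Multiset.card_map]; rfl
  set S : Submodule ℂ (EuclideanSpace ℂ (Fin p)) :=
    Submodule.span ℂ (Set.range (fun i : B => b i)) with hS
  have hSdim : Module.finrank ℂ S = B.card := by
    rw [hS, finrank_span_eq_card]
    · simp
    · exact b.orthonormal.linearIndependent.comp (Subtype.val : B → Fin p) Subtype.val_injective
  have hSmem : ∀ x ∈ S, ∀ i ∉ B, inner ℂ (b i) x = 0 := by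
    intro x hx i hi
    induction hx using Submodule.span_induction with
    | mem x hx =>
      obtain ⟨j, rfl⟩ := hx
      exact b.orthonormal.2 (by rintro rfl; exact hi j.2)
    | zero => simp
    | add x y _ _ hx hy => rw [inner_add_right, hx, hy, add_zero]
    | smul a x _ hx => rw [inner_smul_right, hx, mul_zero]
  -- On `S` the diagonal of the Schur form has real part at most `β`; on `G` the form of `N` is at
  -- least `γ`. Dimension counting makes their intersection at least as large as the excess in the
  -- statement.
  set I := S ⊓ G with hI
  set m := Module.finrank ℂ I with hm
  have hdim : B.card + Module.finrank ℂ G ≤ p + m := by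
    have h1 := Submodule.finrank_sup_add_finrank_inf_eq S G
    have h2 : Module.finrank ℂ ↥(S ⊔ G) ≤ p := by
      simpa using Submodule.finrank_le (S ⊔ G)
    rw [hm, hI]
    omega
  let x : Fin m → EuclideanSpace ℂ (Fin p) := fun l => (stdOrthonormalBasis ℂ I l : I)
  have hx : Orthonormal ℂ x := by
    have := (stdOrthonormalBasis ℂ I).orthonormal
    exact this.comp_linearIsometry I.subtypeₗᵢ
  have hxI : ∀ l, x l ∈ S ∧ x l ∈ G := fun l => (stdOrthonormalBasis ℂ I l : I).2
  -- In the Schur basis `N = t - e` with `t` upper triangular. Below the diagonal `N` is `-e`, and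
  -- above it `N` is the conjugate of that since `N` is Hermitian. So `N` is the diagonal of `t`
  -- plus `c`, and `c` only involves entries of `e`: the uncontrolled strictly upper part of `t`
  -- disappears.
  let c : Fin p → Fin p → ℂ := fun i j => if i < j then - star (e j i) else - e i j
  have hsub : ∀ y, Matrix.toEuclideanLin (M - N) y
      = Matrix.toEuclideanLin M y - Matrix.toEuclideanLin N y := by
    intro y; rw [map_sub]; rfl
  have hNsym : (Matrix.toEuclideanLin N).IsSymmetric := Matrix.isSymmetric_toEuclideanLin_iff.2 hN
  have hn : ∀ i j, t i j - e i j = inner ℂ (b i) (Matrix.toEuclideanLin N (b j)) := by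
    intro i j
    simp only [ht, he, hsub, inner_sub_right]
    ring
  have hkey : ∀ i j, t i j - e i j = (if i = j then t i i else 0) + c i j := by
    intro i j
    rcases lt_trichotomy i j with h | h | h
    · have h1 : t i j - e i j = star (t j i - e j i) := by
        rw [hn, hn]
        exact (hNsym _ _).symm.trans (inner_conj_symm _ _).symm
      have h2 : t j i = 0 := hb j i h
      rw [h1, h2]
      simp [c, h, h.ne]
    · subst h
      simp [c]
      ring
    · have h2 : t i j = 0 := hb i j h
      simp [c, h.ne', h2, not_lt.2 h.le]
  have hquad : ∀ l, (γ - β) ≤ (∑ i, star (inner ℂ (b i) (x l)) * ∑ j, c i j * inner ℂ (b j) (x l)).re := by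
    intro l
    have hnorm : ‖x l‖ = 1 := hx.1 l
    have hexp : x l = ∑ j, (inner ℂ (b j) (x l) : ℂ) • b j := (b.sum_repr' (x l)).symm
    have h1 : inner ℂ (x l) (Matrix.toEuclideanLin N (x l))
        = ∑ i, star (inner ℂ (b i) (x l)) * ∑ j, (t i j - e i j) * inner ℂ (b j) (x l) := by
      conv_lhs => rw [← b.sum_inner_mul_inner (x l) _]
      refine Finset.sum_congr rfl fun i _ => ?_
      congr 1
      · exact (inner_conj_symm _ _).symm
      · conv_lhs => rw [hexp, map_sum, inner_sum]
        refine Finset.sum_congr rfl fun j _ => ?_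
        rw [map_smul, inner_smul_right, hn, mul_comm]
    have h2 := hG _ (hxI l).2
    rw [h1, hnorm] at h2
    have h3 : ∀ i, ∑ j, (t i j - e i j) * inner ℂ (b j) (x l)
        = t i i * inner ℂ (b i) (x l) + ∑ j, c i j * inner ℂ (b j) (x l) := by
      intro i
      simp only [hkey, add_mul, Finset.sum_add_distrib]
      simp
    simp only [h3, mul_add, Finset.sum_add_distrib, Complex.add_re] at h2
    have h4 : (∑ i, star (inner ℂ (b i) (x l)) * (t i i * inner ℂ (b i) (x l))).re ≤ β := by
      have h5 : ∑ i, ‖(inner ℂ (b i) (x l) : ℂ)‖ ^ 2 = 1 := by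
        rw [b.sum_sq_norm_inner_right, hnorm, one_pow]
      rw [Complex.re_sum, ← mul_one β, ← h5, Finset.mul_sum]
      refine Finset.sum_le_sum fun i _ => ?_
      have h6 : (star (inner ℂ (b i) (x l)) * (t i i * inner ℂ (b i) (x l))).re
          = (t i i).re * ‖(inner ℂ (b i) (x l) : ℂ)‖ ^ 2 := by
        generalize (inner ℂ (b i) (x l) : ℂ) = ξ
        rw [← Complex.normSq_eq_norm_sq, Complex.normSq_apply]
        simp
        ring
      rw [h6]
      by_cases hi : i ∈ B
      · exact mul_le_mul_of_nonneg_right (Finset.mem_filter.1 hi).2 (sq_nonneg _)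
      · rw [hSmem _ (hxI l).1 i hi]; simp
    linarith
  have hquad2 : ∀ l, (γ - β) ^ 2 ≤ ∑ i, ‖∑ j, c i j * inner ℂ (b j) (x l)‖ ^ 2 := by
    intro l
    have h5 : ∑ i, ‖(inner ℂ (b i) (x l) : ℂ)‖ ^ 2 = 1 := by
      rw [b.sum_sq_norm_inner_right, hx.1 l, one_pow]
    have h1 : (γ - β) ≤ ∑ i, ‖(inner ℂ (b i) (x l) : ℂ)‖ * ‖∑ j, c i j * inner ℂ (b j) (x l)‖ := by
      refine (hquad l).trans ((Complex.re_le_norm _).trans ((norm_sum_le _ _).trans_eq ?_))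
      exact Finset.sum_congr rfl fun i _ => by rw [norm_mul, norm_star]
    calc (γ - β) ^ 2 ≤ (∑ i, ‖(inner ℂ (b i) (x l) : ℂ)‖
          * ‖∑ j, c i j * inner ℂ (b j) (x l)‖) ^ 2 := by
            exact pow_le_pow_left₀ (by linarith) h1 2
      _ ≤ _ := Finset.sum_mul_sq_le_sq_mul_sq _ _ _
      _ = _ := by rw [h5, one_mul]
  -- Each of the `m` orthonormal vectors `x l` has image under `c` of length at least `γ - β`;
  -- Bessel's inequality row by row bounds the sum of the squares by the Frobenius norm of `c`.
  have hbessel : ∀ i, ∑ l, ‖∑ j, c i j * inner ℂ (b j) (x l)‖ ^ 2 ≤ ∑ j, ‖c i j‖ ^ 2 := by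
    intro i
    set u : EuclideanSpace ℂ (Fin p) := ∑ j, star (c i j) • b j with hu
    have h1 : ∀ l, ‖∑ j, c i j * inner ℂ (b j) (x l)‖ = ‖(inner ℂ (x l) u : ℂ)‖ := by
      intro l
      rw [norm_inner_symm, hu, sum_inner]
      congr 1
      exact Finset.sum_congr rfl fun j _ => by rw [inner_smul_left]; simp
    have h2 : ‖u‖ ^ 2 = ∑ j, ‖c i j‖ ^ 2 := by
      rw [← b.sum_sq_norm_inner_right u]
      refine Finset.sum_congr rfl fun j _ => ?_
      rw [hu, inner_sum]
      simp [inner_smul_right, b.inner_eq_ite]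
    simp only [h1]
    rw [← h2]
    exact hx.sum_inner_products_le (x := u) (s := Finset.univ)
  have hc : ∑ i, ∑ j, ‖c i j‖ ^ 2 ≤ 2 * ∑ i, ∑ j, ‖e i j‖ ^ 2 := by
    calc ∑ i, ∑ j, ‖c i j‖ ^ 2 ≤ ∑ i, ∑ j, (‖e i j‖ ^ 2 + ‖e j i‖ ^ 2) := by
          refine Finset.sum_le_sum fun i _ => Finset.sum_le_sum fun j _ => ?_
          by_cases h : i < j
          · simp only [c, h, if_true, norm_neg, norm_star]
            have := sq_nonneg ‖e i j‖
            linarith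
          · simp only [c, h, if_false, norm_neg]
            have := sq_nonneg ‖e j i‖
            linarith
      _ = _ := by
          simp only [Finset.sum_add_distrib]
          rw [Finset.sum_comm (f := fun i j => ‖e j i‖ ^ 2), two_mul]
  have hfro : ∑ i, ∑ j, ‖e i j‖ ^ 2 = ∑ i, ∑ j, ‖(M - N) i j‖ ^ 2 := by
    rw [Finset.sum_comm]
    have h1 : ∀ j, ∑ i, ‖e i j‖ ^ 2 = ∑ a, ‖(Matrix.toEuclideanLin (M - N) (b j)) a‖ ^ 2 := by
      intro j
      rw [b.sum_sq_norm_inner_right, EuclideanSpace.norm_sq_eq]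
    simp only [h1]
    rw [Finset.sum_comm]
    refine Finset.sum_congr rfl fun a _ => ?_
    have h2 : ∀ j, (Matrix.toEuclideanLin (M - N) (b j)) a
        = inner ℂ (WithLp.toLp 2 (fun k => star ((M - N) a k)) : EuclideanSpace ℂ (Fin p)) (b j) := by
      intro j
      simp only [Matrix.toLpLin_apply, Matrix.mulVec, dotProduct, PiLp.inner_apply]
      simp [mul_comm]
    simp only [h2]
    rw [b.sum_sq_norm_inner_left, EuclideanSpace.norm_sq_eq]
    simp only [norm_star]
  have hfin : (m : ℝ) * (γ - β) ^ 2 ≤ 2 * ∑ i, ∑ j, ‖(M - N) i j‖ ^ 2 := by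
    calc (m : ℝ) * (γ - β) ^ 2 = ∑ l : Fin m, (γ - β) ^ 2 := by simp
      _ ≤ ∑ l, ∑ i, ‖∑ j, c i j * inner ℂ (b j) (x l)‖ ^ 2 := Finset.sum_le_sum fun l _ => hquad2 l
      _ = ∑ i, ∑ l, ‖∑ j, c i j * inner ℂ (b j) (x l)‖ ^ 2 := Finset.sum_comm
      _ ≤ ∑ i, ∑ j, ‖c i j‖ ^ 2 := Finset.sum_le_sum fun i _ => hbessel i
      _ ≤ _ := hfro ▸ hc
  refine le_trans (mul_le_mul_of_nonneg_right ?_ (sq_nonneg _)) hfin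
  rw [hcard]
  have : ((B.card + Module.finrank ℂ G : ℕ) : ℝ) ≤ ((p + m : ℕ) : ℝ) := by exact_mod_cast hdim
  push_cast at this
  linarith

end CommonVAR

/-! ### Frobenius and operator norms, orthogonal projections. -/

namespace CommonVAR

section Frobenius
open scoped Matrix.Norms.L2Operator

variable {l m n : Type*} [Fintype l] [Fintype m] [Fintype n]

theorem frobNorm_nonneg (M : Matrix m n ℝ) : 0 ≤ frobNorm M := Real.sqrt_nonneg _

theorem frobNorm_sq (M : Matrix m n ℝ) : frobNorm M ^ 2 = ∑ i, ∑ j, M i j ^ 2 :=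
  Real.sq_sqrt (Finset.sum_nonneg fun _ _ => Finset.sum_nonneg fun _ _ => sq_nonneg _)

theorem frobNorm_transpose (M : Matrix m n ℝ) : frobNorm Mᵀ = frobNorm M := by
  rw [frobNorm, frobNorm, Finset.sum_comm]; rfl

theorem frobNorm_eq_norm (M : Matrix m n ℝ) :
    frobNorm M = @norm _ (Matrix.frobeniusNormedAddCommGroup).toNorm M := by
  rw [Matrix.frobenius_norm_def, frobNorm, Real.sqrt_eq_rpow]
  simp

theorem frobNorm_add_le (M N : Matrix m n ℝ) : frobNorm (M + N) ≤ frobNorm M + frobNorm N := by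
  simp only [frobNorm_eq_norm]
  exact @norm_add_le _ (Matrix.frobeniusNormedAddCommGroup).toSeminormedAddCommGroup.toSeminormedAddGroup M N

theorem frobNorm_neg (M : Matrix m n ℝ) : frobNorm (-M) = frobNorm M := by
  simp [frobNorm]

theorem frobNorm_sub_le (M N : Matrix m n ℝ) : frobNorm (M - N) ≤ frobNorm M + frobNorm N := by
  rw [sub_eq_add_neg, ← frobNorm_neg N]; exact frobNorm_add_le _ _

theorem frobNorm_sub_rev (M N : Matrix m n ℝ) : frobNorm (M - N) = frobNorm (N - M) := by
  rw [← frobNorm_neg, neg_sub]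

theorem trace_transpose_mul_self (M : Matrix m n ℝ) : (Mᵀ * M).trace = frobNorm M ^ 2 := by
  rw [frobNorm_sq, Finset.sum_comm]
  simp [Matrix.trace, Matrix.mul_apply, sq]

variable [DecidableEq l] [DecidableEq m] [DecidableEq n]

/-- With `l2_opNorm_le_of_forall`, this translates the operator norm into dot products of plain
functions, the form used for vectors throughout. -/
theorem dotProduct_mulVec_self_le (P : Matrix m n ℝ) (x : n → ℝ) :
    (P *ᵥ x) ⬝ᵥ (P *ᵥ x) ≤ ‖P‖ ^ 2 * (x ⬝ᵥ x) := by
  have h := Matrix.l2_opNorm_mulVec P (WithLp.toLp 2 x)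
  have h2 := pow_le_pow_left₀ (norm_nonneg _) h 2
  rw [mul_pow, EuclideanSpace.norm_sq_eq, EuclideanSpace.norm_sq_eq] at h2
  simpa [dotProduct, ← sq] using h2

theorem l2_opNorm_le_of_forall (P : Matrix m n ℝ) (c : ℝ) (hc : 0 ≤ c)
    (h : ∀ x, (P *ᵥ x) ⬝ᵥ (P *ᵥ x) ≤ c ^ 2 * (x ⬝ᵥ x)) : ‖P‖ ≤ c := by
  rw [Matrix.l2_opNorm_def]
  refine ContinuousLinearMap.opNorm_le_bound _ hc fun x => ?_
  refine le_of_sq_le_sq ?_ (by positivity)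
  have := h x.ofLp
  rw [mul_pow, EuclideanSpace.norm_sq_eq, EuclideanSpace.norm_sq_eq]
  simpa [dotProduct, ← sq] using this

theorem frobNorm_mul_le_left (P : Matrix l m ℝ) (M : Matrix m n ℝ) :
    frobNorm (P * M) ≤ ‖P‖ * frobNorm M := by
  refine le_of_sq_le_sq ?_ (mul_nonneg (norm_nonneg _) (frobNorm_nonneg _))
  rw [mul_pow, frobNorm_sq, frobNorm_sq, Finset.sum_comm, Finset.sum_comm (f := fun i j => M i j ^ 2),
    Finset.mul_sum]
  refine Finset.sum_le_sum fun j _ => ?_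
  have := dotProduct_mulVec_self_le P (fun i => M i j)
  simpa [dotProduct, ← sq, Matrix.mul_apply, Matrix.mulVec] using this

theorem l2_opNorm_transpose (P : Matrix m n ℝ) : ‖Pᵀ‖ = ‖P‖ := by
  have := Matrix.l2_opNorm_conjTranspose P
  rwa [Matrix.conjTranspose_eq_transpose_of_trivial] at this

theorem frobNorm_mul_le_right (M : Matrix l m ℝ) (P : Matrix m n ℝ) :
    frobNorm (M * P) ≤ frobNorm M * ‖P‖ := by
  rw [← frobNorm_transpose, Matrix.transpose_mul, ← frobNorm_transpose M, ← l2_opNorm_transpose P,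
    mul_comm]
  exact frobNorm_mul_le_left _ _

theorem l2_opNorm_one_le : ‖(1 : Matrix n n ℝ)‖ ≤ 1 :=
  l2_opNorm_le_of_forall _ _ zero_le_one (by simp)

theorem l2_opNorm_orthonormal_le {W : Matrix m n ℝ} (hW : IsOrthonormal W) : ‖W‖ ≤ 1 :=
  l2_opNorm_le_of_forall _ _ zero_le_one fun x => by
    rw [Matrix.dotProduct_mulVec, Matrix.vecMul_mulVec, ← Matrix.dotProduct_mulVec,
      (show Wᵀ * W = 1 from hW)]
    simp

theorem l2_opNorm_proj_le {W : Matrix m n ℝ} (hW : IsOrthonormal W) : ‖W * Wᵀ‖ ≤ 1 := by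
  refine (Matrix.l2_opNorm_mul _ _).trans ?_
  rw [l2_opNorm_transpose]
  exact mul_le_one₀ (l2_opNorm_orthonormal_le hW) (norm_nonneg _) (l2_opNorm_orthonormal_le hW)

theorem proj_mul_proj {W : Matrix m n ℝ} (hW : IsOrthonormal W) : W * Wᵀ * (W * Wᵀ) = W * Wᵀ := by
  rw [Matrix.mul_assoc, ← Matrix.mul_assoc Wᵀ, (show Wᵀ * W = 1 from hW), Matrix.one_mul]

theorem transpose_compl_proj (W : Matrix m n ℝ) : (1 - W * Wᵀ)ᵀ = 1 - W * Wᵀ := by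
  simp [Matrix.transpose_sub, Matrix.transpose_mul]

theorem compl_proj_mul_compl_proj {W : Matrix m n ℝ} (hW : IsOrthonormal W) :
    (1 - W * Wᵀ) * (1 - W * Wᵀ) = 1 - W * Wᵀ := by
  rw [Matrix.sub_mul, Matrix.mul_sub, Matrix.mul_sub, proj_mul_proj hW]
  simp

theorem l2_opNorm_compl_proj_le {W : Matrix m n ℝ} (hW : IsOrthonormal W) :
    ‖1 - W * Wᵀ‖ ≤ 1 := by
  have h := Matrix.l2_opNorm_conjTranspose_mul_self (1 - W * Wᵀ)
  rw [Matrix.conjTranspose_eq_transpose_of_trivial, transpose_compl_proj,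
    compl_proj_mul_compl_proj hW] at h
  nlinarith [norm_nonneg (1 - W * Wᵀ)]

/-- Distance of two projections of the same rank. -/
theorem frobNorm_proj_sub_proj_sq {k : Type*} [Fintype k] [DecidableEq k]
    {W : Matrix m n ℝ} {W' : Matrix m k ℝ} (hW : IsOrthonormal W)
    (hW' : IsOrthonormal W') (hcard : Fintype.card n = Fintype.card k) :
    frobNorm (W' * W'ᵀ - W * Wᵀ) ^ 2 = 2 * frobNorm ((1 - W * Wᵀ) * W') ^ 2 := by
  -- As traces, both sides equal `2(k - tr(W'W'ᵀWWᵀ))`, where `k` is the common rank.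
  rw [← trace_transpose_mul_self, ← trace_transpose_mul_self]
  have h1 : ((1 - W * Wᵀ) * W')ᵀ * ((1 - W * Wᵀ) * W') = 1 - W'ᵀ * (W * Wᵀ) * W' := by
    rw [Matrix.transpose_mul, transpose_compl_proj, Matrix.mul_assoc, ← Matrix.mul_assoc (1 - _),
      compl_proj_mul_compl_proj hW, Matrix.sub_mul, Matrix.mul_sub, Matrix.one_mul,
      (show W'ᵀ * W' = 1 from hW'), Matrix.mul_assoc W'ᵀ]
  have h2 : (W' * W'ᵀ - W * Wᵀ)ᵀ * (W' * W'ᵀ - W * Wᵀ)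
      = W' * W'ᵀ + W * Wᵀ - W' * W'ᵀ * (W * Wᵀ) - W * Wᵀ * (W' * W'ᵀ) := by
    simp only [Matrix.transpose_sub, Matrix.transpose_mul, Matrix.transpose_transpose,
      Matrix.sub_mul, Matrix.mul_sub, proj_mul_proj hW, proj_mul_proj hW']
    abel
  rw [h1, h2]
  simp only [Matrix.trace_sub, Matrix.trace_add]
  rw [Matrix.trace_mul_comm (W * Wᵀ) (W' * W'ᵀ), Matrix.trace_mul_comm W', Matrix.trace_mul_comm W,
    (show W'ᵀ * W' = 1 from hW'), (show Wᵀ * W = 1 from hW), Matrix.trace_mul_comm (W'ᵀ * (W * Wᵀ)),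
    ← Matrix.mul_assoc W', Matrix.trace_one, Matrix.trace_one, hcard]
  ring

end Frobenius

end CommonVAR

/-! ### Perturbation of top eigenspaces without symmetry. -/

namespace CommonVAR

/-- The cross terms between real and imaginary parts are purely imaginary, so lower bounds for a
real quadratic form pass to complex vectors. -/
theorem re_inner_toEuclideanLin_map_ofReal {p : ℕ} (N : Matrix (Fin p) (Fin p) ℝ)
    (x : EuclideanSpace ℂ (Fin p)) :
    (inner ℂ x (Matrix.toEuclideanLin (N.map (algebraMap ℝ ℂ)) x)).re
      = (fun i => (x i).re) ⬝ᵥ N *ᵥ (fun i => (x i).re)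
        + (fun i => (x i).im) ⬝ᵥ N *ᵥ (fun i => (x i).im) := by
  simp only [Matrix.toLpLin_apply, Matrix.mulVec, dotProduct, PiLp.inner_apply, Complex.re_sum,
    ← Finset.sum_add_distrib]
  refine Finset.sum_congr rfl fun i _ => ?_
  simp [Complex.mul_re]
  ring

/-- **Perturbation of top eigenvectors.** The unperturbed matrix is `W K Wᵀ` with `W` orthonormal
and `K ≥ γ`; the perturbed one is arbitrary. -/
theorem frobNorm_compl_proj_mul_topEigenvectors_sq_le {p k : ℕ} (N' : Matrix (Fin p) (Fin p) ℝ)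
    (W W' : Matrix (Fin p) (Fin k) ℝ) (hW : IsOrthonormal W) (K : Matrix (Fin k) (Fin k) ℝ)
    (hK : Kᵀ = K) {γ : ℝ} (hγ : 0 < γ) (hKγ : ∀ c, γ * (c ⬝ᵥ c) ≤ c ⬝ᵥ K *ᵥ c)
    (hTop : IsTopEigenvectors N' W') :
    γ ^ 2 * frobNorm ((1 - W * Wᵀ) * W') ^ 2 ≤ 12 * frobNorm (N' - W * K * Wᵀ) ^ 2 := by
  classical
  obtain ⟨hW', lam, hanti, heig, rest, hroots, hrest⟩ := hTop
  set E := N' - W * K * Wᵀ with hE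
  set Q := 1 - W * Wᵀ with hQ
  have hQW : Q * W = 0 := by
    rw [hQ, Matrix.sub_mul, Matrix.mul_assoc, (show Wᵀ * W = 1 from hW)]; simp
  set f : Fin k → ℝ := fun j => ∑ i, (Q * W') i j ^ 2 with hf
  have hfro : frobNorm (Q * W') ^ 2 = ∑ j, f j := by rw [frobNorm_sq, Finset.sum_comm]
  -- `Q` annihilates the unperturbed matrix, so the eigenvector equation multiplied by `Q` only sees
  -- `E`. It makes column `j` of `Q * W'` small wherever `lam j` is large.
  have hQE : Q * E * W' = Q * W' * Matrix.diagonal lam := by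
    rw [hE, Matrix.mul_sub, Matrix.mul_assoc W, ← Matrix.mul_assoc Q W, hQW, Matrix.zero_mul,
      sub_zero, Matrix.mul_assoc, heig, Matrix.mul_assoc]
  have hsum : ∑ j, lam j ^ 2 * f j ≤ frobNorm E ^ 2 := by
    have h1 : ∑ j, lam j ^ 2 * f j = frobNorm (Q * E * W') ^ 2 := by
      rw [frobNorm_sq, Finset.sum_comm, hQE]
      refine Finset.sum_congr rfl fun j _ => ?_
      rw [hf, Finset.mul_sum]
      refine Finset.sum_congr rfl fun i _ => ?_
      rw [Matrix.mul_diagonal]; ring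
    rw [h1]
    refine pow_le_pow_left₀ (frobNorm_nonneg _) ?_ 2
    refine (frobNorm_mul_le_right _ _).trans ?_
    refine (mul_le_of_le_one_right (frobNorm_nonneg _) (l2_opNorm_orthonormal_le hW')).trans ?_
    refine (frobNorm_mul_le_left _ _).trans ?_
    exact mul_le_of_le_one_left (frobNorm_nonneg _) (l2_opNorm_compl_proj_le hW)
  have hf0 : ∀ j, 0 ≤ f j := fun j => Finset.sum_nonneg fun _ _ => sq_nonneg _
  have hf1 : ∀ j, f j ≤ 1 := by
    intro j
    have h1 : Q * W' = Q * W' := rfl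
    have h2 := dotProduct_mulVec_self_le Q (fun i => W' i j)
    have h3 : (fun i => W' i j) ⬝ᵥ (fun i => W' i j) = 1 := by
      have := congrFun (congrFun (show W'ᵀ * W' = 1 from hW') j) j
      simpa [Matrix.mul_apply, dotProduct] using this
    rw [h3, mul_one] at h2
    have h4 : f j = (Q *ᵥ fun i => W' i j) ⬝ᵥ (Q *ᵥ fun i => W' i j) := by
      simp [hf, dotProduct, Matrix.mulVec, Matrix.mul_apply, sq]
    rw [h4]
    have h5 := l2_opNorm_compl_proj_le hW
    rw [← hQ] at h5
    exact h2.trans (pow_le_one₀ (by rw [Matrix.l2_opNorm_def]; exact norm_nonneg _) h5)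
  -- For the remaining indices `γ² ≤ 4 lam²`, which costs `4‖E‖²`. Bad indices contribute at most
  -- `γ²` each and are merely counted, which costs `8‖E‖²`; together this gives 12.
  set bad : Finset (Fin k) := Finset.univ.filter (fun j => lam j ≤ γ / 2) with hbad
  have hcardbad : (bad.card : ℝ) * (γ / 2) ^ 2 ≤ 2 * frobNorm E ^ 2 := by
    rcases bad.eq_empty_or_nonempty with h | ⟨j₀, hj₀⟩
    · rw [h]; simp; positivity
    have hj₀' : lam j₀ ≤ γ / 2 := (Finset.mem_filter.1 hj₀).2
    set M : Matrix (Fin p) (Fin p) ℂ := N'.map (algebraMap ℝ ℂ) with hM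
    set N : Matrix (Fin p) (Fin p) ℂ := (W * K * Wᵀ).map (algebraMap ℝ ℂ) with hN
    have hNh : N.IsHermitian := by
      have : (W * K * Wᵀ)ᵀ = W * K * Wᵀ := by
        simp [Matrix.transpose_mul, hK, Matrix.mul_assoc]
      rw [Matrix.IsHermitian, hN]
      ext i j
      have h := congrFun (congrFun this i) j
      simp only [Matrix.conjTranspose_apply, Matrix.map_apply]
      rw [← h]
      simp
    set G := LinearMap.range (Matrix.toEuclideanLin (W.map (algebraMap ℝ ℂ))) with hG
    have hGrank : Module.finrank ℂ G = k := by
      rw [hG, LinearMap.finrank_range_of_inj]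
      · simp
      · intro a b hab
        have h1 : (W.map (algebraMap ℝ ℂ))ᵀ * W.map (algebraMap ℝ ℂ) = 1 := by
          rw [← Matrix.transpose_map, ← Matrix.map_mul, (show Wᵀ * W = 1 from hW)]
          simp
        have h2 : ∀ z : EuclideanSpace ℂ (Fin k), (W.map (algebraMap ℝ ℂ))ᵀ *ᵥ
            (Matrix.toEuclideanLin (W.map (algebraMap ℝ ℂ)) z).ofLp = z.ofLp := by
          intro z
          rw [Matrix.toLpLin_apply, Matrix.mulVec_mulVec, h1, Matrix.one_mulVec]
        have := h2 a
        rw [hab, h2 b] at this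
        ext i
        exact (congrFun this i).symm
    have hquad : ∀ x ∈ G, γ * ‖x‖ ^ 2 ≤ (inner ℂ x (Matrix.toEuclideanLin N x)).re := by
      rintro _ ⟨c, rfl⟩
      rw [hN, re_inner_toEuclideanLin_map_ofReal]
      have hre : (fun i => ((Matrix.toEuclideanLin (W.map (algebraMap ℝ ℂ)) c) i).re)
          = W *ᵥ (fun i => (c i).re) := by
        ext i; simp [Matrix.toLpLin_apply, Matrix.mulVec, dotProduct]
      have him : (fun i => ((Matrix.toEuclideanLin (W.map (algebraMap ℝ ℂ)) c) i).im)
          = W *ᵥ (fun i => (c i).im) := by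
        ext i; simp [Matrix.toLpLin_apply, Matrix.mulVec, dotProduct]
      have hnorm : ∀ z : EuclideanSpace ℂ (Fin p), ‖z‖ ^ 2
          = (fun i => (z i).re) ⬝ᵥ (fun i => (z i).re)
            + (fun i => (z i).im) ⬝ᵥ (fun i => (z i).im) := by
        intro z
        rw [EuclideanSpace.norm_sq_eq]
        simp only [dotProduct, ← Finset.sum_add_distrib]
        exact Finset.sum_congr rfl fun i _ => by
          rw [← Complex.normSq_eq_norm_sq, Complex.normSq_apply]
      have hiso : ∀ a : Fin k → ℝ, (W *ᵥ a) ⬝ᵥ (W *ᵥ a) = a ⬝ᵥ a := by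
        intro a
        rw [Matrix.dotProduct_mulVec, Matrix.vecMul_mulVec, ← Matrix.dotProduct_mulVec,
          (show Wᵀ * W = 1 from hW), Matrix.one_mulVec]
      have hval : ∀ a : Fin k → ℝ, (W *ᵥ a) ⬝ᵥ ((W * K * Wᵀ) *ᵥ (W *ᵥ a)) = a ⬝ᵥ K *ᵥ a := by
        intro a
        rw [Matrix.mulVec_mulVec, Matrix.mul_assoc _ Wᵀ, (show Wᵀ * W = 1 from hW), Matrix.mul_one,
          Matrix.dotProduct_mulVec, Matrix.vecMul_mulVec, ← Matrix.dotProduct_mulVec,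
          ← Matrix.mul_assoc, (show Wᵀ * W = 1 from hW), Matrix.one_mul]
      rw [hnorm, hre, him, hiso, hiso, hval, hval, mul_add]
      exact add_le_add (hKγ _) (hKγ _)
    have hmain := card_roots_re_le_of_quadForm_ge M N hNh G γ (γ / 2) (by linarith) hquad
    -- Once one selected eigenvalue is at most `γ / 2`, so is the real part of every unselected one.
    -- The small eigenvalues then number `bad.card + (p - k)`, and the excess over codimension `p -
    -- k` is `bad.card`.
    have hroots' : (M.charpoly.roots.filter (fun z => z.re ≤ γ / 2)).card
        = bad.card + rest.card := by
      rw [hM, hroots, Multiset.filter_add, Multiset.card_add, Multiset.filter_map,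
        Multiset.card_map, Multiset.filter_eq_self (s := rest).2]
      · rfl
      · intro z hz
        exact (hrest z hz j₀).trans hj₀'
    have hp : k + rest.card = p := by
      have h1 : M.charpoly.roots.card = p := by
        rw [IsAlgClosed.card_roots_eq_natDegree, Matrix.charpoly_natDegree_eq_dim, Fintype.card_fin]
      rw [← h1, hM, hroots, Multiset.card_add]
      simp
    have hnum : (((M.charpoly.roots.filter (fun z => z.re ≤ γ / 2)).card : ℝ)
        + Module.finrank ℂ G - p) = bad.card := by
      rw [hroots', hGrank, ← hp]; push_cast; ring
    have hEM : ∑ i, ∑ j, ‖(M - N) i j‖ ^ 2 = frobNorm E ^ 2 := by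
      rw [frobNorm_sq]
      refine Finset.sum_congr rfl fun i _ => Finset.sum_congr rfl fun j _ => ?_
      simp only [hM, hN, Matrix.sub_apply, Matrix.map_apply, hE, ← map_sub]
      rw [norm_algebraMap', Real.norm_eq_abs, sq_abs]
    rw [hnum, hEM] at hmain
    calc (bad.card : ℝ) * (γ / 2) ^ 2 = bad.card * (γ - γ / 2) ^ 2 := by ring
      _ ≤ _ := hmain
  rw [hfro]
  have h1 : ∀ j, γ ^ 2 * f j ≤ 4 * (lam j ^ 2 * f j) + if lam j ≤ γ / 2 then γ ^ 2 else 0 := by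
    intro j
    split_ifs with h
    · have := mul_le_mul_of_nonneg_left (hf1 j) (sq_nonneg γ)
      have := mul_nonneg (sq_nonneg (lam j)) (hf0 j)
      linarith
    · push Not at h
      have h2 : γ ^ 2 ≤ 4 * lam j ^ 2 := by nlinarith
      have := mul_le_mul_of_nonneg_right h2 (hf0 j)
      linarith
  rw [Finset.mul_sum]
  refine (Finset.sum_le_sum fun j _ => h1 j).trans ?_
  rw [Finset.sum_add_distrib, ← Finset.mul_sum, ← Finset.sum_filter, Finset.sum_const, nsmul_eq_mul]
  have h3 : (bad.card : ℝ) * γ ^ 2 ≤ 8 * frobNorm E ^ 2 := by nlinarith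
  linarith

theorem frobNorm_proj_topEigenvectors_sub_le {p k : ℕ} (N' : Matrix (Fin p) (Fin p) ℝ)
    (W W' : Matrix (Fin p) (Fin k) ℝ) (hW : IsOrthonormal W) (K : Matrix (Fin k) (Fin k) ℝ)
    (hK : Kᵀ = K) {γ : ℝ} (hγ : 0 < γ) (hKγ : ∀ c, γ * (c ⬝ᵥ c) ≤ c ⬝ᵥ K *ᵥ c)
    (hTop : IsTopEigenvectors N' W') :
    γ * frobNorm (W' * W'ᵀ - W * Wᵀ) ≤ 5 * frobNorm (N' - W * K * Wᵀ) := by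
  refine le_of_sq_le_sq ?_ (mul_nonneg (by norm_num) (frobNorm_nonneg _))
  rw [mul_pow, frobNorm_proj_sub_proj_sq hW hTop.1 rfl]
  have := frobNorm_compl_proj_mul_topEigenvectors_sq_le N' W W' hW K hK hγ hKγ hTop
  -- The constant 5 absorbs `2 * 12 ≤ 5 ^ 2`.
  nlinarith [sq_nonneg (frobNorm (N' - W * K * Wᵀ))]

end CommonVAR

/-! ### Singular values and perturbation of column spaces. -/

namespace CommonVAR

section SingularValues

variable {E F : Type*} [NormedAddCommGroup E] [InnerProductSpace ℝ E] [FiniteDimensional ℝ E]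
  [NormedAddCommGroup F] [InnerProductSpace ℝ F] [FiniteDimensional ℝ F]

theorem norm_sq_eq_sum_singularValues (T : E →ₗ[ℝ] F) (x : E) :
    ‖T x‖ ^ 2 = ∑ i : Fin (Module.finrank ℝ E), T.singularValues i ^ 2 *
      (inner ℝ (T.isSymmetric_adjoint_comp_self.eigenvectorBasis rfl i) x) ^ 2 := by
  have h1 : ‖T x‖ ^ 2 = inner ℝ x ((LinearMap.adjoint T ∘ₗ T) x) := by
    rw [LinearMap.comp_apply, LinearMap.adjoint_inner_right, real_inner_self_eq_norm_sq]
  rw [h1, ← (T.isSymmetric_adjoint_comp_self.eigenvectorBasis rfl).sum_inner_mul_inner]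
  refine Finset.sum_congr rfl fun i _ => ?_
  rw [← T.isSymmetric_adjoint_comp_self, LinearMap.IsSymmetric.apply_eigenvectorBasis,
    ← T.sq_singularValues_fin rfl]
  rw [real_inner_comm]
  simp [inner_smul_left]
  ring

theorem norm_le_singularValues_zero (T : E →ₗ[ℝ] F) (x : E) :
    ‖T x‖ ^ 2 ≤ T.singularValues 0 ^ 2 * ‖x‖ ^ 2 := by
  rw [norm_sq_eq_sum_singularValues,
    ← (T.isSymmetric_adjoint_comp_self.eigenvectorBasis rfl).sum_sq_norm_inner_right x,
    Finset.mul_sum]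
  refine Finset.sum_le_sum fun i _ => ?_
  rw [Real.norm_eq_abs, sq_abs]
  exact mul_le_mul_of_nonneg_right (pow_le_pow_left₀ (T.singularValues_nonneg _)
    (T.singularValues_antitone (Nat.zero_le _)) 2) (sq_nonneg _)

/-- Right singular vectors with zero singular value lie in the kernel, so a vector orthogonal to the
kernel has no component along them; the other singular values are at least the one of index `r - 1`.
-/
theorem singularValues_rank_sub_one_le (T : E →ₗ[ℝ] F) {r : ℕ}
    (hr : Module.finrank ℝ (LinearMap.range T) = r) (x : E)
    (hx : ∀ z, T z = 0 → inner ℝ z x = 0) :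
    T.singularValues (r - 1) ^ 2 * ‖x‖ ^ 2 ≤ ‖T x‖ ^ 2 := by
  rw [norm_sq_eq_sum_singularValues,
    ← (T.isSymmetric_adjoint_comp_self.eigenvectorBasis rfl).sum_sq_norm_inner_right x,
    Finset.mul_sum]
  refine Finset.sum_le_sum fun i _ => ?_
  rw [Real.norm_eq_abs, sq_abs]
  by_cases hi : (i : ℕ) < r
  · exact mul_le_mul_of_nonneg_right (pow_le_pow_left₀ (T.singularValues_nonneg _)
      (T.singularValues_antitone (by omega)) 2) (sq_nonneg _)
  · have h0 : T.singularValues i = 0 := T.singularValues_eq_zero_iff_le_finrank_range.2 (by omega)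
    have h1 : T (T.isSymmetric_adjoint_comp_self.eigenvectorBasis rfl i) = 0 := by
      rw [← norm_eq_zero, ← sq_eq_zero_iff, norm_sq_eq_sum_singularValues]
      refine Finset.sum_eq_zero fun j _ => ?_
      by_cases hij : j = i
      · subst hij; rw [h0]; simp
      · rw [(T.isSymmetric_adjoint_comp_self.eigenvectorBasis rfl).orthonormal.2 hij]; simp
    rw [hx _ h1]
    simp

end SingularValues

open scoped Matrix.Norms.L2Operator

theorem l2_opNorm_le_sigma_zero {m n : ℕ} (M : Matrix (Fin m) (Fin n) ℝ) : ‖M‖ ≤ sigma M 0 := by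
  refine l2_opNorm_le_of_forall _ _ (LinearMap.singularValues_nonneg _ _) fun x => ?_
  have := norm_le_singularValues_zero (Matrix.toEuclideanLin M) (WithLp.toLp 2 x)
  rw [EuclideanSpace.norm_sq_eq, EuclideanSpace.norm_sq_eq] at this
  simpa [dotProduct, ← sq, sigma, Matrix.toLpLin_apply] using this

theorem finrank_range_toEuclideanLin {m n : ℕ} (M : Matrix (Fin m) (Fin n) ℝ) :
    Module.finrank ℝ (LinearMap.range (Matrix.toEuclideanLin M)) = M.rank := by
  rw [Matrix.toEuclideanLin, Matrix.toLpLin_eq_toLin, ← Matrix.rank_eq_finrank_range_toLin]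

theorem sigma_rank_sub_one_pos {m n r : ℕ} (M : Matrix (Fin m) (Fin n) ℝ) (hM : M.rank = r)
    (hr : 0 < r) : 0 < sigma M (r - 1) := by
  rw [sigma, LinearMap.singularValues_pos_iff_lt_finrank_range, finrank_range_toEuclideanLin]
  omega

theorem sigma_le_sigma_zero {m n : ℕ} (M : Matrix (Fin m) (Fin n) ℝ) (i : ℕ) :
    sigma M i ≤ sigma M 0 := LinearMap.singularValues_antitone _ (Nat.zero_le _)

/-- The core of a rank factorization with orthonormal factors is invertible, with inverse bounded
through the smallest nonzero singular value. -/
theorem exists_inv_core {p r : ℕ} {κ : Type*} [Fintype κ] [DecidableEq κ]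
    (hκ : Fintype.card κ = r) (hr : 0 < r)
    (A : Matrix (Fin p) (Fin p) ℝ) (hA : A.rank = r) (U V : Matrix (Fin p) κ ℝ)
    (D : Matrix κ κ ℝ) (hU : IsOrthonormal U) (hV : IsOrthonormal V) (hAD : A = U * D * Vᵀ) :
    ∃ D' : Matrix κ κ ℝ, D * D' = 1 ∧ D' * D = 1 ∧ ‖D'‖ ≤ (sigma A (r - 1))⁻¹ := by
  have hσ := sigma_rank_sub_one_pos A hA hr
  have hDunit : IsUnit D := by
    have hle : Fintype.card κ ≤ D.rank := by
      rw [hκ, ← hA, hAD]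
      exact (Matrix.rank_mul_le_left _ _).trans (Matrix.rank_mul_le_right _ _)
    rw [← Matrix.mulVec_surjective_iff_isUnit]
    have htop : LinearMap.range D.mulVecLin = ⊤ := by
      apply Submodule.eq_top_of_finrank_eq
      rw [Module.finrank_fintype_fun_eq_card]
      exact le_antisymm (Matrix.rank_le_card_width D) hle
    exact LinearMap.range_eq_top.1 htop
  have hdet := (Matrix.isUnit_iff_isUnit_det D).1 hDunit
  have hinv1 := Matrix.mul_nonsing_inv D hdet
  have hinv2 := Matrix.nonsing_inv_mul D hdet
  refine ⟨D⁻¹, hinv1, hinv2, ?_⟩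
  have hiso : ∀ {W : Matrix (Fin p) κ ℝ}, IsOrthonormal W → ∀ a b : κ → ℝ,
      (W *ᵥ a) ⬝ᵥ (W *ᵥ b) = a ⬝ᵥ b := by
    intro W hW a b
    rw [Matrix.dotProduct_mulVec, Matrix.vecMul_mulVec, ← Matrix.dotProduct_mulVec,
      (show Wᵀ * W = 1 from hW), Matrix.one_mulVec]
  have hlow : ∀ c : κ → ℝ, sigma A (r - 1) ^ 2 * (c ⬝ᵥ c) ≤ (D *ᵥ c) ⬝ᵥ (D *ᵥ c) := by
    intro c
    have hAV : A *ᵥ (V *ᵥ c) = U *ᵥ (D *ᵥ c) := by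
      rw [hAD, Matrix.mulVec_mulVec, Matrix.mul_assoc _ Vᵀ, (show Vᵀ * V = 1 from hV),
        Matrix.mul_one, Matrix.mulVec_mulVec]
    have h1 := singularValues_rank_sub_one_le (Matrix.toEuclideanLin A) (r := r)
      (by rw [finrank_range_toEuclideanLin, hA]) (WithLp.toLp 2 (V *ᵥ c)) (by
        intro z hz
        have hz' : A *ᵥ z.ofLp = 0 := by
          have := congrArg WithLp.ofLp hz
          simpa [Matrix.toLpLin_apply] using this
        -- `Vᵀ = D⁻¹ Uᵀ A`, hence the kernel of `A` is orthogonal to the range of `V` and the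
        -- smallest nonzero singular value applies to `V *ᵥ c`.
        have h2 : Vᵀ *ᵥ z.ofLp = 0 := by
          have h3 : (D⁻¹ * (Uᵀ * A)) *ᵥ z.ofLp = 0 := by
            rw [← Matrix.mulVec_mulVec, ← Matrix.mulVec_mulVec, hz']; simp
          rwa [hAD, Matrix.mul_assoc U, ← Matrix.mul_assoc Uᵀ, (show Uᵀ * U = 1 from hU),
            Matrix.one_mul, ← Matrix.mul_assoc, hinv2, Matrix.one_mul] at h3
        have h4 : z.ofLp ⬝ᵥ (V *ᵥ c) = 0 := by
          rw [Matrix.dotProduct_mulVec, ← Matrix.mulVec_transpose, h2, zero_dotProduct]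
        rw [PiLp.inner_apply, ← h4]
        simp [dotProduct, mul_comm])
    rw [EuclideanSpace.norm_sq_eq, EuclideanSpace.norm_sq_eq] at h1
    have h5 : sigma A (r - 1) ^ 2 * ((V *ᵥ c) ⬝ᵥ (V *ᵥ c))
        ≤ (A *ᵥ (V *ᵥ c)) ⬝ᵥ (A *ᵥ (V *ᵥ c)) := by
      simpa [dotProduct, ← sq, sigma, Matrix.toLpLin_apply] using h1
    rwa [hAV, hiso hU, hiso hV] at h5
  refine l2_opNorm_le_of_forall _ _ (inv_nonneg.2 hσ.le) fun x => ?_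
  have h := hlow (D⁻¹ *ᵥ x)
  rw [Matrix.mulVec_mulVec, hinv1, Matrix.one_mulVec] at h
  rw [inv_pow, inv_mul_eq_div, le_div_iff₀ (by positivity)]
  linarith

/-- Perturbation of the column space of a matrix of rank `r`. -/
theorem frobNorm_proj_sub_le_of_eq_mul {p r : ℕ} {κ : Type*} [Fintype κ] [DecidableEq κ]
    (hκ : Fintype.card κ = r) {A A' : Matrix (Fin p) (Fin p) ℝ} {U V : Matrix (Fin p) κ ℝ}
    {D D' : Matrix κ κ ℝ} {s : ℝ} (hU : IsOrthonormal U) (hV : IsOrthonormal V)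
    (hAD : A = U * D * Vᵀ) (hDD' : D * D' = 1) (hs : ‖D'‖ ≤ s)
    {U' : Matrix (Fin p) (Fin r) ℝ} {S : Matrix (Fin r) (Fin p) ℝ} (hU' : IsOrthonormal U')
    (hA' : A' = U' * S) :
    frobNorm (U' * U'ᵀ - U * Uᵀ) ≤ 2 * s * frobNorm (A' - A) := by
  have hs0 : 0 ≤ s := (norm_nonneg _).trans hs
  set Q := 1 - U' * U'ᵀ with hQ
  have h0 : Q * A' = 0 := by
    rw [hA', hQ, ← Matrix.mul_assoc, Matrix.sub_mul, Matrix.mul_assoc U',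
      (show U'ᵀ * U' = 1 from hU')]
    simp
  -- `U = A V D'` and `Q` kills `A'`. This uses only that the columns of `A'` lie in the range of
  -- `U'`: no gap in the singular values of `A'` is needed.
  have h1 : Q * U = Q * (A - A') * (V * D') := by
    rw [Matrix.mul_sub, h0, sub_zero, hAD]
    simp only [Matrix.mul_assoc]
    rw [← Matrix.mul_assoc Vᵀ, (show Vᵀ * V = 1 from hV), Matrix.one_mul, hDD', Matrix.mul_one]
  have h2 : frobNorm (Q * U) ≤ s * frobNorm (A' - A) := by
    rw [h1, frobNorm_sub_rev A' A, mul_comm]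
    refine (frobNorm_mul_le_right _ _).trans ?_
    have h3 : frobNorm (Q * (A - A')) ≤ frobNorm (A - A') :=
      (frobNorm_mul_le_left _ _).trans
        (mul_le_of_le_one_left (frobNorm_nonneg _) (l2_opNorm_compl_proj_le hU'))
    have h4 : ‖V * D'‖ ≤ s := by
      refine (Matrix.l2_opNorm_mul _ _).trans ?_
      exact (mul_le_of_le_one_left (norm_nonneg _) (l2_opNorm_orthonormal_le hV)).trans hs
    exact mul_le_mul h3 h4 (norm_nonneg _) (frobNorm_nonneg _)
  have h5 := frobNorm_proj_sub_proj_sq (W := U') (W' := U) hU' hU (by simp [hκ])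
  rw [frobNorm_sub_rev]
  have h6 : 0 ≤ s * frobNorm (A' - A) := mul_nonneg hs0 (frobNorm_nonneg _)
  refine le_of_sq_le_sq ?_ (by linarith)
  have h7 := pow_le_pow_left₀ (frobNorm_nonneg _) h2 2
  rw [h5]
  nlinarith

end CommonVAR

/-! ### Deterministic error propagation through the spectral initialization. -/

namespace CommonVAR

open scoped Matrix.Norms.L2Operator

theorem isOrthonormal_of_fromCols {p : ℕ} {ι κ : Type*} [Fintype ι] [Fintype κ] [DecidableEq ι]
    [DecidableEq κ] {C : Matrix (Fin p) ι ℝ} {R : Matrix (Fin p) κ ℝ}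
    (h : IsOrthonormal (Matrix.fromCols C R)) :
    IsOrthonormal C ∧ IsOrthonormal R ∧ Cᵀ * R = 0 ∧ Rᵀ * C = 0 := by
  have h1 : (Matrix.fromCols C R)ᵀ * Matrix.fromCols C R = 1 := h
  rw [Matrix.transpose_fromCols, Matrix.fromRows_mul_fromCols, ← Matrix.fromBlocks_one,
    Matrix.fromBlocks_inj] at h1
  exact ⟨h1.1, h1.2.2.2, h1.2.1, h1.2.2.1⟩

theorem fromCols_mul_transpose {p : ℕ} {ι κ : Type*} [Fintype ι] [Fintype κ]
    (C : Matrix (Fin p) ι ℝ) (R : Matrix (Fin p) κ ℝ) :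
    Matrix.fromCols C R * (Matrix.fromCols C R)ᵀ = C * Cᵀ + R * Rᵀ := by
  rw [Matrix.transpose_fromCols, Matrix.fromCols_mul_fromRows]

/-- The specific response space: the top left singular vectors of `G (1 - H)`. -/
theorem frobNorm_specific_sub_le {p k : ℕ} {ι : Type*} [Fintype ι] [DecidableEq ι]
    {C : Matrix (Fin p) ι ℝ} {R P R' : Matrix (Fin p) (Fin k) ℝ}
    (hCR : IsOrthonormal (Matrix.fromCols C R)) (hCP : IsOrthonormal (Matrix.fromCols C P))
    {g : ℝ} (hg : 0 < g) (hRP : ∀ c : Fin k → ℝ,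
      ((Pᵀ * R) *ᵥ c) ⬝ᵥ ((Pᵀ * R) *ᵥ c) ≤ (1 - g ^ 2) * (c ⬝ᵥ c))
    {G H G' H' : Matrix (Fin p) (Fin p) ℝ} (hG : G = C * Cᵀ + R * Rᵀ) (hH : H = C * Cᵀ + P * Pᵀ)
    (hG1 : ‖G‖ ≤ 1) (hH1 : ‖1 - H‖ ≤ 1) (hG'1 : ‖G'‖ ≤ 1) (hH'1 : ‖1 - H'‖ ≤ 1)
    {ε : ℝ} (hGε : frobNorm (G' - G) ≤ ε) (hHε : frobNorm (H' - H) ≤ ε)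
    (hR' : IsTopLeftSingularVectors (G' * (1 - H')) R') :
    g ^ 2 * frobNorm (R' * R'ᵀ - R * Rᵀ) ≤ 20 * ε := by
  obtain ⟨hC, hR, hCR0, hRC0⟩ := isOrthonormal_of_fromCols hCR
  obtain ⟨-, hP, hCP0, hPC0⟩ := isOrthonormal_of_fromCols hCP
  have hRR : Rᵀ * R = 1 := hR
  have hPP : Pᵀ * P = 1 := hP
  have hCC : Cᵀ * C = 1 := hC
  set M := G * (1 - H) with hM
  set M' := G' * (1 - H') with hM'
  set K : Matrix (Fin k) (Fin k) ℝ := 1 - (Pᵀ * R)ᵀ * (Pᵀ * R) with hK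
  -- The common part cancels exactly, and `M Mᵀ = R K Rᵀ` with `K = 1 - (PᵀR)ᵀ(PᵀR)`. The angle
  -- condition makes `K` at least `g ^ 2`, which is the gap for the eigenspace bound.
  have hMeq : M = R * Rᵀ * (1 - P * Pᵀ) := by
    rw [hM, hG, hH]
    simp only [Matrix.add_mul, Matrix.mul_sub, Matrix.mul_add, Matrix.mul_one]
    have e1 : C * Cᵀ * (C * Cᵀ) = C * Cᵀ := proj_mul_proj hC
    have e2 : C * Cᵀ * (P * Pᵀ) = 0 := by
      rw [Matrix.mul_assoc, ← Matrix.mul_assoc Cᵀ, hCP0]; simp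
    have e3 : R * Rᵀ * (C * Cᵀ) = 0 := by
      rw [Matrix.mul_assoc, ← Matrix.mul_assoc Rᵀ, hRC0]; simp
    rw [e1, e2, e3]
    abel
  have hMM : M * Mᵀ = R * K * Rᵀ := by
    rw [hMeq, Matrix.transpose_mul, transpose_compl_proj, Matrix.mul_assoc (R * Rᵀ),
      ← Matrix.mul_assoc (1 - P * Pᵀ), compl_proj_mul_compl_proj hP, hK]
    simp only [Matrix.transpose_mul, Matrix.transpose_transpose, Matrix.mul_sub, Matrix.sub_mul,
      Matrix.mul_one, Matrix.one_mul, Matrix.mul_assoc]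
    rw [← Matrix.mul_assoc Rᵀ R, hRR, Matrix.one_mul]
  have hKT : Kᵀ = K := by
    rw [hK]; simp [Matrix.transpose_sub, Matrix.transpose_mul]
  have hKγ : ∀ c, g ^ 2 * (c ⬝ᵥ c) ≤ c ⬝ᵥ K *ᵥ c := by
    intro c
    have h1 : c ⬝ᵥ K *ᵥ c = c ⬝ᵥ c - ((Pᵀ * R) *ᵥ c) ⬝ᵥ ((Pᵀ * R) *ᵥ c) := by
      rw [hK, Matrix.sub_mulVec, Matrix.one_mulVec, dotProduct_sub,
        Matrix.dotProduct_mulVec ((Pᵀ * R) *ᵥ c), Matrix.vecMul_mulVec, ← Matrix.dotProduct_mulVec]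
    have := hRP c
    rw [h1]
    linarith
  have hmain := frobNorm_proj_topEigenvectors_sub_le (M' * M'ᵀ) R R' hR K hKT (pow_pos hg 2) hKγ hR'
  rw [← hMM] at hmain
  have hM1 : ‖M‖ ≤ 1 := (Matrix.l2_opNorm_mul _ _).trans (mul_le_one₀ hG1 (norm_nonneg _) hH1)
  have hM'1 : ‖M'ᵀ‖ ≤ 1 := by
    rw [l2_opNorm_transpose]
    exact (Matrix.l2_opNorm_mul _ _).trans (mul_le_one₀ hG'1 (norm_nonneg _) hH'1)
  have hdiff : frobNorm (M' - M) ≤ 2 * ε := by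
    have : M' - M = (G' - G) * (1 - H') - G * (H' - H) := by
      rw [hM, hM']; noncomm_ring
    rw [this]
    refine (frobNorm_sub_le _ _).trans ?_
    have h1 := (frobNorm_mul_le_right (G' - G) (1 - H')).trans
      (mul_le_of_le_one_right (frobNorm_nonneg _) hH'1)
    have h2 := (frobNorm_mul_le_left G (H' - H)).trans
      (mul_le_of_le_one_left (frobNorm_nonneg _) hG1)
    linarith
  have hdiff2 : frobNorm (M' * M'ᵀ - M * Mᵀ) ≤ 4 * ε := by
    have : M' * M'ᵀ - M * Mᵀ = (M' - M) * M'ᵀ + M * (M' - M)ᵀ := by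
      rw [Matrix.transpose_sub]; noncomm_ring
    rw [this]
    refine (frobNorm_add_le _ _).trans ?_
    have h1 := (frobNorm_mul_le_right (M' - M) M'ᵀ).trans
      (mul_le_of_le_one_right (frobNorm_nonneg _) hM'1)
    have h2 := (frobNorm_mul_le_left M (M' - M)ᵀ).trans
      (mul_le_of_le_one_left (frobNorm_nonneg _) hM1)
    rw [frobNorm_transpose] at h2
    linarith
  linarith

/-- The sine of `arccos σ` is `√(1 - σ²)`, and `σ` bounds the operator norm of `RᵀP` and of its
transpose. For `k = 0` the hypothesis only says `g ≤ 1`. -/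
theorem dotProduct_mulVec_le_of_sin_canonicalAngle {p k : ℕ} {R P : Matrix (Fin p) (Fin k) ℝ}
    {g : ℝ} (hg : 0 < g) (hangle : g ≤ Real.sin (canonicalAngle R P 0)) :
    g ≤ 1 ∧ (∀ c : Fin k → ℝ, ((Pᵀ * R) *ᵥ c) ⬝ᵥ ((Pᵀ * R) *ᵥ c) ≤ (1 - g ^ 2) * (c ⬝ᵥ c)) ∧
      (∀ c : Fin k → ℝ, ((Rᵀ * P) *ᵥ c) ⬝ᵥ ((Rᵀ * P) *ᵥ c) ≤ (1 - g ^ 2) * (c ⬝ᵥ c)) := by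
  refine ⟨hangle.trans (Real.sin_le_one _), ?_⟩
  rw [canonicalAngle, Real.sin_arccos] at hangle
  have h1 : g ^ 2 ≤ 1 - sigma (Rᵀ * P) 0 ^ 2 := by
    rw [Real.le_sqrt' hg] at hangle; exact hangle
  have h0 := LinearMap.singularValues_nonneg (Matrix.toEuclideanLin (Rᵀ * P)) 0
  have h2 : ‖Rᵀ * P‖ ^ 2 ≤ 1 - g ^ 2 := by
    have := pow_le_pow_left₀ (norm_nonneg _) (l2_opNorm_le_sigma_zero (Rᵀ * P)) 2
    linarith
  have h3 : ‖Pᵀ * R‖ ^ 2 ≤ 1 - g ^ 2 := by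
    rw [← l2_opNorm_transpose, Matrix.transpose_mul, Matrix.transpose_transpose]; exact h2
  have hnn : ∀ c : Fin k → ℝ, 0 ≤ c ⬝ᵥ c := fun c =>
    Finset.sum_nonneg fun _ _ => mul_self_nonneg _
  exact ⟨fun c => (dotProduct_mulVec_self_le _ _).trans (mul_le_mul_of_nonneg_right h3 (hnn c)),
    fun c => (dotProduct_mulVec_self_le _ _).trans (mul_le_mul_of_nonneg_right h2 (hnn c))⟩

/-- The common space: top eigenvectors of the sum of projections, compressed. -/
theorem frobNorm_common_sub_le {p d k : ℕ}
    {C C' : Matrix (Fin p) (Fin d) ℝ} {R P R' P' : Matrix (Fin p) (Fin k) ℝ}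
    (hCR : IsOrthonormal (Matrix.fromCols C R)) (hCP : IsOrthonormal (Matrix.fromCols C P))
    (hR' : IsOrthonormal R') (hP' : IsOrthonormal P')
    {G H G' H' : Matrix (Fin p) (Fin p) ℝ} (hG : G = C * Cᵀ + R * Rᵀ) (hH : H = C * Cᵀ + P * Pᵀ)
    (hG1 : ‖G‖ ≤ 1) (hH1 : ‖H‖ ≤ 1) (hG'1 : ‖G'‖ ≤ 1) (hH'1 : ‖H'‖ ≤ 1)
    {ε η : ℝ} (hGε : frobNorm (G' - G) ≤ ε) (hHε : frobNorm (H' - H) ≤ ε)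
    (hRη : frobNorm (R' * R'ᵀ - R * Rᵀ) ≤ η) (hPη : frobNorm (P' * P'ᵀ - P * Pᵀ) ≤ η)
    (hC' : IsTopEigenvectors
      ((1 - R' * R'ᵀ) * (1 - P' * P'ᵀ) * (G' + H') * (1 - R' * R'ᵀ) * (1 - P' * P'ᵀ)) C') :
    2 * frobNorm (C' * C'ᵀ - C * Cᵀ) ≤ 5 * (8 * η + 2 * ε) := by
  obtain ⟨hC, hR, hCR0, hRC0⟩ := isOrthonormal_of_fromCols hCR
  obtain ⟨-, hP, hCP0, hPC0⟩ := isOrthonormal_of_fromCols hCP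
  set a := 1 - R * Rᵀ with ha
  set b := 1 - P * Pᵀ with hb
  set a' := 1 - R' * R'ᵀ with ha'
  set b' := 1 - P' * P'ᵀ with hb'
  have hCa : Cᵀ * a = Cᵀ := by
    rw [ha, Matrix.mul_sub, ← Matrix.mul_assoc, hCR0]; simp
  have hCb : Cᵀ * b = Cᵀ := by
    rw [hb, Matrix.mul_sub, ← Matrix.mul_assoc, hCP0]; simp
  have haC : a * C = C := by
    rw [ha, Matrix.sub_mul, Matrix.mul_assoc, hRC0]; simp
  have hbC : b * C = C := by
    rw [hb, Matrix.sub_mul, Matrix.mul_assoc, hPC0]; simp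
  have hRa : Rᵀ * a = 0 := by
    rw [ha, Matrix.mul_sub, ← Matrix.mul_assoc, (show Rᵀ * R = 1 from hR)]; simp
  have hbP : b * P = 0 := by
    rw [hb, Matrix.sub_mul, Matrix.mul_assoc, (show Pᵀ * P = 1 from hP)]; simp
  -- The complementary projections fix `C`; in `b (G + H) a` one side kills `P` and the other kills
  -- `R`. The unperturbed matrix is thus exactly `2 C Cᵀ`, whatever the angle between `R` and `P`.
  have hN : a * b * (G + H) * a * b = C * ((2 : ℝ) • (1 : Matrix (Fin d) (Fin d) ℝ)) * Cᵀ := by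
    have h1 : b * (G + H) * a = (2 : ℝ) • (C * Cᵀ) := by
      rw [hG, hH, Matrix.mul_add, Matrix.mul_add, Matrix.mul_add, ← Matrix.mul_assoc,
        ← Matrix.mul_assoc, ← Matrix.mul_assoc, hbC, hbP, Matrix.zero_mul, add_zero,
        Matrix.add_mul, Matrix.add_mul, Matrix.mul_assoc, Matrix.mul_assoc, hCa, hRa, two_smul]
      simp
    calc a * b * (G + H) * a * b = a * (b * (G + H) * a) * b := by simp only [Matrix.mul_assoc]
      _ = _ := by
        rw [h1]
        simp only [Matrix.mul_smul, Matrix.smul_mul, Matrix.mul_one]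
        rw [← Matrix.mul_assoc, haC, Matrix.mul_assoc, hCb]
  have hmain := frobNorm_proj_topEigenvectors_sub_le _ C C' hC
    ((2 : ℝ) • (1 : Matrix (Fin d) (Fin d) ℝ)) (by simp) (γ := 2) two_pos
    (fun c => by simp [Matrix.smul_mulVec]) hC'
  rw [← hN] at hmain
  refine hmain.trans (mul_le_mul_of_nonneg_left ?_ (by norm_num))
  have ha1 : ‖a‖ ≤ 1 := l2_opNorm_compl_proj_le hR
  have hb1 : ‖b‖ ≤ 1 := l2_opNorm_compl_proj_le hP
  have ha'1 : ‖a'‖ ≤ 1 := l2_opNorm_compl_proj_le hR'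
  have hb'1 : ‖b'‖ ≤ 1 := l2_opNorm_compl_proj_le hP'
  have haa : frobNorm (a' - a) ≤ η := by
    rw [ha, ha', sub_sub_sub_cancel_left, frobNorm_sub_rev]; exact hRη
  have hbb : frobNorm (b' - b) ≤ η := by
    rw [hb, hb', sub_sub_sub_cancel_left, frobNorm_sub_rev]; exact hPη
  have hs : ‖G + H‖ ≤ 2 := (norm_add_le _ _).trans (by linarith)
  have hs' : ‖G' + H'‖ ≤ 2 := (norm_add_le _ _).trans (by linarith)
  have hss : frobNorm (G' + H' - (G + H)) ≤ 2 * ε := by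
    have : G' + H' - (G + H) = (G' - G) + (H' - H) := by abel
    rw [this]
    exact (frobNorm_add_le _ _).trans (by linarith)
  have step : ∀ (L X Y : Matrix (Fin p) (Fin p) ℝ) (x y z : ℝ), ‖L‖ ≤ x → frobNorm X ≤ y →
      ‖Y‖ ≤ z → frobNorm (L * X * Y) ≤ x * y * z := by
    intro L X Y x y z h1 h2 h3
    have hx := (norm_nonneg _).trans h1
    have hy := (frobNorm_nonneg _).trans h2
    refine (frobNorm_mul_le_right _ _).trans (mul_le_mul ?_ h3 (norm_nonneg _) (mul_nonneg hx hy))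
    exact (frobNorm_mul_le_left _ _).trans (mul_le_mul h1 h2 (frobNorm_nonneg _) hx)
  have mulb : ∀ (X Y : Matrix (Fin p) (Fin p) ℝ) (x y : ℝ), ‖X‖ ≤ x → ‖Y‖ ≤ y →
      ‖X * Y‖ ≤ x * y := fun X Y x y h1 h2 => (Matrix.l2_opNorm_mul _ _).trans
        (mul_le_mul h1 h2 (norm_nonneg _) ((norm_nonneg _).trans h1))
  -- One factor is exchanged at a time: the four projections cost `2η` each and the middle factor
  -- `2ε`.
  have htel : a' * b' * (G' + H') * a' * b' - a * b * (G + H) * a * b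
      = 1 * (a' - a) * (b' * (G' + H') * a' * b') + a * (b' - b) * ((G' + H') * a' * b')
        + a * b * (G' + H' - (G + H)) * (a' * b') + a * b * (G + H) * (a' - a) * b'
        + a * b * (G + H) * a * (b' - b) * 1 := by noncomm_ring
  rw [htel]
  have t1 := step 1 (a' - a) (b' * (G' + H') * a' * b') _ _ _ l2_opNorm_one_le haa
    (mulb _ _ _ _ (mulb _ _ _ _ (mulb _ _ _ _ hb'1 hs') ha'1) hb'1)
  have t2 := step a (b' - b) ((G' + H') * a' * b') _ _ _ ha1 hbb
    (mulb _ _ _ _ (mulb _ _ _ _ hs' ha'1) hb'1)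
  have t3 := step (a * b) (G' + H' - (G + H)) (a' * b') _ _ _ (mulb _ _ _ _ ha1 hb1) hss
    (mulb _ _ _ _ ha'1 hb'1)
  have t4 := step (a * b * (G + H)) (a' - a) b' _ _ _ (mulb _ _ _ _ (mulb _ _ _ _ ha1 hb1) hs) haa
    hb'1
  have t5 := step (a * b * (G + H) * a) (b' - b) 1 _ _ _
    (mulb _ _ _ _ (mulb _ _ _ _ (mulb _ _ _ _ ha1 hb1) hs) ha1) hbb l2_opNorm_one_le
  have u1 := frobNorm_add_le (1 * (a' - a) * (b' * (G' + H') * a' * b'))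
    (a * (b' - b) * ((G' + H') * a' * b'))
  have u2 := frobNorm_add_le (1 * (a' - a) * (b' * (G' + H') * a' * b')
    + a * (b' - b) * ((G' + H') * a' * b')) (a * b * (G' + H' - (G + H)) * (a' * b'))
  have u3 := frobNorm_add_le (1 * (a' - a) * (b' * (G' + H') * a' * b')
    + a * (b' - b) * ((G' + H') * a' * b') + a * b * (G' + H' - (G + H)) * (a' * b'))
    (a * b * (G + H) * (a' - a) * b')
  have u4 := frobNorm_add_le (1 * (a' - a) * (b' * (G' + H') * a' * b')
    + a * (b' - b) * ((G' + H') * a' * b') + a * b * (G' + H' - (G + H)) * (a' * b')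
    + a * b * (G + H) * (a' - a) * b') (a * b * (G + H) * a * (b' - b) * 1)
  linarith

/-- Deterministic error bound of the spectral initialization in terms of the error of the
reduced-rank estimator. -/
theorem frobNorm_spectralInit_sub_le {p r d : ℕ} (hr : 0 < r) (hd : d ≤ r)
    {A : Matrix (Fin p) (Fin p) ℝ} (hrank : A.rank = r)
    {C : Matrix (Fin p) (Fin d) ℝ} {R P : Matrix (Fin p) (Fin (r - d)) ℝ}
    {D : Matrix (Fin d ⊕ Fin (r - d)) (Fin d ⊕ Fin (r - d)) ℝ}
    (hdec : IsCommonDecomposition A C R P D) {g : ℝ} (hg : 0 < g)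
    (hangle : g ≤ Real.sin (canonicalAngle R P 0)) {b : ℝ} (hb : 0 < b) {T : ℕ}
    {Y X : Matrix (Fin p) (Fin T) ℝ} {A₀ : Matrix (Fin p) (Fin p) ℝ} {δ : ℝ}
    (hδ : ∀ A', IsReducedRankEstimator r Y X A' → frobNorm (A' - A) ≤ δ)
    (hA₀ : IsSpectralInit r d b Y X A₀) :
    frobNorm (A₀ - A) ≤ 2884 * (sigma A 0 / sigma A (r - 1)) ^ 2 * (g ^ 2)⁻¹ * δ := by
  obtain ⟨ARR, U', V', s, R', P', C', D', hRR, ⟨hU', hV', -, -, hSVD⟩, hR', hP', hC', hD', hfin⟩ :=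
    hA₀
  obtain ⟨hCR, hCP, hAD⟩ := hdec
  have hΔ := hδ ARR hRR
  set Δ := frobNorm (ARR - A) with hΔdef
  have hΔ0 : 0 ≤ Δ := frobNorm_nonneg _
  set U := Matrix.fromCols C R with hU
  set V := Matrix.fromCols C P with hV
  set G := U * Uᵀ with hG
  set H := V * Vᵀ with hH
  set G' := U' * U'ᵀ with hG'
  set H' := V' * V'ᵀ with hH'
  have hGe : G = C * Cᵀ + R * Rᵀ := fromCols_mul_transpose C R
  have hHe : H = C * Cᵀ + P * Pᵀ := fromCols_mul_transpose C P
  obtain ⟨hg1, hPR, hRP⟩ := dotProduct_mulVec_le_of_sin_canonicalAngle hg hangle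
  set σ := sigma A (r - 1) with hσ
  set σ₁ := sigma A 0 with hσ₁
  have hσ0 : 0 < σ := sigma_rank_sub_one_pos A hrank hr
  have hσ10 : σ ≤ σ₁ := sigma_le_sigma_zero A _
  have hcard : Fintype.card (Fin d ⊕ Fin (r - d)) = r := by simp; omega
  obtain ⟨Di, hDi1, hDi2, hDin⟩ := exists_inv_core hcard hr A hrank U V D hCR hCP hAD
  set ε := 2 * σ⁻¹ * Δ with hε
  have hGε : frobNorm (G' - G) ≤ ε :=
    frobNorm_proj_sub_le_of_eq_mul hcard hCR hCP hAD hDi1 hDin hU'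
      (S := Matrix.diagonal s * V'ᵀ) (by rw [hSVD, Matrix.mul_assoc])
  have hHε : frobNorm (H' - H) ≤ ε := by
    have hADt : Aᵀ = V * Dᵀ * Uᵀ := by
      rw [hAD]; simp [Matrix.transpose_mul, Matrix.mul_assoc]
    have := frobNorm_proj_sub_le_of_eq_mul hcard hCP hCR hADt (D' := Diᵀ) (s := σ⁻¹)
      (by rw [← Matrix.transpose_mul, hDi2, Matrix.transpose_one])
      (by rw [l2_opNorm_transpose]; exact hDin) hV' (A' := ARRᵀ)
      (S := Matrix.diagonal s * U'ᵀ) (by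
        rw [hSVD]; simp [Matrix.transpose_mul, Matrix.mul_assoc])
    have e : frobNorm (ARRᵀ - Aᵀ) = Δ := by rw [← Matrix.transpose_sub, frobNorm_transpose]
    rw [e] at this
    exact this
  have hε0 : 0 ≤ ε := (frobNorm_nonneg _).trans hGε
  set η := 20 * ε * (g ^ 2)⁻¹ with hη
  have hg2 : 0 < g ^ 2 := by positivity
  have hg2i : 1 ≤ (g ^ 2)⁻¹ := (one_le_inv₀ hg2).2 (pow_le_one₀ hg.le hg1)
  have hRη : frobNorm (R' * R'ᵀ - R * Rᵀ) ≤ η := by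
    have := frobNorm_specific_sub_le hCR hCP hg hPR hGe hHe (l2_opNorm_proj_le hCR)
      (l2_opNorm_compl_proj_le hCP) (l2_opNorm_proj_le hU') (l2_opNorm_compl_proj_le hV')
      hGε hHε hR'
    rw [hη, ← div_eq_mul_inv, le_div_iff₀ hg2]
    linarith
  have hPη : frobNorm (P' * P'ᵀ - P * Pᵀ) ≤ η := by
    have := frobNorm_specific_sub_le hCP hCR hg hRP hHe hGe (l2_opNorm_proj_le hCP)
      (l2_opNorm_compl_proj_le hCR) (l2_opNorm_proj_le hV') (l2_opNorm_compl_proj_le hU')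
      hHε hGε hP'
    rw [hη, ← div_eq_mul_inv, le_div_iff₀ hg2]
    linarith
  have hCη := frobNorm_common_sub_le hCR hCP hR'.1 hP'.1 hGe hHe (l2_opNorm_proj_le hCR)
    (l2_opNorm_proj_le hCP) (l2_opNorm_proj_le hU') (l2_opNorm_proj_le hV') hGε hHε hRη hPη hC'
  have hεη : 20 * ε ≤ η := by
    rw [hη]; exact le_mul_of_one_le_right (by positivity) hg2i
  have hCη' : frobNorm (C' * C'ᵀ - C * Cᵀ) ≤ 23 * η := by linarith
  set L' := C' * C'ᵀ + R' * R'ᵀ with hL'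
  set K' := C' * C'ᵀ + P' * P'ᵀ with hK'
  have hLη : frobNorm (L' - G) ≤ 24 * η := by
    have : L' - G = (C' * C'ᵀ - C * Cᵀ) + (R' * R'ᵀ - R * Rᵀ) := by rw [hL', hGe]; abel
    rw [this]
    exact (frobNorm_add_le _ _).trans (by linarith)
  have hKη : frobNorm (K' - H) ≤ 24 * η := by
    have : K' - H = (C' * C'ᵀ - C * Cᵀ) + (P' * P'ᵀ - P * Pᵀ) := by rw [hK', hHe]; abel
    rw [this]
    exact (frobNorm_add_le _ _).trans (by linarith)
  -- `C'` and `R'` are separately orthonormal but not known to be mutually orthogonal, so `L'` need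
  -- not be a projection and 2 replaces 1.
  have hL2 : ‖L'‖ ≤ 2 := (norm_add_le _ _).trans
    (by linarith [l2_opNorm_proj_le hC'.1, l2_opNorm_proj_le hR'.1])
  have hK2 : ‖K'‖ ≤ 2 := (norm_add_le _ _).trans
    (by linarith [l2_opNorm_proj_le hC'.1, l2_opNorm_proj_le hP'.1])
  -- The scaling by `b` cancels: the output is `ARR` multiplied on both sides by the estimated sums
  -- of projections.
  have hA₀eq : A₀ = L' * ARR * K' := by
    have hsm : ∀ Z : Matrix (Fin p) (Fin (r - d)) ℝ, Matrix.fromCols (b • C') (b • Z)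
        = b • Matrix.fromCols C' Z := by
      intro Z; ext i j; cases j <;> simp
    rw [hfin, hsm, hsm, hD', hL', hK', ← fromCols_mul_transpose, ← fromCols_mul_transpose,
      Matrix.transpose_smul]
    simp only [Matrix.smul_mul, Matrix.mul_smul, smul_smul]
    have : b * ((b ^ 2)⁻¹ * b) = 1 := by field_simp
    rw [this]
    simp only [one_smul, Matrix.mul_assoc]
  have hAeq : G * A * H = A := by
    rw [hG, hH, hAD]
    calc U * Uᵀ * (U * D * Vᵀ) * (V * Vᵀ) = U * (Uᵀ * U) * D * (Vᵀ * V) * Vᵀ := by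
          simp only [Matrix.mul_assoc]
      _ = _ := by
          rw [(show Uᵀ * U = 1 from hCR), (show Vᵀ * V = 1 from hCP)]; simp
  have htel : A₀ - A = L' * (ARR - A) * K' + ((L' - G) * A * K' + G * A * (K' - H)) := by
    rw [hA₀eq]
    conv_lhs => rw [← hAeq]
    noncomm_ring
  have hAn : ‖A‖ ≤ σ₁ := l2_opNorm_le_sigma_zero A
  have hη0 : 0 ≤ η := by linarith
  have t1 : frobNorm (L' * (ARR - A) * K') ≤ 2 * Δ * 2 := by
    refine (frobNorm_mul_le_right _ _).trans (mul_le_mul ?_ hK2 (norm_nonneg _) (by positivity))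
    exact (frobNorm_mul_le_left _ _).trans (mul_le_mul_of_nonneg_right hL2 hΔ0)
  have t2 : frobNorm ((L' - G) * A * K') ≤ 24 * η * σ₁ * 2 := by
    have hσ₁0 : 0 ≤ σ₁ := hσ0.le.trans hσ10
    refine (frobNorm_mul_le_right _ _).trans (mul_le_mul ?_ hK2 (norm_nonneg _) (by positivity))
    exact (frobNorm_mul_le_right _ _).trans (mul_le_mul hLη hAn (norm_nonneg _) (by positivity))
  have t3 : frobNorm (G * A * (K' - H)) ≤ σ₁ * (24 * η) := by
    refine (frobNorm_mul_le_left _ _).trans (mul_le_mul ?_ hKη (frobNorm_nonneg _)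
      (hσ0.le.trans hσ10))
    refine (Matrix.l2_opNorm_mul _ _).trans ?_
    exact (mul_le_of_le_one_left (norm_nonneg _) (l2_opNorm_proj_le hCR)).trans hAn
  have u1 := frobNorm_add_le (L' * (ARR - A) * K') ((L' - G) * A * K' + G * A * (K' - H))
  have u2 := frobNorm_add_le ((L' - G) * A * K') (G * A * (K' - H))
  rw [htel]
  set κ := σ₁ / σ with hκ
  have hκ1 : 1 ≤ κ := (one_le_div hσ0).2 hσ10
  have hησ : η * σ₁ = 40 * κ * (g ^ 2)⁻¹ * Δ := by
    rw [hη, hε, hκ, div_eq_mul_inv]; ring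
  have hκκ : κ ≤ κ ^ 2 := by nlinarith
  have hbig : Δ ≤ κ ^ 2 * (g ^ 2)⁻¹ * Δ := by
    have : 1 ≤ κ ^ 2 * (g ^ 2)⁻¹ := one_le_mul_of_one_le_of_one_le (hκ1.trans hκκ) hg2i
    exact le_mul_of_one_le_left hΔ0 this
  have hbig2 : κ * (g ^ 2)⁻¹ * Δ ≤ κ ^ 2 * (g ^ 2)⁻¹ * Δ := by gcongr
  have hbig3 : κ ^ 2 * (g ^ 2)⁻¹ * Δ ≤ κ ^ 2 * (g ^ 2)⁻¹ * δ := by gcongr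
  -- Here `2880 = 72 * 40`, and the remaining 4 in 2884 comes from `L' * (ARR - A) * K'`. A single
  -- power of `κ` arises; it is bounded by `κ ^ 2`.
  have e1 : 24 * η * σ₁ * 2 + σ₁ * (24 * η) = 2880 * (κ * (g ^ 2)⁻¹ * Δ) := by
    linear_combination 72 * hησ
  have e2 : 2884 * κ ^ 2 * (g ^ 2)⁻¹ * δ = 2884 * (κ ^ 2 * (g ^ 2)⁻¹ * δ) := by ring
  rw [e2]
  linarith

end CommonVAR

/-! ### Reduced-rank least squares. -/

namespace CommonVAR

section LeastSquares

open scoped Matrix.Norms.L2Operator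

theorem exists_orthonormal_factor {p n : ℕ} (M : Matrix (Fin p) (Fin n) ℝ) :
    ∃ Q : Matrix (Fin p) (Fin M.rank) ℝ, IsOrthonormal Q ∧ M = Q * (Qᵀ * M) := by
  set G := LinearMap.range (Matrix.toEuclideanLin M) with hG
  have hrank : Module.finrank ℝ G = M.rank := finrank_range_toEuclideanLin M
  let b := (stdOrthonormalBasis ℝ G).reindex (finCongr hrank)
  refine ⟨Matrix.of fun i j => (b j : EuclideanSpace ℝ (Fin p)) i, ?_, ?_⟩
  · ext i j
    have := b.inner_eq_ite i j
    rw [Submodule.coe_inner, PiLp.inner_apply] at this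
    rw [Matrix.mul_apply, Matrix.one_apply, ← this]
    refine Finset.sum_congr rfl fun a _ => ?_
    exact mul_comm _ _
  · ext i j
    have hx : WithLp.toLp 2 (fun a => M a j) ∈ G := by
      refine ⟨WithLp.toLp 2 (Pi.single j 1), ?_⟩
      rw [Matrix.toLpLin_apply]
      simp
      rfl
    have h1 := congrArg (fun z : G => (z : EuclideanSpace ℝ (Fin p)) i) (b.sum_repr' ⟨_, hx⟩)
    simp only [Submodule.coe_sum, Submodule.coe_smul, Submodule.coe_inner, PiLp.inner_apply,
      WithLp.ofLp_sum, Finset.sum_apply, PiLp.smul_apply, smul_eq_mul] at h1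
    rw [Matrix.mul_apply, ← h1]
    refine Finset.sum_congr rfl fun k _ => ?_
    rw [Matrix.mul_apply, mul_comm]
    congr 1
    exact Finset.sum_congr rfl fun a _ => mul_comm _ _

theorem rank_sub_le {p n : ℕ} (A B : Matrix (Fin p) (Fin n) ℝ) :
    (A - B).rank ≤ A.rank + B.rank := by
  have h : LinearMap.range (A - B).mulVecLin
      ≤ LinearMap.range A.mulVecLin ⊔ LinearMap.range B.mulVecLin := by
    rintro _ ⟨x, rfl⟩
    rw [Matrix.mulVecLin_apply, Matrix.sub_mulVec]
    exact Submodule.sub_mem_sup ⟨x, rfl⟩ ⟨x, rfl⟩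
  exact (Submodule.finrank_mono h).trans (Submodule.finrank_add_le_finrank_add_finrank _ _)

theorem sum_mul_le_frobNorm {m n : Type*} [Fintype m] [Fintype n] (M N : Matrix m n ℝ) :
    ∑ i, ∑ j, N i j * M i j ≤ frobNorm N * frobNorm M := by
  have h := Real.sum_mul_le_sqrt_mul_sqrt (Finset.univ : Finset (m × n)) (fun x => N x.1 x.2)
    (fun x => M x.1 x.2)
  simpa [Fintype.sum_prod_type, frobNorm] using h

theorem trace_transpose_mul_eq {m n : Type*} [Fintype m] [Fintype n] (M N : Matrix m n ℝ) :
    (Nᵀ * M).trace = ∑ i, ∑ j, N i j * M i j := by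
  rw [Finset.sum_comm]
  simp [Matrix.trace, Matrix.mul_apply]

/-- Only the component of `N` in the column space of `M` matters. In orthonormal coordinates `Q` of
that space the Frobenius norm of `Qᵀ N` is at most `√rank` times the operator norm of `N`. -/
theorem sum_mul_le_opNorm_mul_sqrt_rank {p n : ℕ} (M N : Matrix (Fin p) (Fin n) ℝ) :
    ∑ i, ∑ j, N i j * M i j ≤ ‖N‖ * Real.sqrt M.rank * frobNorm M := by
  obtain ⟨Q, hQ, hM⟩ := exists_orthonormal_factor M
  have h1 : ∑ i, ∑ j, N i j * M i j = ∑ i, ∑ j, (Qᵀ * N) i j * (Qᵀ * M) i j := by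
    rw [← trace_transpose_mul_eq, ← trace_transpose_mul_eq, Matrix.transpose_mul,
      Matrix.transpose_transpose, Matrix.mul_assoc, ← hM]
  rw [h1]
  refine (sum_mul_le_frobNorm _ _).trans ?_
  have h2 : frobNorm Qᵀ = Real.sqrt M.rank := by
    rw [frobNorm_transpose, ← Real.sqrt_sq (frobNorm_nonneg Q), ← trace_transpose_mul_self,
      (show Qᵀ * Q = 1 from hQ), Matrix.trace_one, Fintype.card_fin]
  have h3 := frobNorm_mul_le_right Qᵀ N
  rw [h2, mul_comm] at h3
  have h4 : frobNorm (Qᵀ * M) ≤ frobNorm M := (frobNorm_mul_le_left _ _).trans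
    (mul_le_of_le_one_left (frobNorm_nonneg _)
      (by rw [l2_opNorm_transpose]; exact l2_opNorm_orthonormal_le hQ))
  exact mul_le_mul h3 h4 (frobNorm_nonneg _) (by positivity)

/-- Error of the reduced-rank estimator under restricted strong convexity and a deviation bound. -/
theorem frobNorm_reducedRank_sub_le {p T r : ℕ} {Y X E : Matrix (Fin p) (Fin T) ℝ}
    {A A' : Matrix (Fin p) (Fin p) ℝ} (hY : Y = A * X + E) (hA : A.rank ≤ r)
    (hA' : IsReducedRankEstimator r Y X A') {c ν : ℝ} (hc : 0 < c)
    (hX : ∀ v : Fin p → ℝ, c * (v ⬝ᵥ v) ≤ (Xᵀ *ᵥ v) ⬝ᵥ (Xᵀ *ᵥ v)) (hν : ‖E * Xᵀ‖ ≤ ν) :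
    frobNorm (A' - A) ≤ 2 * Real.sqrt (2 * r) * ν / c := by
  set Δ := A' - A with hΔ
  have h1 : frobNorm (E - Δ * X) ≤ frobNorm E := by
    have := hA'.2 A hA
    rw [hY] at this
    have e1 : A * X + E - A' * X = E - Δ * X := by rw [hΔ, Matrix.sub_mul]; abel
    have e2 : A * X + E - A * X = E := by abel
    rwa [e1, e2] at this
  -- The basic inequality: `A` itself competes in the minimization.
  have h2 : frobNorm (Δ * X) ^ 2 ≤ 2 * ∑ i, ∑ j, E i j * (Δ * X) i j := by
    have h3 := pow_le_pow_left₀ (frobNorm_nonneg _) h1 2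
    have h4 : frobNorm (E - Δ * X) ^ 2
        = frobNorm E ^ 2 - 2 * ∑ i, ∑ j, E i j * (Δ * X) i j + frobNorm (Δ * X) ^ 2 := by
      simp only [frobNorm_sq, Finset.mul_sum, ← Finset.sum_sub_distrib, ← Finset.sum_add_distrib,
        Matrix.sub_apply]
      refine Finset.sum_congr rfl fun i _ => Finset.sum_congr rfl fun j _ => ?_
      ring
    linarith
  have h5 : ∑ i, ∑ j, E i j * (Δ * X) i j = ∑ i, ∑ j, (E * Xᵀ) i j * Δ i j := by
    rw [← trace_transpose_mul_eq, ← trace_transpose_mul_eq, Matrix.transpose_mul,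
      Matrix.transpose_transpose, ← Matrix.mul_assoc, Matrix.trace_mul_comm, Matrix.mul_assoc]
  have h6 : c * frobNorm Δ ^ 2 ≤ frobNorm (Δ * X) ^ 2 := by
    rw [frobNorm_sq, frobNorm_sq, Finset.mul_sum]
    refine Finset.sum_le_sum fun i _ => ?_
    have := hX (fun j => Δ i j)
    simpa [dotProduct, ← sq, Matrix.mulVec, Matrix.mul_apply, mul_comm] using this
  have h7 := sum_mul_le_opNorm_mul_sqrt_rank Δ (E * Xᵀ)
  have hrankΔ : (Δ.rank : ℝ) ≤ 2 * r := by
    have h8 : Δ.rank ≤ A'.rank + A.rank := rank_sub_le _ _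
    have : Δ.rank ≤ 2 * r := by have := hA'.1; omega
    exact_mod_cast this
  have h9 : ‖E * Xᵀ‖ * Real.sqrt Δ.rank * frobNorm Δ ≤ ν * Real.sqrt (2 * r) * frobNorm Δ := by
    refine mul_le_mul_of_nonneg_right ?_ (frobNorm_nonneg _)
    exact mul_le_mul hν (Real.sqrt_le_sqrt hrankΔ) (Real.sqrt_nonneg _) ((norm_nonneg _).trans hν)
  have h10 : c * frobNorm Δ ^ 2 ≤ 2 * (ν * Real.sqrt (2 * r) * frobNorm Δ) := by
    rw [h5] at h2; linarith
  rw [le_div_iff₀ hc]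
  rcases (frobNorm_nonneg Δ).eq_or_lt with h | h
  · rw [← h, zero_mul]
    exact mul_nonneg (by positivity) ((norm_nonneg _).trans hν)
  · refine le_of_mul_le_mul_right ?_ h
    linarith

end LeastSquares

/-! ### Rounding to a lattice and counting lattice points. -/

section Lattice

/-- Each coordinate is rounded in the direction of the sign of `c i`, so a linear form never
decreases. Suprema of linear forms can therefore be discretized without loss. -/
theorem exists_int_round_dotProduct_le {p : ℕ} {h : ℝ} (hh : 0 < h) (c u : Fin p → ℝ) :
    ∃ k : Fin p → ℤ, (∀ i, |h * k i - u i| ≤ h) ∧ c ⬝ᵥ u ≤ c ⬝ᵥ (fun i => h * (k i : ℝ)) := by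
  refine ⟨fun i => if 0 ≤ c i then ⌈u i / h⌉ else ⌊u i / h⌋, fun i => ?_, ?_⟩
  · have e : u i = h * (u i / h) := by field_simp
    dsimp only
    split_ifs with hc
    · have h1 := Int.le_ceil (u i / h)
      have h2 := Int.ceil_lt_add_one (u i / h)
      rw [e, ← mul_sub, abs_mul, abs_of_pos hh, ← e]
      refine mul_le_of_le_one_right hh.le ?_
      rw [abs_le]; constructor <;> linarith
    · have h1 := Int.floor_le (u i / h)
      have h2 := Int.lt_floor_add_one (u i / h)
      rw [e, ← mul_sub, abs_mul, abs_of_pos hh, ← e]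
      refine mul_le_of_le_one_right hh.le ?_
      rw [abs_le]; constructor <;> linarith
  · refine Finset.sum_le_sum fun i _ => ?_
    have e : u i = h * (u i / h) := by field_simp
    dsimp only
    split_ifs with hc
    · refine mul_le_mul_of_nonneg_left ?_ hc
      conv_lhs => rw [e]
      exact mul_le_mul_of_nonneg_left (Int.le_ceil _) hh.le
    · refine mul_le_mul_of_nonpos_left ?_ (not_le.1 hc).le
      conv_rhs => rw [e]
      exact mul_le_mul_of_nonneg_left (Int.floor_le _) hh.le

theorem quadForm_update {p : ℕ} (K : Matrix (Fin p) (Fin p) ℝ) (w : Fin p → ℝ) (i : Fin p) (s : ℝ) :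
    (w + s • Pi.single i (1 : ℝ)) ⬝ᵥ K *ᵥ (w + s • Pi.single i (1 : ℝ))
      = w ⬝ᵥ K *ᵥ w + s * (w ⬝ᵥ K *ᵥ Pi.single i (1 : ℝ) + (Pi.single i (1 : ℝ)) ⬝ᵥ K *ᵥ w)
        + s ^ 2 * K i i := by
  have : (Pi.single i (1 : ℝ)) ⬝ᵥ K *ᵥ Pi.single i (1 : ℝ) = K i i := by simp
  rw [← this]
  simp only [Matrix.mulVec_add, Matrix.mulVec_smul, dotProduct_add, add_dotProduct, smul_dotProduct,
    dotProduct_smul, smul_eq_mul]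
  ring

/-- Derandomized rounding, one coordinate at a time. With fractional part `f`, rounding up with
weight `f` and down with weight `1 - f` has mean zero, so the linear term cancels on average and
only `h² f(1-f) K i i ≤ h²/4 κ i` is left; one of the two choices does at least as well. The error
involves the trace rather than the operator norm. -/
theorem exists_int_round_quadForm_le {p : ℕ} {h : ℝ} (hh : 0 < h) (K : Matrix (Fin p) (Fin p) ℝ)
    (κ : Fin p → ℝ) (hκ0 : ∀ i, 0 ≤ κ i) (hκ : ∀ i, K i i ≤ κ i) (v : Fin p → ℝ) :
    ∃ k : Fin p → ℤ, (∀ i, |h * k i - v i| ≤ h) ∧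
      (fun i => h * (k i : ℝ)) ⬝ᵥ K *ᵥ (fun i => h * (k i : ℝ))
        ≤ v ⬝ᵥ K *ᵥ v + h ^ 2 / 4 * ∑ i, κ i := by
  classical
  have key : ∀ S : Finset (Fin p), ∃ w : Fin p → ℝ,
      (∀ i ∈ S, ∃ k : ℤ, w i = h * k ∧ |w i - v i| ≤ h) ∧ (∀ i ∉ S, w i = v i) ∧
      w ⬝ᵥ K *ᵥ w ≤ v ⬝ᵥ K *ᵥ v + h ^ 2 / 4 * ∑ i ∈ S, κ i := by
    intro S
    induction S using Finset.induction_on with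
    | empty => exact ⟨v, by simp, by simp, by simp⟩
    | insert i S hi ih =>
      obtain ⟨w, hw1, hw2, hw3⟩ := ih
      set f := Int.fract (v i / h) with hf
      have hf0 : 0 ≤ f := Int.fract_nonneg _
      have hf1 : f < 1 := Int.fract_lt_one _
      have hfe : v i = h * (⌊v i / h⌋ : ℝ) + h * f := by
        rw [← mul_add, hf, Int.floor_add_fract]; field_simp
      have hQ1 := quadForm_update K w i (-(h * f))
      have hQ2 := quadForm_update K w i (h * (1 - f))
      set q := w ⬝ᵥ K *ᵥ w
      set ℓ := w ⬝ᵥ K *ᵥ Pi.single i (1 : ℝ) + (Pi.single i (1 : ℝ)) ⬝ᵥ K *ᵥ w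
      have hchoose : ∃ s : ℝ, (∃ k : ℤ, v i + s = h * k) ∧ |s| ≤ h ∧
          (w + s • Pi.single i (1 : ℝ)) ⬝ᵥ K *ᵥ (w + s • Pi.single i (1 : ℝ))
            ≤ q + h ^ 2 / 4 * κ i := by
        have hff : f * (1 - f) ≤ 1 / 4 := by nlinarith [sq_nonneg (f - 1 / 2)]
        have hff0 : 0 ≤ f * (1 - f) := mul_nonneg hf0 (by linarith)
        have hb : h ^ 2 * (f * (1 - f)) * K i i ≤ h ^ 2 / 4 * κ i := by
          have h1 : h ^ 2 * (f * (1 - f)) * K i i ≤ h ^ 2 * (f * (1 - f)) * κ i :=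
            mul_le_mul_of_nonneg_left (hκ i) (by positivity)
          have h2 : h ^ 2 * (f * (1 - f)) * κ i ≤ h ^ 2 * (1 / 4) * κ i :=
            mul_le_mul_of_nonneg_right (mul_le_mul_of_nonneg_left hff (by positivity)) (hκ0 i)
          linarith
        by_contra hcon
        push Not at hcon
        have c1 := hcon (-(h * f)) ⟨⌊v i / h⌋, by linarith⟩ (by
          rw [abs_neg, abs_of_nonneg (mul_nonneg hh.le hf0)]
          exact mul_le_of_le_one_right hh.le hf1.le)
        have c2 := hcon (h * (1 - f)) ⟨⌊v i / h⌋ + 1, by push_cast; linarith⟩ (by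
          rw [abs_of_nonneg (mul_nonneg hh.le (by linarith))]
          exact mul_le_of_le_one_right hh.le (by linarith))
        rw [hQ1] at c1
        rw [hQ2] at c2
        have hcomb : (1 - f) * (q + -(h * f) * ℓ + (-(h * f)) ^ 2 * K i i)
            + f * (q + h * (1 - f) * ℓ + (h * (1 - f)) ^ 2 * K i i)
            = q + h ^ 2 * (f * (1 - f)) * K i i := by ring
        nlinarith
      obtain ⟨s, ⟨k, hk⟩, hs, hsQ⟩ := hchoose
      refine ⟨w + s • Pi.single i (1 : ℝ), ?_, ?_, ?_⟩
      · intro j hj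
        by_cases hji : j = i
        · subst hji
          refine ⟨k, ?_, ?_⟩
          · simp [hw2 j hi, hk]
          · simpa [hw2 j hi] using hs
        · obtain ⟨k', hk', hk''⟩ := hw1 j (Finset.mem_of_mem_insert_of_ne hj hji)
          refine ⟨k', ?_, ?_⟩
          · simp [hji, hk']
          · simpa [Pi.single_apply, hji] using hk''
      · intro j hj
        rw [Finset.mem_insert, not_or] at hj
        simp [hj.1, hw2 j hj.2]
      · rw [Finset.sum_insert hi, mul_add]
        linarith
  obtain ⟨w, hw1, -, hw3⟩ := key Finset.univ
  choose k hk hk' using fun i => hw1 i (Finset.mem_univ i)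
  have hwk : w = fun i => h * (k i : ℝ) := funext hk
  refine ⟨k, fun i => ?_, ?_⟩
  · rw [← hk]; exact hk' i
  · rw [← hwk]; exact hw3

/-- The squared length after rounding is at most `2|v|² + 2ph² ≤ 4`, which limits the lattice points
that can occur. -/
theorem sum_int_sq_le_of_round {p : ℕ} {h : ℝ} (hh : 0 < h) (hp : p * h ^ 2 ≤ 1)
    {v : Fin p → ℝ} (hv : v ⬝ᵥ v ≤ 1) {k : Fin p → ℤ} (hk : ∀ i, |h * k i - v i| ≤ h) :
    (fun i => h * (k i : ℝ)) ⬝ᵥ (fun i => h * (k i : ℝ)) ≤ 4 ∧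
      ∑ i, (k i : ℝ) ^ 2 ≤ 4 / h ^ 2 := by
  have h1 : (fun i => h * (k i : ℝ)) ⬝ᵥ (fun i => h * (k i : ℝ)) ≤ 4 := by
    have h2 : ∀ i, h * (k i : ℝ) * (h * k i) ≤ 2 * (v i * v i) + 2 * h ^ 2 := by
      intro i
      have := sq_le_sq' (abs_le.1 (hk i)).1 (abs_le.1 (hk i)).2
      nlinarith [sq_nonneg (h * k i - v i - v i)]
    have h3 := Finset.sum_le_sum (s := Finset.univ) fun i _ => h2 i
    rw [Finset.sum_add_distrib, ← Finset.mul_sum] at h3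
    simp only [Finset.sum_const, Finset.card_univ, Fintype.card_fin, nsmul_eq_mul] at h3
    simp only [dotProduct] at hv ⊢
    linarith
  refine ⟨h1, ?_⟩
  rw [le_div_iff₀ (by positivity), Finset.sum_mul]
  simp only [dotProduct] at h1
  refine le_trans (le_of_eq ?_) h1
  exact Finset.sum_congr rfl fun i _ => by ring

/-- The correction `2 * (1/2)^L` makes the induction close; only the bound 3 is used. -/
theorem sum_exp_neg_sq_le (L : ℕ) :
    ∑ j ∈ Finset.Icc (-(L : ℤ)) L, Real.exp (-(j : ℝ) ^ 2) ≤ 3 - 2 * (1 / 2) ^ L := by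
  induction L with
  | zero => simp; norm_num
  | succ L ih =>
    have hset : Finset.Icc (-((L + 1 : ℕ) : ℤ)) ((L + 1 : ℕ) : ℤ)
        = insert (-((L : ℤ) + 1)) (insert ((L : ℤ) + 1) (Finset.Icc (-(L : ℤ)) L)) := by
      ext x; simp only [Finset.mem_Icc, Finset.mem_insert]; push_cast; omega
    rw [hset, Finset.sum_insert, Finset.sum_insert]
    · have h1 : Real.exp (-((L : ℝ) + 1) ^ 2) ≤ (1 / 2) ^ (L + 1) := by
        have h2 : Real.exp (-1) ≤ 1 / 2 := by
          rw [Real.exp_neg, one_div]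
          exact inv_anti₀ two_pos (by linarith [Real.add_one_le_exp (1 : ℝ)])
        calc Real.exp (-((L : ℝ) + 1) ^ 2) ≤ Real.exp (((L + 1 : ℕ) : ℝ) * (-1)) := by
              apply Real.exp_le_exp.2; push_cast; nlinarith [(Nat.cast_nonneg L : (0 : ℝ) ≤ L)]
          _ = Real.exp (-1) ^ (L + 1) := Real.exp_nat_mul _ _
          _ ≤ _ := pow_le_pow_left₀ (Real.exp_pos _).le h2 _
      have h3 : (1 / 2 : ℝ) ^ (L + 1) = (1 / 2) ^ L / 2 := by rw [pow_succ]; ring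
      push_cast
      rw [neg_add, show (-(L : ℝ) + -1) ^ 2 = ((L : ℝ) + 1) ^ 2 by ring]
      linarith
    · simp only [Finset.mem_Icc]; omega
    · simp only [Finset.mem_Icc, Finset.mem_insert]; omega

theorem exists_finset_int_sum_sq_le (p : ℕ) (M : ℝ) :
    ∃ S : Finset (Fin p → ℤ), (∀ k : Fin p → ℤ, ∑ i, (k i : ℝ) ^ 2 ≤ M → k ∈ S) ∧
      (∀ k ∈ S, ∑ i, (k i : ℝ) ^ 2 ≤ M) ∧ (S.card : ℝ) ≤ 3 ^ p * Real.exp M := by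
  classical
  set L := ⌊M⌋₊ with hL
  set B := Fintype.piFinset (fun _ : Fin p => Finset.Icc (-(L : ℤ)) L) with hB
  refine ⟨B.filter (fun k => ∑ i, (k i : ℝ) ^ 2 ≤ M), fun k hk => ?_, fun k hk => ?_, ?_⟩
  · refine Finset.mem_filter.2 ⟨?_, hk⟩
    rw [hB, Fintype.mem_piFinset]
    intro i
    have h1 : (k i : ℝ) ^ 2 ≤ M :=
      (Finset.single_le_sum (fun j _ => sq_nonneg ((k j : ℝ))) (Finset.mem_univ i)).trans hk
    have h2 : |k i| ≤ (L : ℤ) := by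
      rw [Int.abs_eq_natAbs]
      have h3 : |k i| ≤ (k i) ^ 2 := by
        rcases eq_or_ne (k i) 0 with h | h
        · simp [h]
        · rw [← sq_abs]
          have := Int.one_le_abs h
          nlinarith
      have h4 : ((k i).natAbs : ℝ) ≤ M := by
        refine le_trans ?_ h1
        rw [Nat.cast_natAbs]
        exact_mod_cast h3
      exact_mod_cast Nat.le_floor h4
    rw [Finset.mem_Icc]
    exact abs_le.1 h2
  · exact (Finset.mem_filter.1 hk).2
  · have h1 : ((B.filter (fun k => ∑ i, (k i : ℝ) ^ 2 ≤ M)).card : ℝ)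
        ≤ ∑ k ∈ B, Real.exp M * ∏ i, Real.exp (-(k i : ℝ) ^ 2) := by
      rw [Finset.card_eq_sum_ones, Nat.cast_sum]
      refine le_trans ?_ (Finset.sum_le_sum_of_subset_of_nonneg
        (s := B.filter (fun k => ∑ i, (k i : ℝ) ^ 2 ≤ M)) (Finset.filter_subset _ _)
        fun _ _ _ => by positivity)
      refine Finset.sum_le_sum fun k hk => ?_
      rw [← Real.exp_sum, ← Real.exp_add, Nat.cast_one, Finset.sum_neg_distrib]
      exact Real.one_le_exp (by linarith [(Finset.mem_filter.1 hk).2])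
    rw [← Finset.mul_sum, hB, ← Finset.prod_univ_sum (fun _ : Fin p => Finset.Icc (-(L : ℤ)) L)
      (fun _ j => Real.exp (-(j : ℝ) ^ 2))] at h1
    refine h1.trans ?_
    rw [mul_comm]
    refine mul_le_mul_of_nonneg_right ?_ (Real.exp_pos _).le
    rw [Finset.prod_const, Finset.card_univ, Fintype.card_fin]
    refine pow_le_pow_left₀ (Finset.sum_nonneg fun _ _ => (Real.exp_pos _).le) ?_ _
    have := sum_exp_neg_sq_le L
    have h2 : (0 : ℝ) ≤ (1 / 2) ^ L := by positivity
    linarith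

end Lattice

end CommonVAR

/-! ### Energy estimates for linear recursions from the symbol on the unit circle. -/

namespace CommonVAR

section Filter

open Filter Topology

/-- Parseval identity for the discrete Fourier transform on `n` points. -/
theorem sum_norm_sq_dft {n : ℕ} (hn : n ≠ 0) {ω : ℂ} (hω : IsPrimitiveRoot ω n) (a : ℕ → ℂ) :
    ∑ j ∈ Finset.range n, ‖∑ k ∈ Finset.range n, (ω ^ j) ^ k * a k‖ ^ 2
      = n * ∑ k ∈ Finset.range n, ‖a k‖ ^ 2 := by
  have hω0 : ω ≠ 0 := hω.ne_zero hn
  have hnorm : ‖ω‖ = 1 := hω.norm'_eq_one hn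
  have hconj : ∀ k : ℕ, (starRingEnd ℂ) (ω ^ k) = (ω ^ k)⁻¹ := by
    intro k
    rw [Complex.inv_eq_conj]
    rw [norm_pow, hnorm, one_pow]
  have hgeom : ∀ k ∈ Finset.range n, ∀ l ∈ Finset.range n,
      ∑ j ∈ Finset.range n, (ω ^ j) ^ k * ((ω ^ j) ^ l)⁻¹ = if k = l then (n : ℂ) else 0 := by
    intro k hk l hl
    have e : ∀ j, (ω ^ j) ^ k * ((ω ^ j) ^ l)⁻¹ = (ω ^ k * (ω ^ l)⁻¹) ^ j := by
      intro j
      rw [mul_pow, inv_pow, ← pow_mul, ← pow_mul, ← pow_mul, ← pow_mul, mul_comm j, mul_comm j]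
    simp only [e]
    split_ifs with h
    · subst h
      rw [mul_inv_cancel₀ (pow_ne_zero _ hω0)]; simp
    · have h1 : ω ^ k * (ω ^ l)⁻¹ ≠ 1 := by
        intro h1
        have h2 : ω ^ k = ω ^ l := by
          rwa [mul_inv_eq_one₀ (pow_ne_zero _ hω0)] at h1
        exact h (hω.pow_inj (Finset.mem_range.1 hk) (Finset.mem_range.1 hl) h2)
      rw [geom_sum_eq h1]
      have h3 : (ω ^ k * (ω ^ l)⁻¹) ^ n = 1 := by
        rw [mul_pow, inv_pow, ← pow_mul, ← pow_mul, mul_comm k, mul_comm l, pow_mul, pow_mul,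
          hω.pow_eq_one]
        simp
      rw [h3]; simp
  have hC : (∑ j ∈ Finset.range n, (‖∑ k ∈ Finset.range n, (ω ^ j) ^ k * a k‖ ^ 2 : ℝ) : ℂ)
      = ((n * ∑ k ∈ Finset.range n, ‖a k‖ ^ 2 : ℝ) : ℂ) := by
    have e1 : ∀ z : ℂ, ((‖z‖ ^ 2 : ℝ) : ℂ) = z * (starRingEnd ℂ) z := by
      intro z; rw [Complex.mul_conj, Complex.normSq_eq_norm_sq]
    push_cast
    simp only [← Complex.ofReal_pow, e1, map_sum, map_mul]
    simp only [Finset.sum_mul_sum]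
    rw [Finset.sum_comm]
    rw [Finset.mul_sum]
    refine Finset.sum_congr rfl fun k hk => ?_
    rw [Finset.sum_comm]
    have e2 : ∀ l ∈ Finset.range n, ∑ j ∈ Finset.range n,
        (ω ^ j) ^ k * a k * ((starRingEnd ℂ) ((ω ^ j) ^ l) * (starRingEnd ℂ) (a l))
        = if k = l then n * (a k * (starRingEnd ℂ) (a k)) else 0 := by
      intro l hl
      have e3 : ∀ j, (ω ^ j) ^ k * a k * ((starRingEnd ℂ) ((ω ^ j) ^ l) * (starRingEnd ℂ) (a l))
          = a k * (starRingEnd ℂ) (a l) * ((ω ^ j) ^ k * ((ω ^ j) ^ l)⁻¹) := by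
        intro j
        rw [← pow_mul ω j l, hconj]; ring
      simp only [e3]
      rw [← Finset.mul_sum, hgeom k hk l hl]
      split_ifs with h
      · subst h; ring
      · simp
    rw [Finset.sum_congr rfl e2, Finset.sum_ite_eq]
    simp [hk]
  exact_mod_cast hC

variable {p : ℕ}

/-- The filter `1 - B L` is bounded below on finitely supported sequences. -/
theorem sum_dotProduct_le_of_symbol_ge (B : Matrix (Fin p) (Fin p) ℝ) {μ : ℝ}
    (hB : ∀ z : ℂ, ‖z‖ = 1 → ∀ x : Fin p → ℂ,
      μ * ∑ i, ‖x i‖ ^ 2 ≤ ∑ i, ‖(x - z • (B.map (algebraMap ℝ ℂ) *ᵥ x)) i‖ ^ 2)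
    (φ : ℕ → Fin p → ℝ) (N : ℕ) :
    μ * ∑ k ∈ Finset.range (N + 1), φ k ⬝ᵥ φ k
      ≤ φ 0 ⬝ᵥ φ 0 + ∑ k ∈ Finset.range N, (φ (k + 1) - B *ᵥ φ k) ⬝ᵥ (φ (k + 1) - B *ᵥ φ k)
        + (B *ᵥ φ N) ⬝ᵥ (B *ᵥ φ N) := by
  -- `φ` is padded by zero to `φ'` and `ψ` is its image under `1 - B L`, supported on `0, …, N + 1`.
  -- With `N + 2` points, and `φ'` zero at the last one, the cyclic shift agrees with the ordinary
  -- shift, so the symbol bound applies frequency by frequency.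
  set n := N + 2 with hn
  set ω : ℂ := Complex.exp (2 * Real.pi * Complex.I / n) with hωdef
  have hn0 : n ≠ 0 := by omega
  have hω : IsPrimitiveRoot ω n := Complex.isPrimitiveRoot_exp n hn0
  have hωn : ‖ω‖ = 1 := hω.norm'_eq_one hn0
  set ψ : ℕ → Fin p → ℝ := fun k =>
    if k = 0 then φ 0 else if k ≤ N then φ k - B *ᵥ φ (k - 1) else -(B *ᵥ φ N) with hψ
  set φ' : ℕ → Fin p → ℝ := fun k => if k ≤ N then φ k else 0 with hφ'
  -- reduce to sums over `range n`
  have hL : ∑ k ∈ Finset.range (N + 1), φ k ⬝ᵥ φ k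
      = ∑ k ∈ Finset.range n, φ' k ⬝ᵥ φ' k := by
    rw [hn, Finset.sum_range_succ (n := N + 1)]
    have : φ' (N + 1) = 0 := by simp [hφ']
    rw [this, zero_dotProduct, add_zero]
    refine Finset.sum_congr rfl fun k hk => ?_
    have : k ≤ N := by have := Finset.mem_range.1 hk; omega
    simp [hφ', this]
  have hR : φ 0 ⬝ᵥ φ 0 + ∑ k ∈ Finset.range N, (φ (k + 1) - B *ᵥ φ k) ⬝ᵥ (φ (k + 1) - B *ᵥ φ k)
        + (B *ᵥ φ N) ⬝ᵥ (B *ᵥ φ N) = ∑ k ∈ Finset.range n, ψ k ⬝ᵥ ψ k := by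
    rw [hn, Finset.sum_range_succ (n := N + 1), Finset.sum_range_succ' (n := N)]
    have h1 : ψ 0 = φ 0 := by simp [hψ]
    have h2 : ψ (N + 1) = -(B *ᵥ φ N) := by simp [hψ]
    rw [h1, h2, neg_dotProduct_neg, add_comm (φ 0 ⬝ᵥ φ 0)]
    congr 2
    refine Finset.sum_congr rfl fun k hk => ?_
    have : k + 1 ≤ N := by have := Finset.mem_range.1 hk; omega
    simp [hψ, this]
  rw [hL, hR]
  have hψφ : ∀ k, k < n → ψ k = φ' k - (if k = 0 then 0 else B *ᵥ φ' (k - 1)) := by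
    intro k hk
    simp only [hψ, hφ']
    rcases Nat.eq_zero_or_pos k with h | h
    · simp [h]
    · rw [if_neg h.ne', if_neg h.ne']
      have h1 : k - 1 ≤ N := by omega
      rw [if_pos h1]
      split_ifs with h2
      · rfl
      · have : k - 1 = N := by omega
        rw [this, zero_sub]
  set F : ℕ → Fin p → ℂ := fun j i => ∑ k ∈ Finset.range n, (ω ^ j) ^ k * ((φ' k i : ℝ) : ℂ) with hF
  set Ψ : ℕ → Fin p → ℂ := fun j i => ∑ k ∈ Finset.range n, (ω ^ j) ^ k * ((ψ k i : ℝ) : ℂ) with hΨ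
  have hP : ∀ f : ℕ → Fin p → ℝ, ∑ j ∈ Finset.range n, ∑ i,
      ‖∑ k ∈ Finset.range n, (ω ^ j) ^ k * ((f k i : ℝ) : ℂ)‖ ^ 2
        = n * ∑ k ∈ Finset.range n, f k ⬝ᵥ f k := by
    intro f
    rw [Finset.sum_comm]
    have h1 : ∀ i, ∑ j ∈ Finset.range n,
        ‖∑ k ∈ Finset.range n, (ω ^ j) ^ k * ((f k i : ℝ) : ℂ)‖ ^ 2
          = n * ∑ k ∈ Finset.range n, f k i * f k i := by
      intro i
      rw [sum_norm_sq_dft hn0 hω (fun k => ((f k i : ℝ) : ℂ))]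
      congr 1
      refine Finset.sum_congr rfl fun k _ => ?_
      rw [Complex.norm_real, Real.norm_eq_abs, sq_abs, sq]
    rw [Finset.sum_congr rfl fun i _ => h1 i, ← Finset.mul_sum, Finset.sum_comm]
    rfl
  have hsymb : ∀ j, Ψ j = F j - (ω ^ j) • (B.map (algebraMap ℝ ℂ) *ᵥ F j) := by
    intro j
    ext i
    have h1 : Ψ j i = F j i - ∑ k ∈ Finset.range n, (ω ^ j) ^ k *
        (((if k = 0 then (0 : Fin p → ℝ) else B *ᵥ φ' (k - 1)) i : ℝ) : ℂ) := by
      simp only [hΨ, hF, ← Finset.sum_sub_distrib]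
      refine Finset.sum_congr rfl fun k hk => ?_
      rw [hψφ k (Finset.mem_range.1 hk), Pi.sub_apply, Complex.ofReal_sub, mul_sub]
    rw [h1, Pi.sub_apply, Pi.smul_apply, smul_eq_mul]
    congr 1
    rw [hn, Finset.sum_range_succ']
    simp only [Nat.add_eq_zero_iff, one_ne_zero, and_false, if_false, Nat.add_sub_cancel, if_true,
      Pi.zero_apply, Complex.ofReal_zero, mul_zero, add_zero]
    have h2 : F j = fun a => ∑ k ∈ Finset.range (N + 1), (ω ^ j) ^ k * ((φ' k a : ℝ) : ℂ) := by
      ext a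
      simp only [hF]
      rw [hn, Finset.sum_range_succ (n := N + 1)]
      have : φ' (N + 1) = 0 := by simp [hφ']
      rw [this]; simp
    rw [h2]
    simp only [Matrix.mulVec, dotProduct, Matrix.map_apply, Finset.mul_sum]
    rw [Finset.sum_comm]
    refine Finset.sum_congr rfl fun k _ => ?_
    push_cast
    rw [Finset.mul_sum]
    refine Finset.sum_congr rfl fun a _ => ?_
    simp only [Complex.coe_algebraMap]
    ring
  have hn' : (0 : ℝ) < n := by positivity
  refine le_of_mul_le_mul_left ?_ hn'
  rw [← hP ψ, mul_left_comm, ← hP φ', Finset.mul_sum]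
  refine Finset.sum_le_sum fun j _ => ?_
  have := hB (ω ^ j) (by rw [norm_pow, hωn, one_pow]) (F j)
  rw [← hsymb j] at this
  exact this

/-- Energy bound for the stable recursion `φ_{k+1} = B φ_k + w_{k+1}`. -/
theorem sum_dotProduct_recursion_le (B : Matrix (Fin p) (Fin p) ℝ) {μ : ℝ} (hμ : 0 ≤ μ)
    (hB : ∀ z : ℂ, ‖z‖ = 1 → ∀ x : Fin p → ℂ,
      μ * ∑ i, ‖x i‖ ^ 2 ≤ ∑ i, ‖(x - z • (B.map (algebraMap ℝ ℂ) *ᵥ x)) i‖ ^ 2)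
    (hstab : ∀ x : Fin p → ℝ, Tendsto (fun n => (B ^ n) *ᵥ x) atTop (𝓝 0))
    (φ w : ℕ → Fin p → ℝ) (h0 : φ 0 = w 0) (hφ : ∀ k, φ (k + 1) = B *ᵥ φ k + w (k + 1)) (N : ℕ) :
    μ * ∑ k ∈ Finset.range (N + 1), φ k ⬝ᵥ φ k ≤ ∑ k ∈ Finset.range (N + 1), w k ⬝ᵥ w k := by
  -- The trajectory is continued freely past time `N`. This adds no forcing and moves the boundary
  -- term to `B ^ (L + 1) *ᵥ φ N`, which vanishes as `L → ∞` by stability.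
  set φ' : ℕ → Fin p → ℝ := fun k => if k ≤ N then φ k else (B ^ (k - N)) *ᵥ φ N with hφ'
  have hstep : ∀ L, μ * ∑ k ∈ Finset.range (N + 1), φ k ⬝ᵥ φ k
      ≤ ∑ k ∈ Finset.range (N + 1), w k ⬝ᵥ w k
        + ((B ^ (L + 1)) *ᵥ φ N) ⬝ᵥ ((B ^ (L + 1)) *ᵥ φ N) := by
    intro L
    have h1 := sum_dotProduct_le_of_symbol_ge B hB φ' (N + L)
    have h2 : ∑ k ∈ Finset.range (N + 1), φ k ⬝ᵥ φ k
        ≤ ∑ k ∈ Finset.range (N + L + 1), φ' k ⬝ᵥ φ' k := by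
      refine le_trans (le_of_eq ?_) (Finset.sum_le_sum_of_subset_of_nonneg
        (Finset.range_subset_range.2 (show N + 1 ≤ N + L + 1 by omega))
        fun k _ _ => Finset.sum_nonneg fun _ _ => mul_self_nonneg _)
      refine Finset.sum_congr rfl fun k hk => ?_
      have : k ≤ N := by have := Finset.mem_range.1 hk; omega
      simp [hφ', this]
    have h3 : φ' 0 ⬝ᵥ φ' 0 + ∑ k ∈ Finset.range (N + L),
        (φ' (k + 1) - B *ᵥ φ' k) ⬝ᵥ (φ' (k + 1) - B *ᵥ φ' k)
        = ∑ k ∈ Finset.range (N + 1), w k ⬝ᵥ w k := by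
      rw [Finset.sum_range_succ' (n := N), Finset.sum_range_add (n := N), add_comm]
      have h4 : φ' 0 = w 0 := by simp [hφ', h0]
      rw [h4]
      congr 1
      have h5 : ∀ k ∈ Finset.range L, (φ' (N + k + 1) - B *ᵥ φ' (N + k))
          ⬝ᵥ (φ' (N + k + 1) - B *ᵥ φ' (N + k)) = 0 := by
        intro k _
        have e1 : φ' (N + k + 1) = (B ^ (k + 1)) *ᵥ φ N := by
          simp only [hφ']
          rw [if_neg (by omega), show N + k + 1 - N = k + 1 by omega]
        have e2 : φ' (N + k) = (B ^ k) *ᵥ φ N := by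
          simp only [hφ']
          split_ifs with h
          · have : k = 0 := by omega
            subst this; simp
          · rw [show N + k - N = k by omega]
        rw [e1, e2, Matrix.mulVec_mulVec, ← pow_succ', sub_self, zero_dotProduct]
      rw [Finset.sum_eq_zero h5, add_zero]
      refine Finset.sum_congr rfl fun k hk => ?_
      have hk' : k + 1 ≤ N := by have := Finset.mem_range.1 hk; omega
      have e1 : φ' (k + 1) = φ (k + 1) := by simp [hφ', hk']
      have e2 : φ' k = φ k := by simp [hφ', show k ≤ N by omega]
      rw [e1, e2, hφ]; simp
    have h4 : B *ᵥ φ' (N + L) = (B ^ (L + 1)) *ᵥ φ N := by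
      have e2 : φ' (N + L) = (B ^ L) *ᵥ φ N := by
        simp only [hφ']
        split_ifs with h
        · have : L = 0 := by omega
          subst this; simp
        · rw [show N + L - N = L by omega]
      rw [e2, Matrix.mulVec_mulVec, ← pow_succ']
    rw [h3, h4] at h1
    exact (mul_le_mul_of_nonneg_left h2 hμ).trans h1
  have hlim : Tendsto (fun L => ∑ k ∈ Finset.range (N + 1), w k ⬝ᵥ w k
        + ((B ^ (L + 1)) *ᵥ φ N) ⬝ᵥ ((B ^ (L + 1)) *ᵥ φ N)) atTop
      (𝓝 (∑ k ∈ Finset.range (N + 1), w k ⬝ᵥ w k + (0 : Fin p → ℝ) ⬝ᵥ 0)) := by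
    have h1 := (hstab (φ N)).comp (tendsto_add_atTop_nat 1)
    have h2 : Continuous fun x : Fin p → ℝ => x ⬝ᵥ x := by
      simp only [dotProduct]; fun_prop
    exact tendsto_const_nhds.add ((h2.tendsto 0).comp h1)
  rw [zero_dotProduct, add_zero] at hlim
  exact ge_of_tendsto' hlim hstep

end Filter

end CommonVAR

/-! ### Extremal eigenvalues, `muMin` and `muMax`, stability. -/

namespace CommonVAR

section Hermitian

variable {𝕜 : Type*} [RCLike 𝕜] {p : ℕ} {M : Matrix (Fin p) (Fin p) 𝕜}

/-- This turns the infimum and supremum defining `lambdaMin` and `lambdaMax` into extrema over a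
finite set. -/
theorem setOf_mem_spectrum_eq_range (hM : M.IsHermitian) :
    {t : ℝ | (t : 𝕜) ∈ spectrum 𝕜 M} = Set.range hM.eigenvalues := by
  ext t
  rw [Set.mem_ofPred_eq, hM.spectrum_eq_image_range]
  simp

theorem lambdaMin_le_eigenvalues (hM : M.IsHermitian) (i : Fin p) :
    lambdaMin 𝕜 M ≤ hM.eigenvalues i := by
  rw [lambdaMin, setOf_mem_spectrum_eq_range hM]
  exact csInf_le (Set.finite_range _).bddBelow ⟨i, rfl⟩

theorem eigenvalues_le_lambdaMax (hM : M.IsHermitian) (i : Fin p) :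
    hM.eigenvalues i ≤ lambdaMax 𝕜 M := by
  rw [lambdaMax, setOf_mem_spectrum_eq_range hM]
  exact le_csSup (Set.finite_range _).bddAbove ⟨i, rfl⟩

theorem exists_eigenvalues_eq_lambdaMin (hM : M.IsHermitian) (hp : 0 < p) :
    ∃ i, hM.eigenvalues i = lambdaMin 𝕜 M := by
  rw [lambdaMin, setOf_mem_spectrum_eq_range hM]
  exact (Set.range_nonempty_iff_nonempty.2 ⟨⟨0, hp⟩⟩).csInf_mem (Set.finite_range _)

theorem exists_eigenvalues_eq_lambdaMax (hM : M.IsHermitian) (hp : 0 < p) :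
    ∃ i, hM.eigenvalues i = lambdaMax 𝕜 M := by
  rw [lambdaMax, setOf_mem_spectrum_eq_range hM]
  exact (Set.range_nonempty_iff_nonempty.2 ⟨⟨0, hp⟩⟩).csSup_mem (Set.finite_range _)

theorem star_dotProduct_mulVec_eq_sum_eigenvalues (hM : M.IsHermitian) (x : Fin p → 𝕜) :
    RCLike.re (star x ⬝ᵥ M *ᵥ x)
      = ∑ i, hM.eigenvalues i * ‖(inner 𝕜 (hM.eigenvectorBasis i) (WithLp.toLp 2 x) : 𝕜)‖ ^ 2 := by
  have h1 : star x ⬝ᵥ M *ᵥ x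
      = inner 𝕜 (WithLp.toLp 2 x) (Matrix.toEuclideanLin M (WithLp.toLp 2 x)) := by
    rw [Matrix.toLpLin_apply, PiLp.inner_apply]
    simp [dotProduct, mul_comm]
  have hsym : (Matrix.toEuclideanLin M).IsSymmetric := Matrix.isSymmetric_toEuclideanLin_iff.2 hM
  rw [h1, ← hM.eigenvectorBasis.sum_inner_mul_inner, map_sum]
  refine Finset.sum_congr rfl fun i _ => ?_
  have h2 : Matrix.toEuclideanLin M (hM.eigenvectorBasis i)
      = (hM.eigenvalues i : 𝕜) • hM.eigenvectorBasis i := by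
    rw [Matrix.toLpLin_apply]
    ext j
    have := congrFun (hM.mulVec_eigenvectorBasis i) j
    simpa [RCLike.real_smul_eq_coe_mul] using this
  rw [← hsym, h2, inner_smul_left, RCLike.conj_ofReal, ← inner_conj_symm, mul_left_comm,
    RCLike.conj_mul]
  norm_cast

theorem sum_norm_sq_eq_sum_inner (hM : M.IsHermitian) (x : Fin p → 𝕜) :
    ∑ i, ‖x i‖ ^ 2
      = ∑ i, ‖(inner 𝕜 (hM.eigenvectorBasis i) (WithLp.toLp 2 x) : 𝕜)‖ ^ 2 := by
  rw [hM.eigenvectorBasis.sum_sq_norm_inner_right, EuclideanSpace.norm_sq_eq]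

theorem lambdaMin_mul_le (hM : M.IsHermitian) (x : Fin p → 𝕜) :
    lambdaMin 𝕜 M * ∑ i, ‖x i‖ ^ 2 ≤ RCLike.re (star x ⬝ᵥ M *ᵥ x) := by
  rw [star_dotProduct_mulVec_eq_sum_eigenvalues hM, sum_norm_sq_eq_sum_inner hM, Finset.mul_sum]
  exact Finset.sum_le_sum fun i _ =>
    mul_le_mul_of_nonneg_right (lambdaMin_le_eigenvalues hM i) (sq_nonneg _)

theorem le_lambdaMax_mul (hM : M.IsHermitian) (x : Fin p → 𝕜) :
    RCLike.re (star x ⬝ᵥ M *ᵥ x) ≤ lambdaMax 𝕜 M * ∑ i, ‖x i‖ ^ 2 := by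
  rw [star_dotProduct_mulVec_eq_sum_eigenvalues hM, sum_norm_sq_eq_sum_inner hM, Finset.mul_sum]
  exact Finset.sum_le_sum fun i _ =>
    mul_le_mul_of_nonneg_right (eigenvalues_le_lambdaMax hM i) (sq_nonneg _)

theorem exists_unit_quadForm_eq_eigenvalues (hM : M.IsHermitian) (i : Fin p) :
    ∃ x : Fin p → 𝕜, ∑ j, ‖x j‖ ^ 2 = 1 ∧ RCLike.re (star x ⬝ᵥ M *ᵥ x) = hM.eigenvalues i := by
  refine ⟨(hM.eigenvectorBasis i).ofLp, ?_, ?_⟩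
  · rw [← EuclideanSpace.norm_sq_eq, hM.eigenvectorBasis.orthonormal.1 i, one_pow]
  · rw [star_dotProduct_mulVec_eq_sum_eigenvalues hM, Finset.sum_eq_single i]
    · simp
    · intro j _ hj
      rw [WithLp.toLp_ofLp, hM.eigenvectorBasis.orthonormal.2 hj]; simp
    · simp

theorem lambdaMin_le_lambdaMax (hM : M.IsHermitian) (hp : 0 < p) :
    lambdaMin 𝕜 M ≤ lambdaMax 𝕜 M := by
  obtain ⟨i, hi⟩ := exists_eigenvalues_eq_lambdaMin hM hp
  rw [← hi]
  exact eigenvalues_le_lambdaMax hM i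

end Hermitian

section Symbol

variable {p : ℕ}

theorem star_dotProduct_conjTranspose_mul_self_mulVec (M : Matrix (Fin p) (Fin p) ℂ)
    (x : Fin p → ℂ) : RCLike.re (star x ⬝ᵥ (Mᴴ * M) *ᵥ x) = ∑ i, ‖(M *ᵥ x) i‖ ^ 2 := by
  rw [← Matrix.mulVec_mulVec, Matrix.dotProduct_mulVec, ← Matrix.star_mulVec]
  simp only [dotProduct, Pi.star_apply, map_sum]
  refine Finset.sum_congr rfl fun i _ => ?_
  rw [RCLike.star_def, RCLike.conj_mul]
  norm_cast

theorem isHermitian_conjTranspose_mul_self' (M : Matrix (Fin p) (Fin p) ℂ) :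
    (Mᴴ * M).IsHermitian := Matrix.isHermitian_conjTranspose_mul_self M

theorem matPoly_mulVec (A : Matrix (Fin p) (Fin p) ℝ) (z : ℂ) (x : Fin p → ℂ) :
    matPoly A z *ᵥ x = x - z • (A.map (algebraMap ℝ ℂ) *ᵥ x) := by
  rw [matPoly, Matrix.sub_mulVec, Matrix.one_mulVec, Matrix.smul_mulVec]

theorem lambdaMin_conjTranspose_mul_self_nonneg (M : Matrix (Fin p) (Fin p) ℂ) (hp : 0 < p) :
    0 ≤ lambdaMin ℂ (Mᴴ * M) := by
  obtain ⟨i, hi⟩ := exists_eigenvalues_eq_lambdaMin (isHermitian_conjTranspose_mul_self' M) hp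
  obtain ⟨x, -, hx⟩ := exists_unit_quadForm_eq_eigenvalues (isHermitian_conjTranspose_mul_self' M) i
  rw [← hi, ← hx, star_dotProduct_conjTranspose_mul_self_mulVec]
  exact Finset.sum_nonneg fun _ _ => sq_nonneg _

theorem muMin_le (A : Matrix (Fin p) (Fin p) ℝ) (hp : 0 < p) (z : Circle) :
    muMin A ≤ lambdaMin ℂ ((matPoly A z)ᴴ * matPoly A z) :=
  ciInf_le ⟨0, by rintro _ ⟨w, rfl⟩; exact lambdaMin_conjTranspose_mul_self_nonneg _ hp⟩ z

theorem muMin_mul_le (A : Matrix (Fin p) (Fin p) ℝ) (hp : 0 < p) (z : ℂ) (hz : ‖z‖ = 1)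
    (x : Fin p → ℂ) :
    muMin A * ∑ i, ‖x i‖ ^ 2 ≤ ∑ i, ‖(x - z • (A.map (algebraMap ℝ ℂ) *ᵥ x)) i‖ ^ 2 := by
  rw [← matPoly_mulVec, ← star_dotProduct_conjTranspose_mul_self_mulVec]
  refine le_trans ?_ (lambdaMin_mul_le (isHermitian_conjTranspose_mul_self' _) x)
  exact mul_le_mul_of_nonneg_right (muMin_le A hp ⟨z, by simpa [Submonoid.unitSphere] using hz⟩)
    (Finset.sum_nonneg fun _ _ => sq_nonneg _)

theorem lambdaMin_conjTranspose_mul_self_comm (M : Matrix (Fin p) (Fin p) ℂ) :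
    lambdaMin ℂ (M * Mᴴ) = lambdaMin ℂ (Mᴴ * M) := by
  have : spectrum ℂ (M * Mᴴ) = spectrum ℂ (Mᴴ * M) := by
    ext t
    rw [Matrix.mem_spectrum_iff_isRoot_charpoly, Matrix.mem_spectrum_iff_isRoot_charpoly,
      Matrix.charpoly_mul_comm]
  rw [lambdaMin, lambdaMin, this]

/-- The symbol of `Aᵀ` at `z` is the adjoint of the symbol of `A` at the conjugate of `z`, and `M
Mᴴ` has the spectrum of `Mᴴ M`. The transposed bound is needed for the adjoint recursion. -/
theorem muMin_mul_le_transpose (A : Matrix (Fin p) (Fin p) ℝ) (hp : 0 < p) (z : ℂ) (hz : ‖z‖ = 1)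
    (x : Fin p → ℂ) :
    muMin A * ∑ i, ‖x i‖ ^ 2 ≤ ∑ i, ‖(x - z • (Aᵀ.map (algebraMap ℝ ℂ) *ᵥ x)) i‖ ^ 2 := by
  have hconj : matPoly Aᵀ z = (matPoly A (starRingEnd ℂ z))ᴴ := by
    ext i j
    simp [matPoly, Matrix.one_apply, eq_comm]
  rw [← matPoly_mulVec, ← star_dotProduct_conjTranspose_mul_self_mulVec]
  refine le_trans ?_ (lambdaMin_mul_le (isHermitian_conjTranspose_mul_self' _) x)
  refine mul_le_mul_of_nonneg_right ?_ (Finset.sum_nonneg fun _ _ => sq_nonneg _)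
  rw [hconj, Matrix.conjTranspose_conjTranspose, lambdaMin_conjTranspose_mul_self_comm]
  exact muMin_le A hp ⟨starRingEnd ℂ z, by simpa [Submonoid.unitSphere] using hz⟩

open scoped Matrix.Norms.L2Operator
open Filter Topology

/-- Gelfand's formula gives eventual geometric decay. -/
theorem tendsto_pow_zero_of_spectralRadius_lt_one (a : Matrix (Fin p) (Fin p) ℂ)
    (ha : spectralRadius ℂ a < 1) : Tendsto (fun n => ‖a ^ n‖) atTop (𝓝 0) := by
  have : CompleteSpace (Matrix (Fin p) (Fin p) ℂ) := FiniteDimensional.complete ℂ _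
  obtain ⟨q, hq1, hq2⟩ := exists_between ha
  have hq2' : q ≠ ⊤ := (hq2.trans ENNReal.one_lt_top).ne
  lift q to ℝ≥0 using hq2'
  have hlim := spectrum.pow_nnnorm_pow_one_div_tendsto_nhds_spectralRadius a
  have hev := (hlim.eventually_lt_const hq1).and (eventually_gt_atTop 0)
  have hq : Tendsto (fun n : ℕ => ((q ^ n : ℝ≥0) : ℝ)) atTop (𝓝 0) := by
    push_cast
    exact tendsto_pow_atTop_nhds_zero_of_lt_one q.2 (by exact_mod_cast hq2)
  refine squeeze_zero' (Eventually.of_forall fun n => norm_nonneg _) ?_ hq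
  filter_upwards [hev] with n hn
  obtain ⟨h1, h2⟩ := hn
  have h3 : (‖a ^ n‖₊ : ℝ≥0∞) ≤ (q : ℝ≥0∞) ^ (n : ℝ) := by
    have h4 := ENNReal.rpow_le_rpow h1.le (show (0 : ℝ) ≤ n by positivity)
    rwa [← ENNReal.rpow_mul, one_div, inv_mul_cancel₀ (by positivity), ENNReal.rpow_one] at h4
  rw [ENNReal.rpow_natCast] at h3
  exact_mod_cast h3

theorem sum_norm_sq_mulVec_le (M : Matrix (Fin p) (Fin p) ℂ) (x : Fin p → ℂ) :
    ∑ i, ‖(M *ᵥ x) i‖ ^ 2 ≤ ‖M‖ ^ 2 * ∑ i, ‖x i‖ ^ 2 := by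
  have h := Matrix.l2_opNorm_mulVec M (WithLp.toLp 2 x)
  have h2 := pow_le_pow_left₀ (norm_nonneg _) h 2
  rw [mul_pow, EuclideanSpace.norm_sq_eq, EuclideanSpace.norm_sq_eq] at h2
  simpa using h2

/-- The bound must be uniform in `z`. With `‖a ^ n‖ < 1/2`, the finite geometric sum is a left
inverse of `1 - z a` up to an error below `1/2`; since `|z| = 1`, the norms involved do not depend
on `z`. -/
theorem muMin_pos (A : Matrix (Fin p) (Fin p) ℝ) (hp : 0 < p)
    (hA : spectralRadius ℂ (A.map (algebraMap ℝ ℂ)) < 1) : 0 < muMin A := by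
  set a := A.map (algebraMap ℝ ℂ) with ha
  have hlim := tendsto_pow_zero_of_spectralRadius_lt_one a hA
  obtain ⟨n, hn⟩ := (hlim.eventually_lt_const (show (0 : ℝ) < 1 / 2 by norm_num)).exists
  set S := 1 + ∑ k ∈ Finset.range n, ‖a ^ k‖ with hS
  have hS1 : 1 ≤ S := le_add_of_nonneg_right (Finset.sum_nonneg fun _ _ => norm_nonneg _)
  have hpos : 0 < (1 / (2 * S)) ^ 2 := by positivity
  refine hpos.trans_le (le_ciInf fun z => ?_)
  have hz : ‖(z : ℂ)‖ = 1 := Circle.norm_coe z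
  obtain ⟨i, hi⟩ := exists_eigenvalues_eq_lambdaMin
    (isHermitian_conjTranspose_mul_self' (matPoly A z)) hp
  obtain ⟨x, hx1, hx⟩ := exists_unit_quadForm_eq_eigenvalues
    (isHermitian_conjTranspose_mul_self' (matPoly A z)) i
  rw [← hi, ← hx, star_dotProduct_conjTranspose_mul_self_mulVec]
  set N := matPoly A z with hN
  have hN' : N = 1 - (z : ℂ) • a := rfl
  have hgeom : (1 : Matrix (Fin p) (Fin p) ℂ)
      = (∑ k ∈ Finset.range n, ((z : ℂ) • a) ^ k) * N + ((z : ℂ) • a) ^ n := by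
    rw [hN', geom_sum_mul_neg]; abel
  have hpow : ∀ k, ‖((z : ℂ) • a) ^ k‖ = ‖a ^ k‖ := by
    intro k
    rw [smul_pow, norm_smul, norm_pow, hz, one_pow, one_mul]
  have hxn : ‖(WithLp.toLp 2 x : EuclideanSpace ℂ (Fin p))‖ = 1 := by
    rw [← sq_eq_sq₀ (norm_nonneg _) zero_le_one, EuclideanSpace.norm_sq_eq, one_pow]
    exact hx1
  set Nx : EuclideanSpace ℂ (Fin p) := WithLp.toLp 2 (N *ᵥ x) with hNx
  have hbound : (1 : ℝ) ≤ S * ‖Nx‖ + 1 / 2 := by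
    have e1 : (WithLp.toLp 2 x : EuclideanSpace ℂ (Fin p))
        = WithLp.toLp 2 ((∑ k ∈ Finset.range n, ((z : ℂ) • a) ^ k) *ᵥ Nx.ofLp)
          + WithLp.toLp 2 ((((z : ℂ) • a) ^ n) *ᵥ x) := by
      rw [← WithLp.toLp_add, hNx, Matrix.mulVec_mulVec, ← Matrix.add_mulVec, ← hgeom,
        Matrix.one_mulVec]
    refine hxn.symm.le.trans ?_
    rw [e1]
    refine (norm_add_le _ _).trans (add_le_add ?_ ?_)
    · refine (Matrix.l2_opNorm_mulVec _ Nx).trans (mul_le_mul_of_nonneg_right ?_ (norm_nonneg _))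
      refine (norm_sum_le _ _).trans ?_
      simp only [hpow]
      rw [hS]; linarith
    · have := Matrix.l2_opNorm_mulVec (((z : ℂ) • a) ^ n) (WithLp.toLp 2 x)
      rw [hxn, mul_one, hpow] at this
      exact this.trans hn.le
  have h2 : 1 / (2 * S) ≤ ‖Nx‖ := by
    rw [div_le_iff₀ (by positivity)]; linarith
  have h3 := pow_le_pow_left₀ (by positivity) h2 2
  rw [EuclideanSpace.norm_sq_eq] at h3
  exact h3

theorem bddAbove_lambdaMax_matPoly (A : Matrix (Fin p) (Fin p) ℝ) (hp : 0 < p) :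
    BddAbove (Set.range fun z : Circle => lambdaMax ℂ ((matPoly A z)ᴴ * matPoly A z)) := by
  set a := A.map (algebraMap ℝ ℂ) with ha
  refine ⟨(‖(1 : Matrix (Fin p) (Fin p) ℂ)‖ + ‖a‖) ^ 2, ?_⟩
  rintro _ ⟨z, rfl⟩
  obtain ⟨i, hi⟩ := exists_eigenvalues_eq_lambdaMax
    (isHermitian_conjTranspose_mul_self' (matPoly A z)) hp
  obtain ⟨x, hx1, hx⟩ := exists_unit_quadForm_eq_eigenvalues
    (isHermitian_conjTranspose_mul_self' (matPoly A z)) i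
  dsimp only
  rw [← hi, ← hx, star_dotProduct_conjTranspose_mul_self_mulVec]
  refine (sum_norm_sq_mulVec_le _ _).trans ?_
  rw [hx1, mul_one]
  refine pow_le_pow_left₀ (norm_nonneg _) ?_ 2
  refine (norm_sub_le _ _).trans ?_
  rw [norm_smul, Circle.norm_coe, one_mul]

theorem sum_norm_sq_matPoly_le (A : Matrix (Fin p) (Fin p) ℝ) (hp : 0 < p) (z : Circle)
    (x : Fin p → ℂ) :
    ∑ i, ‖(matPoly A z *ᵥ x) i‖ ^ 2 ≤ muMax A * ∑ i, ‖x i‖ ^ 2 := by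
  rw [← star_dotProduct_conjTranspose_mul_self_mulVec]
  refine (le_lambdaMax_mul (isHermitian_conjTranspose_mul_self' _) x).trans ?_
  exact mul_le_mul_of_nonneg_right (le_ciSup (bddAbove_lambdaMax_matPoly A hp) z)
    (Finset.sum_nonneg fun _ _ => sq_nonneg _)

/-- By the parallelogram law, the squared lengths of `x - Ax` and `x + Ax` add up to at least 2 for
a unit vector `x`; these are the values at `z = 1` and `z = -1`. -/
theorem one_le_muMax (A : Matrix (Fin p) (Fin p) ℝ) (hp : 0 < p) : 1 ≤ muMax A := by
  set x : Fin p → ℂ := Pi.single ⟨0, hp⟩ 1 with hx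
  have hx1 : ∑ i, ‖x i‖ ^ 2 = 1 := by
    rw [Finset.sum_eq_single ⟨0, hp⟩]
    · simp [hx]
    · intro j _ hj; simp [hx, hj]
    · simp
  have h1 := sum_norm_sq_matPoly_le A hp 1 x
  have h2 := sum_norm_sq_matPoly_le A hp (-1) x
  rw [hx1, mul_one, matPoly_mulVec] at h1 h2
  set y := A.map (algebraMap ℝ ℂ) *ᵥ x with hy
  have h3 : ∑ i, ‖(x - ((1 : Circle) : ℂ) • y) i‖ ^ 2 + ∑ i, ‖(x - ((-1 : Circle) : ℂ) • y) i‖ ^ 2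
      = 2 * ∑ i, ‖x i‖ ^ 2 + 2 * ∑ i, ‖y i‖ ^ 2 := by
    rw [Finset.mul_sum, Finset.mul_sum, ← Finset.sum_add_distrib, ← Finset.sum_add_distrib]
    refine Finset.sum_congr rfl fun i _ => ?_
    have := parallelogram_law_with_norm ℝ (x i) (y i)
    simp only [Pi.sub_apply, Pi.smul_apply, Circle.coe_one, Circle.coe_neg, smul_eq_mul, one_mul,
      neg_mul, sub_neg_eq_add]
    nlinarith
  have h4 : 0 ≤ ∑ i, ‖y i‖ ^ 2 := Finset.sum_nonneg fun _ _ => sq_nonneg _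
  rw [hx1] at h3
  linarith

theorem muMin_le_muMax (A : Matrix (Fin p) (Fin p) ℝ) (hp : 0 < p) : muMin A ≤ muMax A :=
  (muMin_le A hp 1).trans ((lambdaMin_le_lambdaMax (isHermitian_conjTranspose_mul_self' _) hp).trans
    (le_ciSup (bddAbove_lambdaMax_matPoly A hp) 1))

theorem tendsto_pow_zero_of_stable (A : Matrix (Fin p) (Fin p) ℝ)
    (hA : spectralRadius ℂ (A.map (algebraMap ℝ ℂ)) < 1) (i j : Fin p) :
    Tendsto (fun n => (A ^ n) i j) atTop (𝓝 0) := by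
  have hlim := tendsto_pow_zero_of_spectralRadius_lt_one _ hA
  rw [tendsto_zero_iff_norm_tendsto_zero]
  refine squeeze_zero (fun n => norm_nonneg _) (fun n => ?_) hlim
  have h1 : ((A ^ n).map (algebraMap ℝ ℂ)) = (A.map (algebraMap ℝ ℂ)) ^ n :=
    Matrix.map_pow A (algebraMap ℝ ℂ) n
  rw [← h1]
  set B := (A ^ n).map (algebraMap ℝ ℂ)
  have h2 := sum_norm_sq_mulVec_le B (Pi.single j 1)
  have h3 : ∑ i, ‖(Pi.single j (1 : ℂ) : Fin p → ℂ) i‖ ^ 2 = 1 := by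
    rw [Finset.sum_eq_single j]
    · simp
    · intro k _ hk; simp [hk]
    · simp
  rw [h3, mul_one] at h2
  have h4 := (Finset.single_le_sum (f := fun i => ‖(B *ᵥ (Pi.single j 1)) i‖ ^ 2)
    (fun k _ => sq_nonneg _) (Finset.mem_univ i)).trans h2
  have h5 := le_of_sq_le_sq h4 (norm_nonneg _)
  rw [Matrix.mulVec_single_one] at h5
  simpa [B] using h5

theorem tendsto_pow_mulVec_zero {A : Matrix (Fin p) (Fin p) ℝ}
    (hA : ∀ i j, Tendsto (fun n => (A ^ n) i j) atTop (𝓝 0)) (x : Fin p → ℝ) :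
    Tendsto (fun n => (A ^ n) *ᵥ x) atTop (𝓝 0) := by
  rw [tendsto_pi_nhds]
  intro i
  have : Tendsto (fun n => ∑ j, (A ^ n) i j * x j) atTop (𝓝 (∑ j : Fin p, 0 * x j)) :=
    tendsto_finsetSum _ fun j _ => (hA i j).mul_const _
  simpa [Matrix.mulVec, dotProduct] using this

theorem tendsto_transpose_pow_zero {A : Matrix (Fin p) (Fin p) ℝ}
    (hA : ∀ i j, Tendsto (fun n => (A ^ n) i j) atTop (𝓝 0)) (i j : Fin p) :
    Tendsto (fun n => (Aᵀ ^ n) i j) atTop (𝓝 0) := by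
  simp only [← Matrix.transpose_pow, Matrix.transpose_apply]
  exact hA j i

end Symbol

section Covariance

variable {p : ℕ} {Cov H : Matrix (Fin p) (Fin p) ℝ}

theorem lambdaMin_pos (hCov : Cov.PosDef) (hp : 0 < p) : 0 < lambdaMin ℝ Cov := by
  obtain ⟨i, hi⟩ := exists_eigenvalues_eq_lambdaMin hCov.isHermitian hp
  rw [← hi]
  exact hCov.eigenvalues_pos i

theorem sqrt_mulVec_dotProduct (hH : H.PosSemidef) (hHH : H * H = Cov) (v : Fin p → ℝ) :
    (H *ᵥ v) ⬝ᵥ (H *ᵥ v) = RCLike.re (star v ⬝ᵥ Cov *ᵥ v) := by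
  have hT : Hᵀ = H := by
    have := hH.isHermitian
    rwa [Matrix.IsHermitian, Matrix.conjTranspose_eq_transpose_of_trivial] at this
  rw [Matrix.dotProduct_mulVec, Matrix.vecMul_mulVec, hT, hHH, ← Matrix.dotProduct_mulVec]
  simp

theorem lambdaMin_mul_le_sqrt (hCov : Cov.PosDef) (hH : H.PosSemidef) (hHH : H * H = Cov)
    (v : Fin p → ℝ) : lambdaMin ℝ Cov * (v ⬝ᵥ v) ≤ (H *ᵥ v) ⬝ᵥ (H *ᵥ v) := by
  rw [sqrt_mulVec_dotProduct hH hHH]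
  have := lambdaMin_mul_le hCov.isHermitian v
  simpa [dotProduct, ← sq] using this

theorem sqrt_le_lambdaMax_mul (hCov : Cov.PosDef) (hH : H.PosSemidef) (hHH : H * H = Cov)
    (v : Fin p → ℝ) : (H *ᵥ v) ⬝ᵥ (H *ᵥ v) ≤ lambdaMax ℝ Cov * (v ⬝ᵥ v) := by
  rw [sqrt_mulVec_dotProduct hH hHH]
  have := le_lambdaMax_mul hCov.isHermitian v
  simpa [dotProduct, ← sq] using this

end Covariance

end CommonVAR

/-! ### Exponential moments and Gaussian averaging. -/

namespace CommonVAR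

/-- The exponential moment `E exp f`, as an extended nonnegative number. -/
noncomputable def expMoment {Ω : Type*} [MeasurableSpace Ω] (Pr : Measure Ω) (f : Ω → ℝ) : ℝ≥0∞ :=
  ∫⁻ ω, ENNReal.ofReal (Real.exp (f ω)) ∂Pr

section ExpMoment

variable {Ω : Type*} [MeasurableSpace Ω] {Pr : Measure Ω}

lemma expMoment_mono {f g : Ω → ℝ} (h : ∀ ω, f ω ≤ g ω) : expMoment Pr f ≤ expMoment Pr g :=
  lintegral_mono fun ω => ENNReal.ofReal_le_ofReal (Real.exp_le_exp.2 (h ω))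

lemma expMoment_add_const (f : Ω → ℝ) (c : ℝ) :
    expMoment Pr (fun ω => f ω + c) = expMoment Pr f * ENNReal.ofReal (Real.exp c) := by
  unfold expMoment
  rw [← lintegral_mul_const' _ _ ENNReal.ofReal_ne_top]
  refine lintegral_congr fun ω => ?_
  rw [Real.exp_add, ENNReal.ofReal_mul (Real.exp_pos _).le]

lemma expMoment_sub_const_le {f : Ω → ℝ} {c : ℝ}
    (h : expMoment Pr f ≤ ENNReal.ofReal (Real.exp c)) :
    expMoment Pr (fun ω => f ω - c) ≤ 1 := by
  simp only [sub_eq_add_neg]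
  rw [expMoment_add_const]
  calc _ ≤ ENNReal.ofReal (Real.exp c) * ENNReal.ofReal (Real.exp (-c)) := by gcongr
    _ = 1 := by
      rw [← ENNReal.ofReal_mul (Real.exp_pos _).le, ← Real.exp_add]
      simp

/-- Markov's inequality for the exponential moment. -/
lemma measure_le_of_expMoment_le {f : Ω → ℝ} (hf : Measurable f) {a B : ℝ}
    (h : expMoment Pr f ≤ ENNReal.ofReal B) :
    Pr {ω | a ≤ f ω} ≤ ENNReal.ofReal (Real.exp (-a) * B) := by
  have h1 : Pr {ω | a ≤ f ω} ≤
      Pr {ω | ENNReal.ofReal (Real.exp a) ≤ ENNReal.ofReal (Real.exp (f ω))} :=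
    measure_mono fun ω hω => ENNReal.ofReal_le_ofReal (Real.exp_le_exp.2 hω)
  have h2 := mul_meas_ge_le_lintegral (μ := Pr)
    (f := fun ω => ENNReal.ofReal (Real.exp (f ω))) (by fun_prop) (ENNReal.ofReal (Real.exp a))
  have h3 : ENNReal.ofReal (Real.exp (-a)) * ENNReal.ofReal (Real.exp a) = 1 := by
    rw [← ENNReal.ofReal_mul (Real.exp_pos _).le, ← Real.exp_add]
    simp
  calc Pr {ω | a ≤ f ω}
      = ENNReal.ofReal (Real.exp (-a)) * (ENNReal.ofReal (Real.exp a) * Pr {ω | a ≤ f ω}) := by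
        rw [← mul_assoc, h3, one_mul]
    _ ≤ ENNReal.ofReal (Real.exp (-a)) * ENNReal.ofReal B := by
        gcongr
        exact (mul_le_mul_right h1 _).trans (h2.trans h)
    _ = _ := by rw [ENNReal.ofReal_mul (Real.exp_pos _).le]

lemma expMoment_eq_ofReal_integral {f : Ω → ℝ} (hf : Integrable (fun ω => Real.exp (f ω)) Pr) :
    expMoment Pr f = ENNReal.ofReal (∫ ω, Real.exp (f ω) ∂Pr) :=
  (ofReal_integral_eq_lintegral_ofReal hf (ae_of_all _ fun _ => (Real.exp_pos _).le)).symm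

lemma expMoment_const_mul_le_of_hasSubgaussianMGF {X : Ω → ℝ} {c : ℝ≥0}
    (h : HasSubgaussianMGF X c Pr) (t : ℝ) :
    expMoment Pr (fun ω => t * X ω) ≤ ENNReal.ofReal (Real.exp (c * t ^ 2 / 2)) := by
  rw [expMoment_eq_ofReal_integral (h.integrable_exp_mul t)]
  exact ENNReal.ofReal_le_ofReal (h.mgf_le t)

end ExpMoment

section Gaussian

lemma expMoment_gaussianReal_const_mul (a : ℝ) :
    expMoment (gaussianReal 0 1) (fun x => a * x) = ENNReal.ofReal (Real.exp (a ^ 2 / 2)) := by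
  rw [expMoment_eq_ofReal_integral (integrable_exp_mul_gaussianReal a)]
  have := congrFun (mgf_fun_id_gaussianReal (μ := 0) (v := 1)) a
  simp only [mgf] at this
  rw [this]
  simp

lemma expMoment_gaussianReal_sq :
    expMoment (gaussianReal 0 1) (fun x => x ^ 2 / 4) = ENNReal.ofReal (Real.sqrt 2) := by
  unfold expMoment
  rw [gaussianReal_of_var_ne_zero _ one_ne_zero,
    lintegral_withDensity_eq_lintegral_mul _ (measurable_gaussianPDF _ _) (by fun_prop)]
  have h1 : ∀ x : ℝ, (gaussianPDF 0 1 * fun x => ENNReal.ofReal (Real.exp (x ^ 2 / 4))) x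
      = ENNReal.ofReal ((Real.sqrt (2 * Real.pi))⁻¹ * Real.exp (-(1 / 4) * x ^ 2)) := by
    intro x
    rw [Pi.mul_apply, gaussianPDF, ← ENNReal.ofReal_mul (gaussianPDFReal_nonneg _ _ _)]
    congr 1
    simp only [gaussianPDFReal, NNReal.coe_one, mul_one, sub_zero]
    rw [mul_assoc, ← Real.exp_add]
    congr 2
    ring
  rw [lintegral_congr h1, ← ofReal_integral_eq_lintegral_ofReal
    ((integrable_exp_neg_mul_sq (by norm_num)).const_mul _) (ae_of_all _ fun x => by positivity),
    integral_const_mul, integral_gaussian]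
  congr 1
  have h2 : Real.pi / (1 / 4) = 2 * (2 * Real.pi) := by ring
  rw [h2, Real.sqrt_mul (show (0 : ℝ) ≤ 2 by norm_num) (2 * Real.pi)]
  have h3 : Real.sqrt (2 * Real.pi) ≠ 0 := (Real.sqrt_pos.2 (by positivity)).ne'
  rw [mul_comm, mul_assoc, mul_inv_cancel₀ h3, mul_one]

variable {ι : Type*} [Fintype ι]

lemma expMoment_pi_sum (ν : Measure ℝ) [IsProbabilityMeasure ν] (f : ι → ℝ → ℝ)
    (hf : ∀ i, Measurable (f i)) :
    expMoment (Measure.pi fun _ : ι => ν) (fun g => ∑ i, f i (g i)) = ∏ i, expMoment ν (f i) := by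
  unfold expMoment
  have h1 : ∀ g : ι → ℝ, ENNReal.ofReal (Real.exp (∑ i, f i (g i)))
      = ∏ i, ENNReal.ofReal (Real.exp (f i (g i))) := fun g => by
    rw [Real.exp_sum, ENNReal.ofReal_prod_of_nonneg fun i _ => (Real.exp_pos _).le]
  rw [lintegral_congr h1]
  have h2 := lintegral_prod_eq_prod_lintegral_of_indepFun (μ := Measure.pi fun _ : ι => ν)
    Finset.univ (fun i g => ENNReal.ofReal (Real.exp (f i (g i))))
    (iIndepFun_pi (μ := fun _ : ι => ν) (X := fun i x => ENNReal.ofReal (Real.exp (f i x)))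
      fun i => by have := hf i; fun_prop) (fun i => by have := hf i; fun_prop)
  rw [h2]
  refine Finset.prod_congr rfl fun i _ => ?_
  exact (measurePreserving_eval (fun _ : ι => ν) i).lintegral_comp
    (f := fun x => ENNReal.ofReal (Real.exp (f i x))) (by have := hf i; fun_prop)

/-- Linear sub-Gaussian exponential moments imply a quadratic one, by integrating the linear bound
against an independent standard Gaussian vector. -/
theorem expMoment_sum_sq_le {Ω : Type*} [MeasurableSpace Ω] {Pr : Measure Ω} [SFinite Pr]
    {X : Ω → ι → ℝ} (hX : Measurable X) {K : ℝ} (hK : 0 < K)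
    (h : ∀ g : ι → ℝ, expMoment Pr (fun ω => ∑ i, g i * X ω i)
      ≤ ENNReal.ofReal (Real.exp (K * (∑ i, g i ^ 2) / 2))) :
    expMoment Pr (fun ω => (∑ i, X ω i ^ 2) / (4 * K))
      ≤ ENNReal.ofReal (Real.sqrt 2 ^ Fintype.card ι) := by
  set γ : Measure (ι → ℝ) := Measure.pi fun _ : ι => gaussianReal 0 1 with hγ
  -- Chosen so that averaging `exp(s X g)` over standard Gaussian `g` gives `exp(X²/(4K))`. After
  -- swapping the integrals the hypothesis leaves `exp(g²/4)`, whose Gaussian mean is `√2` per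
  -- coordinate.
  set s : ℝ := Real.sqrt (1 / (2 * K)) with hs
  have hs2 : s ^ 2 = 1 / (2 * K) := Real.sq_sqrt (by positivity)
  have h1 : ∀ ω, ENNReal.ofReal (Real.exp ((∑ i, X ω i ^ 2) / (4 * K)))
      = ∫⁻ g, ENNReal.ofReal (Real.exp (∑ i, (s * X ω i) * g i)) ∂γ := by
    intro ω
    have := expMoment_pi_sum (ι := ι) (gaussianReal 0 1) (fun i x => (s * X ω i) * x)
      (fun i => by fun_prop)
    unfold expMoment at this
    rw [this]
    have h2 : ∀ i, ∫⁻ x, ENNReal.ofReal (Real.exp ((s * X ω i) * x)) ∂(gaussianReal 0 1)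
        = ENNReal.ofReal (Real.exp ((s * X ω i) ^ 2 / 2)) :=
      fun i => expMoment_gaussianReal_const_mul _
    rw [Finset.prod_congr rfl fun i _ => h2 i,
      ← ENNReal.ofReal_prod_of_nonneg fun i _ => (Real.exp_pos _).le, ← Real.exp_sum]
    congr 2
    rw [Finset.sum_div]
    refine Finset.sum_congr rfl fun i _ => ?_
    rw [mul_pow, hs2]
    field_simp
    ring
  unfold expMoment
  rw [lintegral_congr h1, lintegral_lintegral_swap (by fun_prop)]
  calc ∫⁻ g, ∫⁻ ω, ENNReal.ofReal (Real.exp (∑ i, (s * X ω i) * g i)) ∂Pr ∂γ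
      ≤ ∫⁻ g, ENNReal.ofReal (Real.exp (∑ i, g i ^ 2 / 4)) ∂γ := by
        refine lintegral_mono fun g => ?_
        have h2 := h (fun i => s * g i)
        unfold expMoment at h2
        refine le_trans (le_of_eq (lintegral_congr fun ω => ?_)) (h2.trans (le_of_eq ?_))
        · congr 2
          exact Finset.sum_congr rfl fun i _ => by ring
        · congr 2
          simp only [mul_pow, hs2]
          rw [← Finset.mul_sum, ← Finset.sum_div]
          field_simp
          ring
    _ = ∏ i : ι, expMoment (gaussianReal 0 1) (fun x => x ^ 2 / 4) :=
        expMoment_pi_sum (ι := ι) (gaussianReal 0 1) (fun _ x => x ^ 2 / 4) (fun i => by fun_prop)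
    _ = _ := by
        rw [Finset.prod_const, expMoment_gaussianReal_sq, Finset.card_univ,
          ENNReal.ofReal_pow (Real.sqrt_nonneg _)]

end Gaussian

end CommonVAR

/-! ### Squares of normalized sub-Gaussian variables. -/

namespace CommonVAR

section OneDim

variable {Ω : Type*} [MeasurableSpace Ω] {Pr : Measure Ω}

lemma expMoment_le_ofReal_integral {f φ : Ω → ℝ} (hφ : Integrable φ Pr)
    (h : ∀ ω, Real.exp (f ω) ≤ φ ω) : expMoment Pr f ≤ ENNReal.ofReal (∫ ω, φ ω ∂Pr) := by
  rw [ofReal_integral_eq_lintegral_ofReal hφ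
    (ae_of_all _ fun ω => (Real.exp_pos _).le.trans (h ω))]
  exact lintegral_mono fun ω => ENNReal.ofReal_le_ofReal (h ω)

lemma two_add_sq_le_exp_add_exp_neg (x : ℝ) : 2 + x ^ 2 ≤ Real.exp x + Real.exp (-x) := by
  have key : ∀ y : ℝ, 0 ≤ y → 2 + y ^ 2 ≤ Real.exp y + Real.exp (-y) := by
    intro y hy
    have h1 := Real.self_le_sinh_iff.2 (show 0 ≤ y / 2 by positivity)
    rw [Real.sinh_eq] at h1
    have h2 : Real.exp y = Real.exp (y / 2) ^ 2 := by rw [← Real.exp_nat_mul]; congr 1; push_cast; ring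
    have h3 : Real.exp (-y) = Real.exp (-(y / 2)) ^ 2 := by
      rw [← Real.exp_nat_mul]; congr 1; push_cast; ring
    have h4 : Real.exp (y / 2) * Real.exp (-(y / 2)) = 1 := by rw [← Real.exp_add]; simp
    rw [h2, h3]
    nlinarith
  rcases le_total 0 x with hx | hx
  · exact key x hx
  · have := key (-x) (by linarith)
    simpa [add_comm] using this

variable [IsProbabilityMeasure Pr] {Z : Ω → ℝ} {c : ℝ≥0}

/-- The variance is at most the sub-Gaussian parameter: averaging `2 + x² ≤ eˣ + e⁻ˣ` at `x = tZ`
gives `2 + t² ≤ 2 exp(ct²/2)`, which fails at `t² = 1 - c` if `c < 1`. This yields `τ² ≥ 1`. -/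
lemma one_le_of_hasSubgaussianMGF (hZ : HasSubgaussianMGF Z c Pr)
    (h2 : ∫ ω, Z ω ^ 2 ∂Pr = 1) : (1 : ℝ) ≤ c := by
  have hsq : Integrable (fun ω => Z ω ^ 2) Pr := (hZ.memLp 2).integrable_sq
  have h3 : ∀ t : ℝ, 2 + t ^ 2 ≤ 2 * Real.exp (c * t ^ 2 / 2) := by
    intro t
    have h4 := hZ.mgf_le t
    have h5 := hZ.mgf_le (-t)
    have h6 : ∫ ω, (2 + t ^ 2 * Z ω ^ 2) ∂Pr
        ≤ ∫ ω, (Real.exp (t * Z ω) + Real.exp (-t * Z ω)) ∂Pr := by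
      refine integral_mono ((integrable_const _).add (hsq.const_mul _))
        ((hZ.integrable_exp_mul t).add (hZ.integrable_exp_mul (-t))) fun ω => ?_
      have := two_add_sq_le_exp_add_exp_neg (t * Z ω)
      simp only [neg_mul]
      nlinarith
    rw [integral_add (integrable_const _) (hsq.const_mul _), integral_const_mul, h2,
      integral_add (hZ.integrable_exp_mul t) (hZ.integrable_exp_mul (-t))] at h6
    simp only [mgf, neg_sq] at h4 h5
    simp at h6 h5
    linarith
  by_contra! hc
  have hc0 : (0 : ℝ) ≤ c := c.2
  have h4 := h3 (Real.sqrt (1 - c))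
  rw [Real.sq_sqrt (by linarith)] at h4
  have h5 := abs_le.1 (Real.abs_exp_sub_one_sub_id_le (x := (c : ℝ) * (1 - c) / 2)
    (by rw [abs_of_nonneg (by nlinarith)]; nlinarith))
  have h6 : (0 : ℝ) < (1 - c) * (1 - c) * (1 - (c : ℝ) ^ 2 / 2) :=
    mul_pos (mul_pos (sub_pos.2 hc) (sub_pos.2 hc)) (by nlinarith)
  have h7 := h5.2
  ring_nf at h4 h6 h7
  linarith

lemma sqrt_two_le : Real.sqrt 2 ≤ 3 / 2 := by
  rw [Real.sqrt_le_left (by norm_num)]; norm_num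

lemma expMoment_sq_le (hZm : Measurable Z) (hZ : HasSubgaussianMGF Z c Pr) (hc : (1 : ℝ) ≤ c) :
    expMoment Pr (fun ω => Z ω ^ 2 / (4 * c)) ≤ ENNReal.ofReal (3 / 2) := by
  have := expMoment_sum_sq_le (Pr := Pr) (ι := Unit) (X := fun ω _ => Z ω)
    (measurable_pi_lambda _ fun _ => hZm)
    (K := c) (by linarith) (fun g => by
      simpa using! expMoment_const_mul_le_of_hasSubgaussianMGF hZ (g ()))
  simp only [Finset.univ_unique, Finset.sum_const, Finset.card_singleton, one_smul,
    Fintype.card_unit, pow_one] at this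
  exact this.trans (ENNReal.ofReal_le_ofReal sqrt_two_le)

lemma integrable_exp_sq (hZm : Measurable Z) (hZ : HasSubgaussianMGF Z c Pr) (hc : (1 : ℝ) ≤ c) :
    Integrable (fun ω => Real.exp (Z ω ^ 2 / (4 * c))) Pr ∧
      ∫ ω, Real.exp (Z ω ^ 2 / (4 * c)) ∂Pr ≤ 3 / 2 := by
  have h := expMoment_sq_le hZm hZ hc
  have hi : Integrable (fun ω => Real.exp (Z ω ^ 2 / (4 * c))) Pr := by
    refine ⟨((hZm.pow_const 2).div_const _).exp.aestronglyMeasurable, ?_⟩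
    rw [hasFiniteIntegral_iff_ofReal (ae_of_all _ fun _ => (Real.exp_pos _).le)]
    exact lt_of_le_of_lt h ENNReal.ofReal_lt_top
  refine ⟨hi, ?_⟩
  rw [expMoment_eq_ofReal_integral hi] at h
  exact (ENNReal.ofReal_le_ofReal_iff (by norm_num)).1 h

/-- Both estimates below dominate an exponential by a combination of `1`, `Z`, `Z²` and
`exp(Z²/(4c))`. -/
lemma integral_const_add_lincomb (hf : Integrable Z Pr) {G₁ G₂ : Ω → ℝ} (hG₁ : Integrable G₁ Pr)
    (hG₂ : Integrable G₂ Pr) (a₀ a₁ a₂ a₃ : ℝ) :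
    Integrable (fun ω => a₀ + a₁ * Z ω + a₂ * G₁ ω + a₃ * G₂ ω) Pr ∧
      ∫ ω, (a₀ + a₁ * Z ω + a₂ * G₁ ω + a₃ * G₂ ω) ∂Pr
        = a₀ + a₁ * ∫ ω, Z ω ∂Pr + a₂ * ∫ ω, G₁ ω ∂Pr + a₃ * ∫ ω, G₂ ω ∂Pr := by
  have h1 : Integrable (fun ω => a₀ + a₁ * Z ω) Pr := (integrable_const _).add (hf.const_mul _)
  have h2 : Integrable (fun ω => a₀ + a₁ * Z ω + a₂ * G₁ ω) Pr := h1.add (hG₁.const_mul _)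
  refine ⟨h2.add (hG₂.const_mul _), ?_⟩
  rw [integral_add h2 (hG₂.const_mul _), integral_add h1 (hG₁.const_mul _),
    integral_add (integrable_const _) (hf.const_mul _), integral_const_mul, integral_const_mul,
    integral_const_mul]
  simp

lemma sq_div_two_le_exp {u : ℝ} (hu : 0 ≤ u) : u ^ 2 / 2 ≤ Real.exp u := by
  have := Real.quadratic_le_exp_of_nonneg hu
  linarith

/-- The scale `θ` at which squares of normalized `c`-sub-Gaussian variables are controlled. -/
noncomputable def sqScale (c : ℝ) : ℝ := 1 / (2048 * c ^ 2)

lemma sqScale_pos {c : ℝ} (hc : 1 ≤ c) : 0 < sqScale c := by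
  unfold sqScale; positivity

lemma sqScale_mul {c : ℝ} (hc : 1 ≤ c) : sqScale c * (2048 * c ^ 2) = 1 := by
  unfold sqScale
  have : c ≠ 0 := by linarith
  field_simp

lemma sqScale_le {c : ℝ} (hc : 1 ≤ c) : sqScale c ≤ 1 / 2048 := by
  have h1 := sqScale_mul hc
  have h2 := sqScale_pos hc
  nlinarith [mul_le_mul_of_nonneg_left (show (1 : ℝ) ≤ c ^ 2 by nlinarith) h2.le]

/-- With `x = θZ²`, `eˣ ≤ 1 + x + x²eˣ`, and the scale `θ ∼ c⁻²` is small enough for the last term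
to be at most `θ/16 · exp(Z²/(4c))`, of mean below `θ`. The exponent is thus of the order of the
mean `θ`, not of `cθ`. -/
theorem expMoment_sqScale_mul_sq_le (hZm : Measurable Z) (hZ : HasSubgaussianMGF Z c Pr)
    (h2 : ∫ ω, Z ω ^ 2 ∂Pr = 1) :
    expMoment Pr (fun ω => sqScale c * Z ω ^ 2)
      ≤ ENNReal.ofReal (Real.exp (2 * sqScale c)) := by
  have hc := one_le_of_hasSubgaussianMGF hZ h2
  have hc0 : (0 : ℝ) < c := by linarith
  set θ := sqScale c with hθ
  have hθ0 := sqScale_pos hc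
  have hθ1 := sqScale_mul hc
  obtain ⟨hi, hI⟩ := integrable_exp_sq hZm hZ hc
  have hsq : Integrable (fun ω => Z ω ^ 2) Pr := (hZ.memLp 2).integrable_sq
  have hθc : θ * 128 * (c : ℝ) ^ 2 = 1 / 16 := by rw [← hθ] at hθ1; linarith
  obtain ⟨hφ, hφI⟩ := integral_const_add_lincomb hZ.integrable hsq hi 1 0 θ (θ / 16)
  refine (expMoment_le_ofReal_integral hφ fun ω => ?_).trans (ENNReal.ofReal_le_ofReal ?_)
  · set x := θ * Z ω ^ 2 with hx
    have hx0 : 0 ≤ x := by positivity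
    set u := Z ω ^ 2 / (8 * c) with hu
    have hu0 : 0 ≤ u := by positivity
    have hz : Z ω ^ 2 = 8 * c * u := by rw [hu]; field_simp
    have hxu : x ≤ u := by
      rw [hx, hz]
      have : θ * (8 * c) ≤ 1 := by nlinarith [hθ1, hθ0, mul_pos hθ0 hc0]
      nlinarith
    have h3 : Real.exp x ≤ 1 + x + x ^ 2 * Real.exp x := by
      have h4 := Real.add_one_le_exp (-x)
      have h5 : Real.exp (-x) * Real.exp x = 1 := by rw [← Real.exp_add]; simp
      have h6 : Real.exp x ≤ 1 + x * Real.exp x := by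
        have := mul_le_mul_of_nonneg_right h4 (Real.exp_pos x).le
        linarith
      have h7 := mul_le_mul_of_nonneg_left h6 hx0
      linarith
    have h6 : x ^ 2 ≤ θ / 16 * Real.exp u := by
      have := sq_div_two_le_exp hu0
      have h7 : x ^ 2 = θ * (θ * 128 * (c : ℝ) ^ 2) * (u ^ 2 / 2) := by
        rw [hx, hz]; ring
      rw [h7, hθc]
      nlinarith
    have h8 : Real.exp (Z ω ^ 2 / (4 * c)) = Real.exp u * Real.exp u := by
      rw [← Real.exp_add]; congr 1; rw [hu]; field_simp; ring
    rw [h8]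
    have h9 : Real.exp x ≤ Real.exp u := Real.exp_le_exp.2 hxu
    calc Real.exp x ≤ 1 + x + x ^ 2 * Real.exp x := h3
      _ ≤ 1 + x + (θ / 16 * Real.exp u) * Real.exp u := by gcongr
      _ = _ := by ring
  · rw [hφI, h2]
    have := Real.add_one_le_exp (2 * θ)
    nlinarith

/-- Uniformity in the shift `b` is the point: `b` will be the predictable part of the process, over
which there is no control. For `θb² ≤ 1/16` a second-order expansion applies, with mean `-θ(b² + 1)`
to first order. For larger `b`, `(b + Z)² ≥ b²/2 - Z²` gives a decay of `1/32`, far beyond what is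
needed as `θ ≤ 1/2048`. -/
theorem expMoment_neg_sqScale_mul_add_sq_le (hZm : Measurable Z) (hZ : HasSubgaussianMGF Z c Pr)
    (h1 : ∫ ω, Z ω ∂Pr = 0) (h2 : ∫ ω, Z ω ^ 2 ∂Pr = 1) (b : ℝ) :
    expMoment Pr (fun ω => -(sqScale c * (b + Z ω) ^ 2))
      ≤ ENNReal.ofReal (Real.exp (-(7 / 8 * sqScale c))) := by
  have hc := one_le_of_hasSubgaussianMGF hZ h2
  have hc0 : (0 : ℝ) < c := by linarith
  have hQ := expMoment_sqScale_mul_sq_le hZm hZ h2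
  have hθ1 := sqScale_mul hc
  have hθ2 := sqScale_le hc
  set θ := sqScale c with hθ
  have hθ0 : 0 < θ := sqScale_pos hc
  rcases le_or_gt (θ * b ^ 2) (1 / 16) with hb | hb
  · obtain ⟨hi, hI⟩ := integrable_exp_sq hZm hZ hc
    have hsq : Integrable (fun ω => Z ω ^ 2) Pr := (hZ.memLp 2).integrable_sq
    obtain ⟨hφ, hφI⟩ := integral_const_add_lincomb hZ.integrable hsq hi
      (1 - θ * b ^ 2 + 4 * θ ^ 2 * b ^ 4) (-(2 * θ * b)) (-θ) (θ / 16)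
    refine (expMoment_le_ofReal_integral hφ fun ω => ?_).trans (ENNReal.ofReal_le_ofReal ?_)
    · set u := Z ω ^ 2 / (4 * c) with hu
      have hu0 : 0 ≤ u := by positivity
      have hz : Z ω ^ 2 = 4 * c * u := by rw [hu]; field_simp
      have h3 : θ ^ 2 * Z ω ^ 4 ≤ θ / 64 * Real.exp u := by
        have := sq_div_two_le_exp hu0
        have h4 : θ ^ 2 * Z ω ^ 4 = θ / 64 * (θ * (2048 * (c : ℝ) ^ 2)) * (u ^ 2 / 2) := by
          have : Z ω ^ 4 = (Z ω ^ 2) ^ 2 := by ring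
          rw [this, hz]; ring
        rw [h4, hθ1]
        nlinarith
      set x := θ * (b + Z ω) ^ 2 with hx
      have hx0 : 0 ≤ x := by positivity
      have h5 : Real.exp (-x) ≤ 1 - x + x ^ 2 / 2 := by
        have h6 := Real.quadratic_le_exp_of_nonneg hx0
        have h7 : Real.exp (-x) * Real.exp x = 1 := by rw [← Real.exp_add]; simp
        by_contra! h9
        have h10 := mul_lt_mul_of_pos_right h9 (show 0 < 1 + x + x ^ 2 / 2 by positivity)
        have h11 := mul_le_mul_of_nonneg_left h6 (Real.exp_pos (-x)).le
        rw [h7] at h11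
        have h12 := pow_nonneg hx0 4
        ring_nf at h10 h11 h12
        linarith
      have h12 : (b + Z ω) ^ 4 ≤ 8 * b ^ 4 + 8 * Z ω ^ 4 := by
        have h6 : (b + Z ω) ^ 2 ≤ 2 * b ^ 2 + 2 * Z ω ^ 2 := by nlinarith [sq_nonneg (b - Z ω)]
        have h7 := pow_le_pow_left₀ (sq_nonneg _) h6 2
        nlinarith [sq_nonneg (b ^ 2 - Z ω ^ 2)]
      have h13 : x ^ 2 / 2 ≤ 4 * θ ^ 2 * b ^ 4 + 4 * (θ / 64 * Real.exp u) := by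
        have : x ^ 2 = θ ^ 2 * (b + Z ω) ^ 4 := by rw [hx]; ring
        rw [this]
        nlinarith [mul_le_mul_of_nonneg_left h12 (sq_nonneg θ)]
      calc Real.exp (-x) ≤ 1 - x + (4 * θ ^ 2 * b ^ 4 + 4 * (θ / 64 * Real.exp u)) := by linarith
        _ = _ := by rw [hx]; ring
    · rw [hφI, h1, h2]
      have h3 := Real.add_one_le_exp (-(7 / 8 * θ))
      have h4 : 4 * θ ^ 2 * b ^ 4 ≤ 1 / 4 * (θ * b ^ 2) := by
        have : 4 * θ ^ 2 * b ^ 4 = 4 * (θ * b ^ 2) * (θ * b ^ 2) := by ring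
        rw [this]
        have : 0 ≤ θ * b ^ 2 := by positivity
        nlinarith
      have : 0 ≤ θ * b ^ 2 := by positivity
      nlinarith
  · calc expMoment Pr (fun ω => -(θ * (b + Z ω) ^ 2))
        ≤ expMoment Pr (fun ω => θ * Z ω ^ 2 + -(1 / 32)) := expMoment_mono fun ω => by
          nlinarith [sq_nonneg (b + 2 * Z ω)]
      _ ≤ ENNReal.ofReal (Real.exp (2 * θ)) * ENNReal.ofReal (Real.exp (-(1 / 32))) := by
          rw [expMoment_add_const]; gcongr
      _ ≤ _ := by
          rw [← ENNReal.ofReal_mul (Real.exp_pos _).le, ← Real.exp_add]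
          exact ENNReal.ofReal_le_ofReal (Real.exp_le_exp.2 (by linarith))

end OneDim

end CommonVAR

/-! ### Exponential supermartingales along the process started from zero. -/

namespace CommonVAR

section Supermartingale

variable {Ω α β : Type*} {mΩ : MeasurableSpace Ω} [MeasurableSpace α] [MeasurableSpace β]
  {Pr : Measure Ω} [IsProbabilityMeasure Pr]

/-- One supermartingale step without conditional expectations: the joint law of the past and `ξ` is
a product, so `ξ` is integrated with the past frozen. -/
lemma lintegral_mul_le_of_indepFun {W : Ω → ℝ≥0∞} {X : Ω → α} {ξ : Ω → β} (hW : Measurable W)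
    (hX : Measurable X) (hξ : Measurable ξ) (hind : IndepFun (fun ω => (W ω, X ω)) ξ Pr)
    {g : α → β → ℝ≥0∞} (hg : Measurable (Function.uncurry g))
    (h1 : ∀ a, ∫⁻ ω, g a (ξ ω) ∂Pr ≤ 1) :
    ∫⁻ ω, W ω * g (X ω) (ξ ω) ∂Pr ≤ ∫⁻ ω, W ω ∂Pr := by
  have hWX : Measurable fun ω => (W ω, X ω) := hW.prodMk hX
  have hF : Measurable fun q : (ℝ≥0∞ × α) × β => q.1.1 * Function.uncurry g (q.1.2, q.2) := by
    fun_prop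
  have e1 : ∫⁻ ω, W ω * g (X ω) (ξ ω) ∂Pr
      = ∫⁻ q, q.1.1 * Function.uncurry g (q.1.2, q.2)
          ∂((Pr.map fun ω => (W ω, X ω)).prod (Pr.map ξ)) := by
    rw [← hind.map_prod_eq_prod_map_map hWX.aemeasurable hξ.aemeasurable,
      lintegral_map hF (hWX.prodMk hξ)]
    rfl
  have : IsProbabilityMeasure (Pr.map ξ) := Measure.isProbabilityMeasure_map hξ.aemeasurable
  rw [e1, lintegral_prod _ hF.aemeasurable]
  calc ∫⁻ q : ℝ≥0∞ × α, ∫⁻ b, q.1 * Function.uncurry g (q.2, b) ∂(Pr.map ξ)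
          ∂(Pr.map fun ω => (W ω, X ω))
      ≤ ∫⁻ q : ℝ≥0∞ × α, q.1 ∂(Pr.map fun ω => (W ω, X ω)) := by
        refine lintegral_mono fun q => ?_
        have hgq : Measurable fun b => Function.uncurry g (q.2, b) := by fun_prop
        rw [lintegral_const_mul _ hgq, lintegral_map hgq hξ]
        calc q.1 * ∫⁻ ω, g q.2 (ξ ω) ∂Pr ≤ q.1 * 1 := by gcongr; exact h1 _
          _ = q.1 := mul_one _
    _ = ∫⁻ ω, W ω ∂Pr := by rw [lintegral_map measurable_fst hWX]

/-- Exponential supermartingale bound: if each increment has conditional exponential moment at most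
one given the past, so has the sum. -/
theorem expMoment_sum_le_one {ℱ : ℕ → MeasurableSpace Ω} (hmono : Monotone ℱ)
    (hle : ∀ k, ℱ k ≤ mΩ) {X : ℕ → Ω → α} {ξ : ℕ → Ω → β} (hX : ∀ k, Measurable[ℱ k] (X k))
    (hξ : ∀ k, Measurable[ℱ (k + 1)] (ξ k))
    (hind : ∀ k, Indep (ℱ k) (MeasurableSpace.comap (ξ k) inferInstance) Pr)
    {f : ℕ → α → β → ℝ} (hf : ∀ k, Measurable (Function.uncurry (f k)))
    (h1 : ∀ k a, expMoment Pr (fun ω => f k a (ξ k ω)) ≤ 1) (J : ℕ) :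
    expMoment Pr (fun ω => ∑ j ∈ Finset.range J, f j (X j ω) (ξ j ω)) ≤ 1 := by
  have hS : ∀ J, Measurable[ℱ J] fun ω => ∑ j ∈ Finset.range J, f j (X j ω) (ξ j ω) := by
    intro J
    refine Finset.measurable_fun_sum _ fun j hj => ?_
    have hj' : j + 1 ≤ J := Finset.mem_range.1 hj
    exact (hf j).comp (((hX j).mono (hmono ((Nat.le_succ j).trans hj')) le_rfl).prodMk
      ((hξ j).mono (hmono hj') le_rfl))
  induction J with
  | zero => simp [expMoment]
  | succ J ih =>
    refine le_trans ?_ ih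
    unfold expMoment
    have e : ∀ ω, ENNReal.ofReal (Real.exp (∑ j ∈ Finset.range (J + 1), f j (X j ω) (ξ j ω)))
        = ENNReal.ofReal (Real.exp (∑ j ∈ Finset.range J, f j (X j ω) (ξ j ω)))
          * ENNReal.ofReal (Real.exp (f J (X J ω) (ξ J ω))) := fun ω => by
      rw [Finset.sum_range_succ, Real.exp_add, ENNReal.ofReal_mul (Real.exp_pos _).le]
    rw [lintegral_congr e]
    have hW : Measurable[ℱ J] fun ω =>
        ENNReal.ofReal (Real.exp (∑ j ∈ Finset.range J, f j (X j ω) (ξ j ω))) :=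
      ENNReal.measurable_ofReal.comp (Real.measurable_exp.comp (hS J))
    refine lintegral_mul_le_of_indepFun (hW.mono (hle J) le_rfl) ((hX J).mono (hle J) le_rfl)
      ((hξ J).mono (hle _) le_rfl) ?_
      (g := fun a b => ENNReal.ofReal (Real.exp (f J a b))) ?_ (h1 J)
    · rw [IndepFun_iff_Indep]
      exact indep_of_indep_of_le_left (hind J) (hW.prodMk (hX J)).comap_le
    · exact ENNReal.measurable_ofReal.comp (Real.measurable_exp.comp (hf J))

end Supermartingale

section Truncation

variable {Ω : Type*} {mΩ : MeasurableSpace Ω} {p : ℕ}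

/-- The σ-algebra generated by the innovations up to time `t`. -/
@[reducible]
def pastField (ζ : ℤ → Ω → Fin p → ℝ) (t : ℤ) : MeasurableSpace Ω :=
  ⨆ j ∈ Set.Iic t, MeasurableSpace.comap (ζ j) inferInstance

lemma pastField_mono (ζ : ℤ → Ω → Fin p → ℝ) : Monotone (pastField ζ) :=
  fun _ _ h => biSup_mono fun _ hj => le_trans hj h

lemma pastField_le {ζ : ℤ → Ω → Fin p → ℝ} (hζ : ∀ t, Measurable (ζ t)) (t : ℤ) :
    pastField ζ t ≤ mΩ :=
  iSup₂_le fun j _ => (hζ j).comap_le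

lemma measurable_pastField (ζ : ℤ → Ω → Fin p → ℝ) {s t : ℤ} (h : s ≤ t) :
    Measurable[pastField ζ t] (ζ s) :=
  measurable_iff_comap_le.2
    (le_iSup₂_of_le (f := fun j (_ : j ∈ Set.Iic t) => MeasurableSpace.comap (ζ j) inferInstance)
      s h le_rfl)

lemma indep_pastField {Pr : Measure Ω} {ζ : ℤ → Ω → Fin p → ℝ} (hζ : ∀ t, Measurable (ζ t))
    (hi : iIndepFun ζ Pr) {s t : ℤ} (h : s < t) :
    Indep (pastField ζ s) (MeasurableSpace.comap (ζ t) inferInstance) Pr := by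
  have := indep_iSup_of_disjoint (μ := Pr) (fun j => (hζ j).comap_le)
    ((iIndepFun_iff_iIndep _ _ _).1 hi) (S := Set.Iic s) (T := {t})
    (Set.disjoint_singleton_right.2 fun h' => absurd (Set.mem_Iic.1 h') (not_le.2 h))
  simpa [pastField] using this

/-- The VAR process started from zero at time `-1 - n`; `truncVAR A H ζ n k` is its value at time
`k - 1 - n`. -/
def truncVAR (A H : Matrix (Fin p) (Fin p) ℝ) (ζ : ℤ → Ω → Fin p → ℝ) (n : ℕ) :
    ℕ → Ω → Fin p → ℝ
  | 0 => fun _ => 0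
  | k + 1 => fun ω => A *ᵥ truncVAR A H ζ n k ω + H *ᵥ ζ ((k : ℤ) - n) ω

lemma measurable_mulVec {m' : MeasurableSpace Ω} (B : Matrix (Fin p) (Fin p) ℝ)
    {f : Ω → Fin p → ℝ} (hf : Measurable[m'] f) : Measurable[m'] fun ω => B *ᵥ f ω :=
  ((Matrix.mulVecLin B).continuous_of_finiteDimensional.measurable).comp hf

lemma measurable_truncVAR (A H : Matrix (Fin p) (Fin p) ℝ) (ζ : ℤ → Ω → Fin p → ℝ) (n k : ℕ) :
    Measurable[pastField ζ ((k : ℤ) - 1 - n)] (truncVAR A H ζ n k) := by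
  induction k with
  | zero => exact @measurable_const _ _ _ (pastField ζ _) _
  | succ k ih =>
    have h1 : Measurable[pastField ζ (((k + 1 : ℕ) : ℤ) - 1 - n)] (truncVAR A H ζ n k) :=
      ih.mono (pastField_mono ζ (by push_cast; linarith)) le_rfl
    have h2 : Measurable[pastField ζ (((k + 1 : ℕ) : ℤ) - 1 - n)] (ζ ((k : ℤ) - n)) :=
      measurable_pastField ζ (by push_cast; linarith)
    exact (measurable_mulVec A h1).add (measurable_mulVec H h2)

/-- The exponential supermartingale bound along the truncated process. -/
theorem expMoment_truncVAR_le_one {Pr : Measure Ω} [IsProbabilityMeasure Pr]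
    (A H : Matrix (Fin p) (Fin p) ℝ) {ζ : ℤ → Ω → Fin p → ℝ} (hζ : ∀ t, Measurable (ζ t))
    (hi : iIndepFun ζ Pr) (n m : ℕ) {f : ℕ → (Fin p → ℝ) → (Fin p → ℝ) → ℝ}
    (hf : ∀ k, Measurable (Function.uncurry (f k)))
    (h1 : ∀ k a t, expMoment Pr (fun ω => f k a (ζ t ω)) ≤ 1) (J : ℕ) :
    expMoment Pr (fun ω => ∑ j ∈ Finset.range J,
      f j (truncVAR A H ζ n (m + j) ω) (ζ ((m : ℤ) + j - n) ω)) ≤ 1 := by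
  refine expMoment_sum_le_one (ℱ := fun j => pastField ζ ((m : ℤ) + j - 1 - n))
    (X := fun j => truncVAR A H ζ n (m + j)) (ξ := fun j => ζ ((m : ℤ) + j - n))
    (fun i j hij => pastField_mono ζ ?_) (fun k => pastField_le hζ _) (fun k => ?_) (fun k => ?_)
    (fun k => indep_pastField hζ hi (by linarith)) hf (fun k a => h1 k a _) J
  · have : (i : ℤ) ≤ j := by exact_mod_cast hij
    linarith
  · have := measurable_truncVAR A H ζ n (m + k)
    simpa using this
  · exact measurable_pastField ζ (by push_cast; linarith)

end Truncation

end CommonVAR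

/-! ### Moments of the innovations, and approximation of the stationary solution. -/

namespace CommonVAR

lemma dotProduct_self_nonneg {n : Type*} [Fintype n] (v : n → ℝ) : 0 ≤ v ⬝ᵥ v :=
  Finset.sum_nonneg fun i _ => mul_self_nonneg (v i)

section Innovation

variable {Ω : Type*} [MeasurableSpace Ω] {Pr : Measure Ω} [IsProbabilityMeasure Pr] {p : ℕ}
  {τ : ℝ≥0} {ζ : ℤ → Ω → Fin p → ℝ}

lemma IsInnovation.hasSubgaussianMGF_dotProduct (h : IsInnovation Pr τ ζ) (t : ℤ)
    (c : Fin p → ℝ) :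
    HasSubgaussianMGF (fun ω => c ⬝ᵥ ζ t ω) ((c ⬝ᵥ c).toNNReal * τ ^ 2) Pr := by
  have h1 : iIndepFun (fun i ω => c i * ζ t ω i) Pr :=
    (h.indep_entries t).comp (fun i x => c i * x) fun i => by fun_prop
  have h2 : ∀ i, HasSubgaussianMGF (fun ω => c i * ζ t ω i) ((c i ^ 2).toNNReal * τ ^ 2) Pr :=
    fun i => by
      rw [Real.toNNReal_of_nonneg (sq_nonneg (c i))]
      exact (h.subgaussian t i).const_mul (c i)
  have h3 := HasSubgaussianMGF.sum_of_iIndepFun h1 (s := Finset.univ) fun i _ => h2 i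
  have e : ∑ i, (c i ^ 2).toNNReal * τ ^ 2 = (c ⬝ᵥ c).toNNReal * τ ^ 2 := by
    rw [← Finset.sum_mul, ← Real.toNNReal_sum_of_nonneg fun i _ => sq_nonneg (c i)]
    simp only [dotProduct, pow_two]
  exact e ▸ h3

lemma IsInnovation.expMoment_dotProduct_sub_le_one (h : IsInnovation Pr τ ζ) (t : ℤ)
    (c : Fin p → ℝ) (s : ℝ) :
    expMoment Pr (fun ω => s * (c ⬝ᵥ ζ t ω) - (τ : ℝ) ^ 2 * (c ⬝ᵥ c) * s ^ 2 / 2) ≤ 1 := by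
  refine expMoment_sub_const_le
    ((expMoment_const_mul_le_of_hasSubgaussianMGF (h.hasSubgaussianMGF_dotProduct t c) s).trans
      (le_of_eq ?_))
  rw [NNReal.coe_mul, Real.coe_toNNReal _ (dotProduct_self_nonneg c), NNReal.coe_pow]
  congr 2
  ring

lemma IsInnovation.integral_dotProduct (h : IsInnovation Pr τ ζ) (t : ℤ) (c : Fin p → ℝ) :
    ∫ ω, c ⬝ᵥ ζ t ω ∂Pr = 0 := by
  simp only [dotProduct]
  rw [integral_finsetSum _ fun i _ => (h.subgaussian t i).integrable.const_mul _]
  simp [integral_const_mul, h.mean_zero]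

lemma IsInnovation.integral_dotProduct_sq (h : IsInnovation Pr τ ζ) (t : ℤ) (c : Fin p → ℝ) :
    ∫ ω, (c ⬝ᵥ ζ t ω) ^ 2 ∂Pr = c ⬝ᵥ c := by
  have hij : ∀ i j, Integrable (fun ω => c i * c j * (ζ t ω i * ζ t ω j)) Pr := fun i j =>
    (MemLp.integrable_mul (p := 2) (q := 2) ((h.subgaussian t i).memLp 2)
      ((h.subgaussian t j).memLp 2)).const_mul _
  have e : ∀ ω, (c ⬝ᵥ ζ t ω) ^ 2 = ∑ i, ∑ j, c i * c j * (ζ t ω i * ζ t ω j) := fun ω => by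
    rw [pow_two, dotProduct, Finset.sum_mul_sum]
    exact Finset.sum_congr rfl fun i _ => Finset.sum_congr rfl fun j _ => by ring
  simp only [e]
  rw [integral_finsetSum _ fun i _ => integrable_finsetSum _ fun j _ => hij i j]
  refine Finset.sum_congr rfl fun i _ => ?_
  rw [integral_finsetSum _ fun j _ => hij i j]
  simp [integral_const_mul, h.cov_one]

lemma IsInnovation.one_le_sq (h : IsInnovation Pr τ ζ) (hp : 0 < p) : 1 ≤ (τ : ℝ) ^ 2 := by
  have h2 := h.cov_one 0 ⟨0, hp⟩ ⟨0, hp⟩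
  simp only [if_true, ← pow_two] at h2
  have := one_le_of_hasSubgaussianMGF (h.subgaussian 0 ⟨0, hp⟩) h2
  exact_mod_cast this

/-- The one-dimensional bound in the unit direction `c/|c|`, compensated so as to serve as a
supermartingale increment. -/
lemma IsInnovation.expMoment_neg_sq_le_one (h : IsInnovation Pr τ ζ) (t : ℤ) {c : Fin p → ℝ}
    (hc : 0 < c ⬝ᵥ c) (b : ℝ) :
    expMoment Pr (fun ω => -(sqScale ((τ : ℝ) ^ 2) / (c ⬝ᵥ c) * (b + c ⬝ᵥ ζ t ω) ^ 2)
      + 7 / 8 * sqScale ((τ : ℝ) ^ 2)) ≤ 1 := by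
  set q := Real.sqrt (c ⬝ᵥ c) with hq
  have hq0 : 0 < q := Real.sqrt_pos.2 hc
  have hq2 : q ^ 2 = c ⬝ᵥ c := Real.sq_sqrt hc.le
  set e : Fin p → ℝ := q⁻¹ • c with he
  have hee : e ⬝ᵥ e = 1 := by
    rw [he, smul_dotProduct, dotProduct_smul, ← hq2]
    simp only [smul_eq_mul]
    field_simp
  have hζe : ∀ ω, e ⬝ᵥ ζ t ω = q⁻¹ * (c ⬝ᵥ ζ t ω) := fun ω => by
    rw [he, smul_dotProduct, smul_eq_mul]
  have hm := h.measurable t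
  have hZ := h.hasSubgaussianMGF_dotProduct t e
  rw [hee, Real.toNNReal_one, one_mul] at hZ
  have key := expMoment_neg_sqScale_mul_add_sq_le (Pr := Pr) (Z := fun ω => e ⬝ᵥ ζ t ω)
    (by simp only [dotProduct]; fun_prop) hZ (h.integral_dotProduct t e)
    ((h.integral_dotProduct_sq t e).trans hee) (q⁻¹ * b)
  have := expMoment_sub_const_le key
  refine le_trans (expMoment_mono fun ω => le_of_eq ?_) this
  rw [hζe, ← hq2]
  push_cast
  field_simp
  ring

lemma IsInnovation.expMoment_sum_sq_sub_le_one (h : IsInnovation Pr τ ζ) (t : ℤ) :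
    expMoment Pr (fun ω => sqScale ((τ : ℝ) ^ 2) * (ζ t ω ⬝ᵥ ζ t ω)
      - 2 * sqScale ((τ : ℝ) ^ 2) * p) ≤ 1 := by
  refine expMoment_sub_const_le ?_
  have hm := h.measurable t
  have e : ∀ ω, ENNReal.ofReal (Real.exp (sqScale ((τ : ℝ) ^ 2) * (ζ t ω ⬝ᵥ ζ t ω)))
      = ∏ i, ENNReal.ofReal (Real.exp (sqScale ((τ : ℝ) ^ 2) * ζ t ω i ^ 2)) := fun ω => by
    rw [← ENNReal.ofReal_prod_of_nonneg fun i _ => (Real.exp_pos _).le, ← Real.exp_sum,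
      ← Finset.mul_sum]
    simp only [dotProduct, pow_two]
  unfold expMoment
  rw [lintegral_congr e, lintegral_prod_eq_prod_lintegral_of_indepFun Finset.univ
    (fun i ω => ENNReal.ofReal (Real.exp (sqScale ((τ : ℝ) ^ 2) * ζ t ω i ^ 2)))
    ((h.indep_entries t).comp
      (fun i x => ENNReal.ofReal (Real.exp (sqScale ((τ : ℝ) ^ 2) * x ^ 2)))
      fun i => by fun_prop) fun i => by fun_prop]
  have h1 : ∀ i, ∫⁻ ω, ENNReal.ofReal (Real.exp (sqScale ((τ : ℝ) ^ 2) * ζ t ω i ^ 2)) ∂Pr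
      ≤ ENNReal.ofReal (Real.exp (2 * sqScale ((τ : ℝ) ^ 2))) := fun i => by
    have h2 := h.cov_one t i i
    simp only [if_true, ← pow_two] at h2
    have := expMoment_sqScale_mul_sq_le (Pr := Pr) (Z := fun ω => ζ t ω i) (by fun_prop)
      (h.subgaussian t i) h2
    push_cast at this
    exact this
  refine (Finset.prod_le_prod' fun i _ => h1 i).trans (le_of_eq ?_)
  rw [Finset.prod_const, ← ENNReal.ofReal_pow (Real.exp_pos _).le, ← Real.exp_nat_mul]
  congr 2
  simp
  ring

end Innovation

section Approximation

open Filter Topology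

variable {Ω : Type*} [MeasurableSpace Ω] {Pr : Measure Ω} [IsProbabilityMeasure Pr] {p : ℕ}
  {A H : Matrix (Fin p) (Fin p) ℝ} {ζ y : ℤ → Ω → Fin p → ℝ}

lemma IsStationaryVAR.map_eq (h : IsStationaryVAR Pr A H ζ y) (t : ℤ) :
    Pr.map (y t) = Pr.map (y 0) := by
  have h1 := congrArg (Measure.map fun u : ℤ → Fin p → ℝ => u 0) (h.stationary t)
  have hy := h.measurable
  rw [Measure.map_map (measurable_pi_apply _) (by fun_prop),
    Measure.map_map (measurable_pi_apply _) (by fun_prop)] at h1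
  simpa [Function.comp_def] using h1

lemma IsStationaryVAR.sub_truncVAR_ae (h : IsStationaryVAR Pr A H ζ y) (n k : ℕ) :
    ∀ᵐ ω ∂Pr, y ((k : ℤ) - 1 - n) ω - truncVAR A H ζ n k ω = (A ^ k) *ᵥ y (-1 - n) ω := by
  induction k with
  | zero =>
    refine ae_of_all _ fun ω => ?_
    simp [truncVAR]
  | succ k ih =>
    filter_upwards [ih, h.recursion (((k + 1 : ℕ) : ℤ) - 1 - n)] with ω h1 h2
    rw [h2, truncVAR, pow_succ', ← Matrix.mulVec_mulVec, ← h1, Matrix.mulVec_sub]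
    have e1 : (((k + 1 : ℕ) : ℤ) - 1 - n) - 1 = (k : ℤ) - 1 - n := by push_cast; ring
    have e2 : ((k + 1 : ℕ) : ℤ) - 1 - n = (k : ℤ) - n := by push_cast; ring
    rw [e1, e2]
    exact add_sub_add_right_eq_sub _ _ _

/-- Along a subsequence the truncated processes converge almost surely to the stationary
solution, simultaneously at all nonnegative times. -/
theorem IsStationaryVAR.exists_truncVAR_tendsto (h : IsStationaryVAR Pr A H ζ y)
    (hA : spectralRadius ℂ (A.map (algebraMap ℝ ℂ)) < 1) :
    ∃ ns : ℕ → ℕ, ∀ᵐ ω ∂Pr, ∀ t : ℕ,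
      Tendsto (fun i => truncVAR A H ζ (ns i) (ns i + 1 + t) ω) atTop (𝓝 (y t ω)) := by
  have hy := h.measurable
  have hm : ∀ k : ℕ, Measurable fun v : Fin p → ℝ => (A ^ k) *ᵥ v := fun k =>
    (Matrix.mulVecLin (A ^ k)).continuous_of_finiteDimensional.measurable
  have h0 : TendstoInMeasure Pr (fun (n : ℕ) ω => (A ^ (n + 1)) *ᵥ y 0 ω) atTop fun _ => 0 :=
    tendstoInMeasure_of_tendsto_ae (fun n => ((hm _).comp (hy 0)).aestronglyMeasurable)
      (ae_of_all _ fun ω => (tendsto_pow_mulVec_zero (tendsto_pow_zero_of_stable A hA)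
        (y 0 ω)).comp (tendsto_add_atTop_nat 1))
  -- The starting value recedes into the past with `n`, so pointwise convergence is not available;
  -- by stationarity it may be replaced in law by `y 0`, which gives convergence in probability. A
  -- subsequence then converges almost surely.
  have h1 : TendstoInMeasure Pr (fun (n : ℕ) ω => (A ^ (n + 1)) *ᵥ y (-1 - n) ω) atTop
      fun _ => 0 := by
    intro ε hε
    refine (h0 ε hε).congr fun n => ?_
    have hs : MeasurableSet {v : Fin p → ℝ | ε ≤ edist ((A ^ (n + 1)) *ᵥ v) 0} :=
      measurableSet_le measurable_const ((hm _).edist measurable_const)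
    have h2 := congrArg (fun μ => μ {v : Fin p → ℝ | ε ≤ edist ((A ^ (n + 1)) *ᵥ v) 0})
      (h.map_eq (-1 - n))
    rw [Measure.map_apply (hy _) hs, Measure.map_apply (hy _) hs] at h2
    exact h2.symm
  obtain ⟨ns, -, hns⟩ := h1.exists_seq_tendsto_ae
  refine ⟨ns, ?_⟩
  have h3 : ∀ᵐ ω ∂Pr, ∀ n k : ℕ,
      y ((k : ℤ) - 1 - n) ω - truncVAR A H ζ n k ω = (A ^ k) *ᵥ y (-1 - n) ω :=
    ae_all_iff.2 fun n => ae_all_iff.2 fun k => h.sub_truncVAR_ae n k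
  filter_upwards [h3, hns] with ω hω hlim t
  have h4 : Tendsto (fun i => (A ^ t) *ᵥ ((A ^ (ns i + 1)) *ᵥ y (-1 - ns i) ω)) atTop (𝓝 0) := by
    have := ((Matrix.mulVecLin (A ^ t)).continuous_of_finiteDimensional.tendsto 0).comp hlim
    simpa [Function.comp_def] using this
  have h5 : ∀ i, truncVAR A H ζ (ns i) (ns i + 1 + t) ω
      = y t ω - (A ^ t) *ᵥ ((A ^ (ns i + 1)) *ᵥ y (-1 - ns i) ω) := by
    intro i
    have := hω (ns i) (ns i + 1 + t)
    rw [Matrix.mulVec_mulVec, ← pow_add, add_comm t, ← this]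
    have e : (((ns i + 1 + t : ℕ) : ℤ) - 1 - ns i) = t := by push_cast; ring
    rw [e]
    abel
  simp only [h5]
  simpa using h4.const_sub (y t ω)

/-- Fatou's lemma for exponential moments along the truncated processes. -/
theorem IsStationaryVAR.expMoment_le_of_truncVAR (h : IsStationaryVAR Pr A H ζ y)
    (hA : spectralRadius ℂ (A.map (algebraMap ℝ ℂ)) < 1)
    {F : Ω → (ℕ → Fin p → ℝ) → ℝ} (hF : ∀ ω, Continuous (F ω)) {B : ℝ≥0∞}
    (hm : ∀ n, Measurable fun ω => F ω fun t => truncVAR A H ζ n (n + 1 + t) ω)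
    (hB : ∀ n, expMoment Pr (fun ω => F ω fun t => truncVAR A H ζ n (n + 1 + t) ω) ≤ B) :
    expMoment Pr (fun ω => F ω fun t => y t ω) ≤ B := by
  obtain ⟨ns, hns⟩ := h.exists_truncVAR_tendsto hA
  unfold expMoment at hB ⊢
  calc ∫⁻ ω, ENNReal.ofReal (Real.exp (F ω fun t => y t ω)) ∂Pr
      = ∫⁻ ω, liminf (fun i => ENNReal.ofReal
          (Real.exp (F ω fun t => truncVAR A H ζ (ns i) (ns i + 1 + t) ω))) atTop ∂Pr := by
        refine lintegral_congr_ae ?_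
        filter_upwards [hns] with ω hω
        refine (Tendsto.liminf_eq ?_).symm
        refine (ENNReal.continuous_ofReal.tendsto _).comp
          ((Real.continuous_exp.tendsto _).comp (((hF ω).tendsto _).comp ?_))
        exact tendsto_pi_nhds.2 hω
    _ ≤ liminf (fun i => ∫⁻ ω, ENNReal.ofReal
          (Real.exp (F ω fun t => truncVAR A H ζ (ns i) (ns i + 1 + t) ω)) ∂Pr) atTop :=
        lintegral_liminf_le fun i => (Real.measurable_exp.comp (hm _)).ennreal_ofReal
    _ ≤ B := by
        refine liminf_le_of_le (by isBoundedDefault) fun b hb => ?_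
        obtain ⟨i, hi⟩ := hb.exists
        exact hi.trans (hB _)

end Approximation

end CommonVAR

/-! ### Exponential moments of the stationary process. -/

namespace CommonVAR

section Duality

variable {p : ℕ}

/-- Summation by parts for a linear recursion and its adjoint recursion. -/
lemma sum_dotProduct_eq_sum_adjoint (A : Matrix (Fin p) (Fin p) ℝ) {φ w : ℕ → Fin p → ℝ}
    (h0 : φ 0 = w 0) (hφ : ∀ k, φ (k + 1) = Aᵀ *ᵥ φ k + w (k + 1)) (N : ℕ) :
    ∀ {x e : ℕ → Fin p → ℝ}, (∀ k, x (k + 1) = A *ᵥ x k + e k) →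
      ∑ k ∈ Finset.range (N + 1), w (N - k) ⬝ᵥ x k
        = φ N ⬝ᵥ x 0 + ∑ k ∈ Finset.range N, φ (N - 1 - k) ⬝ᵥ e k := by
  induction N with
  | zero => intro x e _; simp [h0]
  | succ N ih =>
    intro x e hx
    rw [Finset.sum_range_succ']
    have h1 := ih (x := fun k => x (k + 1)) (e := fun k => e (k + 1)) (fun k => hx (k + 1))
    have h2 : ∀ k, N + 1 - (k + 1) = N - k := fun k => by omega
    simp only [h2, zero_add] at h1 ⊢
    rw [h1, Finset.sum_range_succ', hx 0, hφ N]
    have h3 : ∑ k ∈ Finset.range N, φ (N - (k + 1)) ⬝ᵥ e (k + 1)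
        = ∑ k ∈ Finset.range N, φ (N - 1 - k) ⬝ᵥ e (k + 1) :=
      Finset.sum_congr rfl fun k _ => by rw [Nat.sub_sub, Nat.add_comm 1 k]
    simp only [Nat.sub_zero, h3, dotProduct_add, add_dotProduct,
      Matrix.mulVec_transpose, ← Matrix.dotProduct_mulVec]
    ring

end Duality

section Moments

variable {Ω : Type*} [MeasurableSpace Ω] {Pr : Measure Ω} [IsProbabilityMeasure Pr] {p : ℕ}
  {A H : Matrix (Fin p) (Fin p) ℝ} {τ : ℝ≥0} {ζ y : ℤ → Ω → Fin p → ℝ}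

lemma dotProduct_mulVec_eq (H : Matrix (Fin p) (Fin p) ℝ) (v x : Fin p → ℝ) :
    v ⬝ᵥ H *ᵥ x = (Hᵀ *ᵥ v) ⬝ᵥ x := by
  rw [Matrix.dotProduct_mulVec, Matrix.mulVec_transpose]

lemma continuous_dotProduct_apply (v : Fin p → ℝ) (t : ℕ) :
    Continuous fun u : ℕ → Fin p → ℝ => v ⬝ᵥ u t := by
  simp only [dotProduct]; fun_prop

lemma measurable_dotProduct_right (v : Fin p → ℝ) {f : Ω → Fin p → ℝ} (hf : Measurable f) :
    Measurable fun ω => v ⬝ᵥ f ω := by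
  simp only [dotProduct]; fun_prop

lemma IsInnovation.measurable_truncVAR (h : IsInnovation Pr τ ζ) (n k : ℕ) :
    Measurable (truncVAR A H ζ n k) :=
  (CommonVAR.measurable_truncVAR A H ζ n k).mono (pastField_le h.measurable _) le_rfl

/-- Small-ball exponential moment of the quadratic form of the process. -/
theorem IsStationaryVAR.expMoment_neg_sum_sq_le_one (hy : IsStationaryVAR Pr A H ζ y)
    (h : IsInnovation Pr τ ζ) (hA : spectralRadius ℂ (A.map (algebraMap ℝ ℂ)) < 1)
    {v : Fin p → ℝ} (hv : 0 < (Hᵀ *ᵥ v) ⬝ᵥ (Hᵀ *ᵥ v)) (T : ℕ) :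
    expMoment Pr (fun ω => ∑ t ∈ Finset.range T,
      (-(sqScale ((τ : ℝ) ^ 2) / ((Hᵀ *ᵥ v) ⬝ᵥ (Hᵀ *ᵥ v)) * (v ⬝ᵥ y t ω) ^ 2)
        + 7 / 8 * sqScale ((τ : ℝ) ^ 2))) ≤ 1 := by
  set c := Hᵀ *ᵥ v with hc
  refine hy.expMoment_le_of_truncVAR hA (F := fun _ u => ∑ t ∈ Finset.range T,
      (-(sqScale ((τ : ℝ) ^ 2) / (c ⬝ᵥ c) * (v ⬝ᵥ u t) ^ 2)
        + 7 / 8 * sqScale ((τ : ℝ) ^ 2))) (fun _ => ?_) (fun n => ?_) fun n => ?_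
  · refine continuous_finsetSum _ fun t _ => ?_
    have := continuous_dotProduct_apply v t
    fun_prop
  · refine Finset.measurable_fun_sum _ fun t _ => ?_
    have := measurable_dotProduct_right v (h.measurable_truncVAR (A := A) (H := H) n (n + 1 + t))
    fun_prop
  -- The recursion is unfolded once, so that `v ⬝ᵥ y_t` is the predictable `v ⬝ᵥ A *ᵥ x` plus the
  -- fresh `c ⬝ᵥ ζ_t`; hence the start `n` instead of `n + 1`.
  · have key := expMoment_truncVAR_le_one A H h.measurable h.indep n n
      (f := fun _ x e => -(sqScale ((τ : ℝ) ^ 2) / (c ⬝ᵥ c) * (v ⬝ᵥ A *ᵥ x + c ⬝ᵥ e) ^ 2)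
        + 7 / 8 * sqScale ((τ : ℝ) ^ 2))
      (fun k => by simp only [dotProduct, mulVec, Function.uncurry_def]; fun_prop)
      (fun k a t => h.expMoment_neg_sq_le_one t hv _) T
    refine le_trans (expMoment_mono fun ω => le_of_eq ?_) key
    refine Finset.sum_congr rfl fun t _ => ?_
    have e1 : n + 1 + t = n + t + 1 := by ring
    simp only [e1]
    rw [truncVAR, dotProduct_add, dotProduct_mulVec_eq H]
    push_cast
    rfl

/-- Exponential moment of the martingale of cross products of innovations and past values. -/
theorem IsStationaryVAR.expMoment_sum_cross_le_one (hy : IsStationaryVAR Pr A H ζ y)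
    (h : IsInnovation Pr τ ζ) (hA : spectralRadius ℂ (A.map (algebraMap ℝ ℂ)) < 1)
    (u v : Fin p → ℝ) (s : ℝ) (T : ℕ) :
    expMoment Pr (fun ω => ∑ t ∈ Finset.range T,
      (s * (u ⬝ᵥ H *ᵥ ζ ((t : ℤ) + 1) ω) * (v ⬝ᵥ y t ω)
        - (τ : ℝ) ^ 2 * ((Hᵀ *ᵥ u) ⬝ᵥ (Hᵀ *ᵥ u)) * s ^ 2 * (v ⬝ᵥ y t ω) ^ 2 / 2)) ≤ 1 := by
  have hζ := h.measurable
  refine hy.expMoment_le_of_truncVAR hA (F := fun ω x => ∑ t ∈ Finset.range T,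
      (s * (u ⬝ᵥ H *ᵥ ζ ((t : ℤ) + 1) ω) * (v ⬝ᵥ x t)
        - (τ : ℝ) ^ 2 * ((Hᵀ *ᵥ u) ⬝ᵥ (Hᵀ *ᵥ u)) * s ^ 2 * (v ⬝ᵥ x t) ^ 2 / 2))
      (fun _ => ?_) (fun n => ?_) fun n => ?_
  · refine continuous_finsetSum _ fun t _ => ?_
    have := continuous_dotProduct_apply v t
    fun_prop
  · refine Finset.measurable_fun_sum _ fun t _ => ?_
    have h1 := measurable_dotProduct_right v (h.measurable_truncVAR (A := A) (H := H) n (n + 1 + t))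
    have h2 := measurable_dotProduct_right u (measurable_mulVec H (hζ ((t : ℤ) + 1)))
    fun_prop
  -- Here `v ⬝ᵥ y_t` belongs to the past of `ζ_{t+1}` and acts as a frozen multiplier of the linear
  -- sub-Gaussian bound.
  · have key := expMoment_truncVAR_le_one A H h.measurable h.indep n (n + 1)
      (f := fun _ x e => (s * (v ⬝ᵥ x)) * ((Hᵀ *ᵥ u) ⬝ᵥ e)
        - (τ : ℝ) ^ 2 * ((Hᵀ *ᵥ u) ⬝ᵥ (Hᵀ *ᵥ u)) * (s * (v ⬝ᵥ x)) ^ 2 / 2)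
      (fun k => by simp only [dotProduct, Function.uncurry_def]; fun_prop)
      (fun k a t => h.expMoment_dotProduct_sub_le_one t _ _) T
    refine le_trans (expMoment_mono fun ω => le_of_eq ?_) key
    refine Finset.sum_congr rfl fun t _ => ?_
    have e1 : ((n + 1 : ℕ) : ℤ) + t - n = (t : ℤ) + 1 := by push_cast; ring
    rw [e1, dotProduct_mulVec_eq H]
    ring

/-- Exponential moment of the total energy of the innovations. -/
theorem IsInnovation.expMoment_sum_sum_sq_le_one (h : IsInnovation Pr τ ζ) (T : ℕ) :
    expMoment Pr (fun ω => ∑ t ∈ Finset.range T,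
      (sqScale ((τ : ℝ) ^ 2) * (ζ ((t : ℤ) + 1) ω ⬝ᵥ ζ ((t : ℤ) + 1) ω)
        - 2 * sqScale ((τ : ℝ) ^ 2) * p)) ≤ 1 := by
  have key := expMoment_truncVAR_le_one 0 0 h.measurable h.indep 0 1
      (f := fun _ _ e => sqScale ((τ : ℝ) ^ 2) * (e ⬝ᵥ e) - 2 * sqScale ((τ : ℝ) ^ 2) * p)
      (fun k => by simp only [dotProduct, Function.uncurry_def]; fun_prop)
      (fun k a t => h.expMoment_sum_sq_sub_le_one t) T
  refine le_trans (expMoment_mono fun ω => le_of_eq ?_) key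
  refine Finset.sum_congr rfl fun t _ => ?_
  have e1 : ((1 : ℕ) : ℤ) + t - (0 : ℕ) = (t : ℤ) + 1 := by push_cast; ring
  rw [e1]

variable {m L : ℝ}

/-- Summation by parts writes the functional as a sum over independent innovations whose
coefficients solve the adjoint recursion driven by the time-reversed `w`. The energy estimate bounds
their total square by `∑ |w|² / m`, with no loss in the number of time steps. -/
lemma IsInnovation.expMoment_truncVAR_linear_le (h : IsInnovation Pr τ ζ)
    (hA : spectralRadius ℂ (A.map (algebraMap ℝ ℂ)) < 1) (hm : 0 < m)
    (hAm : ∀ z : ℂ, ‖z‖ = 1 → ∀ x : Fin p → ℂ,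
      m * ∑ i, ‖x i‖ ^ 2 ≤ ∑ i, ‖(x - z • (Aᵀ.map (algebraMap ℝ ℂ) *ᵥ x)) i‖ ^ 2)
    (hL0 : 0 ≤ L) (hL : ∀ v, (Hᵀ *ᵥ v) ⬝ᵥ (Hᵀ *ᵥ v) ≤ L * (v ⬝ᵥ v)) (n N : ℕ)
    (w : ℕ → Fin p → ℝ) :
    expMoment Pr (fun ω => ∑ k ∈ Finset.range (N + 1), w k ⬝ᵥ truncVAR A H ζ n k ω)
      ≤ ENNReal.ofReal (Real.exp ((τ : ℝ) ^ 2 * (L / m)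
        * (∑ k ∈ Finset.range (N + 1), w k ⬝ᵥ w k) / 2)) := by
  set φ : ℕ → Fin p → ℝ := fun k => Nat.rec (w N) (fun j q => Aᵀ *ᵥ q + w (N - (j + 1))) k with hφ
  have hφ0 : φ 0 = w (N - 0) := rfl
  have hφs : ∀ k, φ (k + 1) = Aᵀ *ᵥ φ k + w (N - (k + 1)) := fun k => rfl
  have hfilt := sum_dotProduct_recursion_le Aᵀ hm.le hAm
    (tendsto_pow_mulVec_zero (tendsto_transpose_pow_zero (tendsto_pow_zero_of_stable A hA)))
    φ (fun k => w (N - k)) hφ0 hφs N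
  have hrefl : ∑ k ∈ Finset.range (N + 1), w (N - k) ⬝ᵥ w (N - k)
      = ∑ k ∈ Finset.range (N + 1), w k ⬝ᵥ w k := by
    simpa using! Finset.sum_range_reflect (fun k => w k ⬝ᵥ w k) (N + 1)
  have hsum : ∀ ω, ∑ k ∈ Finset.range (N + 1), w k ⬝ᵥ truncVAR A H ζ n k ω
      = ∑ k ∈ Finset.range N, (Hᵀ *ᵥ φ (N - 1 - k)) ⬝ᵥ ζ ((k : ℤ) - n) ω := by
    intro ω
    have h1 := sum_dotProduct_eq_sum_adjoint A (w := fun k => w (N - k)) hφ0 hφs N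
      (x := fun k => truncVAR A H ζ n k ω)
      (e := fun k => H *ᵥ ζ ((k : ℤ) - n) ω) (fun k => rfl)
    have h2 : truncVAR A H ζ n 0 ω = 0 := rfl
    rw [h2, dotProduct_zero, zero_add] at h1
    simp only [← dotProduct_mulVec_eq]
    rw [← h1]
    refine Finset.sum_congr rfl fun k hk => ?_
    have : N - (N - k) = k := by have := Finset.mem_range.1 hk; omega
    rw [this]
  have key := expMoment_truncVAR_le_one A H h.measurable h.indep n 0
      (f := fun k _ e => 1 * ((Hᵀ *ᵥ φ (N - 1 - k)) ⬝ᵥ e)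
        - (τ : ℝ) ^ 2 * ((Hᵀ *ᵥ φ (N - 1 - k)) ⬝ᵥ (Hᵀ *ᵥ φ (N - 1 - k))) * 1 ^ 2 / 2)
      (fun k => by simp only [dotProduct, Function.uncurry_def]; fun_prop)
      (fun k a t => h.expMoment_dotProduct_sub_le_one t _ _) N
  have hbound : ∑ k ∈ Finset.range N, (τ : ℝ) ^ 2
        * ((Hᵀ *ᵥ φ (N - 1 - k)) ⬝ᵥ (Hᵀ *ᵥ φ (N - 1 - k))) * 1 ^ 2 / 2
      ≤ (τ : ℝ) ^ 2 * (L / m) * (∑ k ∈ Finset.range (N + 1), w k ⬝ᵥ w k) / 2 := by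
    have h1 : ∑ k ∈ Finset.range N, φ (N - 1 - k) ⬝ᵥ φ (N - 1 - k)
        ≤ (∑ k ∈ Finset.range (N + 1), w k ⬝ᵥ w k) / m := by
      rw [Finset.sum_range_reflect (fun k => φ k ⬝ᵥ φ k) N, le_div_iff₀ hm, mul_comm, ← hrefl]
      refine le_trans (mul_le_mul_of_nonneg_left ?_ hm.le) hfilt
      rw [Finset.sum_range_succ]
      exact le_add_of_nonneg_right (dotProduct_self_nonneg _)
    calc _ = (τ : ℝ) ^ 2 / 2 * ∑ k ∈ Finset.range N,
          (Hᵀ *ᵥ φ (N - 1 - k)) ⬝ᵥ (Hᵀ *ᵥ φ (N - 1 - k)) := by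
          rw [Finset.mul_sum]
          exact Finset.sum_congr rfl fun k _ => by ring
      _ ≤ (τ : ℝ) ^ 2 / 2 * ∑ k ∈ Finset.range N, L * (φ (N - 1 - k) ⬝ᵥ φ (N - 1 - k)) := by
          gcongr; exact hL _
      _ ≤ (τ : ℝ) ^ 2 / 2 * (L * ((∑ k ∈ Finset.range (N + 1), w k ⬝ᵥ w k) / m)) := by
          rw [← Finset.mul_sum]
          gcongr
      _ = _ := by ring
  set B := ∑ k ∈ Finset.range N, (τ : ℝ) ^ 2
        * ((Hᵀ *ᵥ φ (N - 1 - k)) ⬝ᵥ (Hᵀ *ᵥ φ (N - 1 - k))) * 1 ^ 2 / 2 with hB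
  calc expMoment Pr (fun ω => ∑ k ∈ Finset.range (N + 1), w k ⬝ᵥ truncVAR A H ζ n k ω)
      = expMoment Pr (fun ω => ∑ j ∈ Finset.range N,
          (1 * ((Hᵀ *ᵥ φ (N - 1 - j)) ⬝ᵥ ζ (((0 : ℕ) : ℤ) + j - n) ω)
          - (τ : ℝ) ^ 2 * ((Hᵀ *ᵥ φ (N - 1 - j)) ⬝ᵥ (Hᵀ *ᵥ φ (N - 1 - j))) * 1 ^ 2 / 2) + B) := by
        congr 1
        ext ω
        rw [hsum, Finset.sum_sub_distrib, sub_add_cancel]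
        simp
    _ ≤ 1 * ENNReal.ofReal (Real.exp B) := by
        rw [expMoment_add_const]
        gcongr
    _ ≤ _ := by
        rw [one_mul]
        exact ENNReal.ofReal_le_ofReal (Real.exp_le_exp.2 hbound)

/-- Linear functionals of the stationary process are sub-Gaussian. -/
theorem IsStationaryVAR.expMoment_linear_le (hy : IsStationaryVAR Pr A H ζ y)
    (h : IsInnovation Pr τ ζ)
    (hA : spectralRadius ℂ (A.map (algebraMap ℝ ℂ)) < 1) (hm : 0 < m)
    (hAm : ∀ z : ℂ, ‖z‖ = 1 → ∀ x : Fin p → ℂ,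
      m * ∑ i, ‖x i‖ ^ 2 ≤ ∑ i, ‖(x - z • (Aᵀ.map (algebraMap ℝ ℂ) *ᵥ x)) i‖ ^ 2)
    (hL0 : 0 ≤ L) (hL : ∀ v, (Hᵀ *ᵥ v) ⬝ᵥ (Hᵀ *ᵥ v) ≤ L * (v ⬝ᵥ v)) (N : ℕ)
    (w : ℕ → Fin p → ℝ) :
    expMoment Pr (fun ω => ∑ t ∈ Finset.range N, w t ⬝ᵥ y t ω)
      ≤ ENNReal.ofReal (Real.exp ((τ : ℝ) ^ 2 * (L / m)
        * (∑ t ∈ Finset.range N, w t ⬝ᵥ w t) / 2)) := by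
  refine hy.expMoment_le_of_truncVAR hA
    (F := fun _ u => ∑ t ∈ Finset.range N, w t ⬝ᵥ u t) (fun _ => ?_) (fun n => ?_) fun n => ?_
  · exact continuous_finsetSum _ fun t _ => continuous_dotProduct_apply (w t) t
  · exact Finset.measurable_fun_sum _ fun t _ =>
      measurable_dotProduct_right (w t) (h.measurable_truncVAR (A := A) (H := H) n (n + 1 + t))
  -- Zero weights during the `n + 1` steps before time 0.
  · set w' : ℕ → Fin p → ℝ := fun k => if k < n + 1 then 0 else w (k - (n + 1)) with hw'
    have h0 : ∀ k ∈ Finset.range (n + 1), w' k = 0 := fun k hk => by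
      rw [hw']; exact if_pos (Finset.mem_range.1 hk)
    have h1 : ∀ t, w' (n + 1 + t) = w t := fun t => by
      rw [hw']
      simp only [if_neg (show ¬ n + 1 + t < n + 1 by omega), Nat.add_sub_cancel_left]
    have key := h.expMoment_truncVAR_linear_le hA hm hAm hL0 hL n (n + N) w'
    have e : n + N + 1 = n + 1 + N := by ring
    rw [e, Finset.sum_range_add] at key
    simp only [Finset.sum_range_add _ (n + 1) N] at key
    rw [Finset.sum_eq_zero fun k hk => by rw [h0 k hk, dotProduct_zero], zero_add] at key
    refine le_trans (expMoment_mono fun ω => le_of_eq ?_) (key.trans (le_of_eq ?_))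
    · have h2 : ∑ k ∈ Finset.range (n + 1), w' k ⬝ᵥ truncVAR A H ζ n k ω = 0 :=
        Finset.sum_eq_zero fun k hk => by rw [h0 k hk, zero_dotProduct]
      rw [h2, zero_add]
      simp only [h1]
    · simp only [h1]

end Moments

end CommonVAR

/-! ### Tail bounds in a fixed direction. -/

namespace CommonVAR

/-- Bounds on the spectral quantities of a stable VAR model with noise `H ζ_t`: `m` bounds the
symbol of the transition matrix from below, and `l`, `L` bound the noise covariance `H Hᵀ`. -/
structure SpectralBounds {p : ℕ} (A H : Matrix (Fin p) (Fin p) ℝ) (m l L : ℝ) : Prop where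
  stable : spectralRadius ℂ (A.map (algebraMap ℝ ℂ)) < 1
  m_pos : 0 < m
  symbol : ∀ z : ℂ, ‖z‖ = 1 → ∀ x : Fin p → ℂ,
    m * ∑ i, ‖x i‖ ^ 2 ≤ ∑ i, ‖(x - z • (A.map (algebraMap ℝ ℂ) *ᵥ x)) i‖ ^ 2
  symbol_transpose : ∀ z : ℂ, ‖z‖ = 1 → ∀ x : Fin p → ℂ,
    m * ∑ i, ‖x i‖ ^ 2 ≤ ∑ i, ‖(x - z • (Aᵀ.map (algebraMap ℝ ℂ) *ᵥ x)) i‖ ^ 2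
  l_pos : 0 < l
  le_L : l ≤ L
  l_le : ∀ v, l * (v ⬝ᵥ v) ≤ (Hᵀ *ᵥ v) ⬝ᵥ (Hᵀ *ᵥ v)
  le_L_mul : ∀ v, (Hᵀ *ᵥ v) ⬝ᵥ (Hᵀ *ᵥ v) ≤ L * (v ⬝ᵥ v)
  noise_le : ∀ v, (H *ᵥ v) ⬝ᵥ (H *ᵥ v) ≤ L * (v ⬝ᵥ v)

lemma SpectralBounds.L_pos {p : ℕ} {A H : Matrix (Fin p) (Fin p) ℝ} {m l L : ℝ}
    (hb : SpectralBounds A H m l L) : 0 < L := hb.l_pos.trans_le hb.le_L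

/-- The quadratic form `∑_{t < T} (v · y_t)²` of the Gram matrix of the data. -/
noncomputable def gramForm {Ω : Type*} {p : ℕ} (y : ℤ → Ω → Fin p → ℝ) (T : ℕ) (v : Fin p → ℝ)
    (ω : Ω) : ℝ := ∑ t ∈ Finset.range T, (v ⬝ᵥ y t ω) ^ 2

lemma gramForm_nonneg {Ω : Type*} {p : ℕ} (y : ℤ → Ω → Fin p → ℝ) (T : ℕ) (v : Fin p → ℝ)
    (ω : Ω) : 0 ≤ gramForm y T v ω := Finset.sum_nonneg fun _ _ => sq_nonneg _

section Tails

variable {Ω : Type*} [MeasurableSpace Ω] {Pr : Measure Ω} [IsProbabilityMeasure Pr] {p : ℕ}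
  {A H : Matrix (Fin p) (Fin p) ℝ} {τ : ℝ≥0} {ζ y : ℤ → Ω → Fin p → ℝ} {m l L : ℝ}

lemma measurable_gramForm (hy : ∀ t, Measurable (y t)) (T : ℕ) (v : Fin p → ℝ) :
    Measurable (gramForm y T v) :=
  Finset.measurable_fun_sum _ fun _ _ => (measurable_dotProduct_right v (hy _)).pow_const 2

lemma sqrt_two_pow_le (n : ℕ) : Real.sqrt 2 ^ n ≤ Real.exp (n / 2) := by
  have h1 : Real.sqrt 2 ≤ Real.exp (1 / 2) := by
    have := Real.add_one_le_exp (1 / 2 : ℝ)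
    linarith [sqrt_two_le]
  calc Real.sqrt 2 ^ n ≤ Real.exp (1 / 2) ^ n := pow_le_pow_left₀ (Real.sqrt_nonneg _) h1 n
    _ = _ := by rw [← Real.exp_nat_mul]; congr 1; ring

/-- Upper exponential moment of the Gram form. -/
theorem IsStationaryVAR.expMoment_gramForm_le (hy : IsStationaryVAR Pr A H ζ y)
    (h : IsInnovation Pr τ ζ) (hb : SpectralBounds A H m l L) (hK : 1 ≤ (τ : ℝ) ^ 2)
    {v : Fin p → ℝ} (hv : 0 < v ⬝ᵥ v) (T : ℕ) :
    expMoment Pr (fun ω => gramForm y T v ω / (4 * ((τ : ℝ) ^ 2 * (L / m) * (v ⬝ᵥ v))))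
      ≤ ENNReal.ofReal (Real.exp (T / 2)) := by
  have hm := hb.m_pos
  have hL := hb.L_pos
  have hym := hy.measurable
  have key := expMoment_sum_sq_le (Pr := Pr) (ι := Fin T) (X := fun ω t => v ⬝ᵥ y (t : ℕ) ω)
    (measurable_pi_lambda _ fun t => measurable_dotProduct_right v (hym _))
    (K := (τ : ℝ) ^ 2 * (L / m) * (v ⬝ᵥ v)) (by positivity) fun g => ?_
  · refine le_trans (le_of_eq ?_) (key.trans (ENNReal.ofReal_le_ofReal ?_))
    · congr 1
      ext ω
      rw [gramForm, Finset.sum_range]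
    · simpa using sqrt_two_pow_le T
  · set w : ℕ → Fin p → ℝ := fun t => if ht : t < T then g ⟨t, ht⟩ • v else 0 with hw
    have hwt : ∀ t : Fin T, w t = g t • v := fun t => by simp [hw]
    have h1 := hy.expMoment_linear_le h hb.stable hm hb.symbol_transpose hL.le hb.le_L_mul T w
    refine le_trans (le_of_eq ?_) (h1.trans (le_of_eq ?_))
    · congr 1
      ext ω
      rw [Finset.sum_range]
      exact Finset.sum_congr rfl fun t _ => by rw [hwt, smul_dotProduct, smul_eq_mul]
    · have h2 : ∑ t ∈ Finset.range T, w t ⬝ᵥ w t = v ⬝ᵥ v * ∑ t, g t ^ 2 := by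
        rw [Finset.sum_range, Finset.mul_sum]
        refine Finset.sum_congr rfl fun t _ => ?_
        rw [hwt, smul_dotProduct, dotProduct_smul, smul_eq_mul, smul_eq_mul]
        ring
      rw [h2, mul_assoc _ (v ⬝ᵥ v)]

/-- Exponential moment of the squared length of one observation. -/
theorem IsStationaryVAR.expMoment_dotProduct_self_le (hy : IsStationaryVAR Pr A H ζ y)
    (h : IsInnovation Pr τ ζ) (hb : SpectralBounds A H m l L) (hK : 1 ≤ (τ : ℝ) ^ 2) (s : ℕ) :
    expMoment Pr (fun ω => (y s ω ⬝ᵥ y s ω) / (4 * ((τ : ℝ) ^ 2 * (L / m))))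
      ≤ ENNReal.ofReal (Real.exp (p / 2)) := by
  have hm := hb.m_pos
  have hL := hb.L_pos
  have key := expMoment_sum_sq_le (Pr := Pr) (ι := Fin p) (X := fun ω => y s ω)
    (hy.measurable s) (K := (τ : ℝ) ^ 2 * (L / m)) (by positivity) fun g => ?_
  · refine le_trans (le_of_eq ?_) (key.trans (ENNReal.ofReal_le_ofReal ?_))
    · simp only [dotProduct, pow_two]
    · simpa using sqrt_two_pow_le p
  · set w : ℕ → Fin p → ℝ := fun t => if t = s then g else 0 with hw
    have hs : s ∈ Finset.range (s + 1) := Finset.self_mem_range_succ s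
    have h1 := hy.expMoment_linear_le h hb.stable hm hb.symbol_transpose hL.le hb.le_L_mul
      (s + 1) w
    have h2 : ∀ f : ℕ → Fin p → ℝ, ∑ t ∈ Finset.range (s + 1), w t ⬝ᵥ f t = g ⬝ᵥ f s := by
      intro f
      rw [Finset.sum_eq_single_of_mem s hs fun t _ ht => by simp [hw, ht]]
      simp [hw]
    refine le_trans (le_of_eq ?_) (h1.trans (le_of_eq ?_))
    · congr 1
      ext ω
      rw [h2 fun t => y t ω]
      rfl
    · congr 3
      rw [h2]
      simp [hw, dotProduct, pow_two]

/-- Lower tail of the Gram form. -/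
theorem IsStationaryVAR.measure_gramForm_lt_le (hy : IsStationaryVAR Pr A H ζ y)
    (h : IsInnovation Pr τ ζ) (hb : SpectralBounds A H m l L) (hK : 1 ≤ (τ : ℝ) ^ 2)
    (v : Fin p → ℝ) (T : ℕ) :
    Pr {ω | gramForm y T v ω < 3 / 4 * T * l * (v ⬝ᵥ v)}
      ≤ ENNReal.ofReal (Real.exp (-(sqScale ((τ : ℝ) ^ 2) * T / 8))) := by
  rcases (dotProduct_self_nonneg v).eq_or_lt with hv | hv
  · rw [← hv, mul_zero]
    have : {ω | gramForm y T v ω < 0} = ∅ := by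
      ext ω; simpa using gramForm_nonneg y T v ω
    rw [this]; simp
  have hc : 0 < (Hᵀ *ᵥ v) ⬝ᵥ (Hᵀ *ᵥ v) := (mul_pos hb.l_pos hv).trans_le (hb.l_le v)
  have hE := hy.expMoment_neg_sum_sq_le_one h hb.stable hc T
  have hθ := sqScale_pos hK
  have hll := hb.l_le v
  set θ := sqScale ((τ : ℝ) ^ 2) with hθd
  set c := (Hᵀ *ᵥ v) ⬝ᵥ (Hᵀ *ᵥ v) with hcd
  rw [← ENNReal.ofReal_one] at hE
  -- On the event the exponent is at least `(7/8 - 3/4) θT = θT/8`.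
  have hM := measure_le_of_expMoment_le (Finset.measurable_fun_sum _ fun t _ => by
    have := measurable_dotProduct_right v (hy.measurable t)
    fun_prop) (a := θ * T / 8) hE
  rw [mul_one] at hM
  refine le_trans (measure_mono fun ω hω => ?_) hM
  simp only [Set.mem_ofPred_eq] at hω ⊢
  rw [Finset.sum_add_distrib, Finset.sum_neg_distrib, ← Finset.mul_sum, Finset.sum_const,
    Finset.card_range, nsmul_eq_mul]
  have h1 : θ / c * gramForm y T v ω ≤ 3 / 4 * T * θ := by
    have h2 : gramForm y T v ω ≤ 3 / 4 * T * c := by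
      refine hω.le.trans ?_
      have : (0 : ℝ) ≤ 3 / 4 * T := by positivity
      nlinarith [mul_le_mul_of_nonneg_left hll this]
    calc θ / c * gramForm y T v ω ≤ θ / c * (3 / 4 * T * c) := by gcongr
      _ = _ := by field_simp
  unfold gramForm at h1
  linarith

/-- Upper tail of the Gram form, in directions of length at most two. -/
theorem IsStationaryVAR.measure_le_gramForm_le (hy : IsStationaryVAR Pr A H ζ y)
    (h : IsInnovation Pr τ ζ) (hb : SpectralBounds A H m l L) (hK : 1 ≤ (τ : ℝ) ^ 2)
    {v : Fin p → ℝ} (hv4 : v ⬝ᵥ v ≤ 4) {T : ℕ} (hT : 0 < T) :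
    Pr {ω | 32 * (τ : ℝ) ^ 2 * (L / m) * T ≤ gramForm y T v ω}
      ≤ ENNReal.ofReal (Real.exp (-T)) := by
  have hm := hb.m_pos
  have hL := hb.L_pos
  have hT' : (0 : ℝ) < T := by exact_mod_cast hT
  rcases (dotProduct_self_nonneg v).eq_or_lt with hv | hv
  · have hv0 : v = 0 := dotProduct_self_eq_zero.1 hv.symm
    have : {ω | 32 * (τ : ℝ) ^ 2 * (L / m) * T ≤ gramForm y T v ω} = ∅ := by
      ext ω
      simp only [hv0, gramForm, zero_dotProduct, Set.mem_ofPred_eq, Set.mem_empty_iff_false,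
        iff_false, not_le]
      simp only [ne_eq, OfNat.ofNat_ne_zero, not_false_eq_true, zero_pow, Finset.sum_const_zero]
      positivity
    rw [this]; simp
  -- Since `v ⬝ᵥ v ≤ 4`, the threshold divided by the normalization is at least `32T/16 = 2T`, which
  -- leaves `exp(-2T + T/2)`.
  have hM := measure_le_of_expMoment_le ((measurable_gramForm hy.measurable T v).div_const _)
    (a := 2 * T) (hy.expMoment_gramForm_le h hb hK hv T)
  refine le_trans (measure_mono fun ω hω => ?_) (hM.trans (ENNReal.ofReal_le_ofReal ?_))
  · simp only [Set.mem_ofPred_eq] at hω ⊢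
    rw [le_div_iff₀ (by positivity)]
    refine le_trans ?_ hω
    have : (0 : ℝ) ≤ (τ : ℝ) ^ 2 * (L / m) * T := by positivity
    nlinarith [mul_le_mul_of_nonneg_left hv4 this]
  · rw [← Real.exp_add]
    exact Real.exp_le_exp.2 (by linarith)

/-- Upper tail of the squared length of one observation. -/
theorem IsStationaryVAR.measure_le_dotProduct_self_le (hy : IsStationaryVAR Pr A H ζ y)
    (h : IsInnovation Pr τ ζ) (hb : SpectralBounds A H m l L) (hK : 1 ≤ (τ : ℝ) ^ 2) (s : ℕ)
    (a : ℝ) :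
    Pr {ω | a * (4 * ((τ : ℝ) ^ 2 * (L / m))) ≤ y s ω ⬝ᵥ y s ω}
      ≤ ENNReal.ofReal (Real.exp (-a + p / 2)) := by
  have hm := hb.m_pos
  have hL := hb.L_pos
  have hym := hy.measurable
  have hM := measure_le_of_expMoment_le (by simp only [dotProduct]; fun_prop) (a := a)
    (hy.expMoment_dotProduct_self_le h hb hK s)
  rw [← Real.exp_add] at hM
  refine le_trans (measure_mono fun ω hω => ?_) hM
  simp only [Set.mem_ofPred_eq] at hω ⊢
  rwa [le_div_iff₀ (by positivity)]

/-- Upper tail of the total energy of the innovations. -/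
theorem IsInnovation.measure_le_sum_sq_le (h : IsInnovation Pr τ ζ) (T : ℕ) :
    Pr {ω | 3 * (T : ℝ) * p ≤ ∑ t ∈ Finset.range T, ζ ((t : ℤ) + 1) ω ⬝ᵥ ζ ((t : ℤ) + 1) ω}
      ≤ ENNReal.ofReal (Real.exp (-(sqScale ((τ : ℝ) ^ 2) * T * p))) := by
  have hE := h.expMoment_sum_sum_sq_le_one T
  have hθ : 0 ≤ sqScale ((τ : ℝ) ^ 2) := by unfold sqScale; positivity
  have hζ := h.measurable
  set θ := sqScale ((τ : ℝ) ^ 2) with hθd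
  rw [← ENNReal.ofReal_one] at hE
  have hM := measure_le_of_expMoment_le (Finset.measurable_fun_sum _ fun t _ => by
    simp only [dotProduct]; fun_prop) (a := θ * T * p) hE
  rw [mul_one] at hM
  refine le_trans (measure_mono fun ω hω => ?_) hM
  simp only [Set.mem_ofPred_eq] at hω ⊢
  rw [Finset.sum_sub_distrib, ← Finset.mul_sum, Finset.sum_const, Finset.card_range, nsmul_eq_mul]
  nlinarith [mul_le_mul_of_nonneg_left hω hθ]

/-- Upper tail of the cross products, on the event that the Gram form is under control. -/
theorem IsStationaryVAR.measure_le_sum_cross_le (hy : IsStationaryVAR Pr A H ζ y)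
    (h : IsInnovation Pr τ ζ) (hb : SpectralBounds A H m l L) (hK : 1 ≤ (τ : ℝ) ^ 2)
    {u : Fin p → ℝ} (hu : u ⬝ᵥ u ≤ 4) (v : Fin p → ℝ) {T : ℕ} (hT : 0 < T) :
    Pr {ω | 64 * (τ : ℝ) ^ 2 * (L / Real.sqrt m) * Real.sqrt (p * T)
          ≤ ∑ t ∈ Finset.range T, (u ⬝ᵥ H *ᵥ ζ ((t : ℤ) + 1) ω) * (v ⬝ᵥ y t ω) ∧
        gramForm y T v ω ≤ 32 * (τ : ℝ) ^ 2 * (L / m) * T}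
      ≤ ENNReal.ofReal (Real.exp (-(16 * p))) := by
  have hm := hb.m_pos
  have hL := hb.L_pos
  have hT' : (0 : ℝ) < T := by exact_mod_cast hT
  set K := (τ : ℝ) ^ 2 with hKd
  set q := Real.sqrt m with hq
  have hq0 : 0 < q := Real.sqrt_pos.2 hm
  have hq2 : q ^ 2 = m := Real.sq_sqrt hm.le
  set x := Real.sqrt (p * T) with hx
  have hx2 : x ^ 2 = p * T := Real.sq_sqrt (by positivity)
  have hx0 : 0 ≤ x := Real.sqrt_nonneg _
  -- The maximizer of the linear gain minus the quadratic compensator: the gain is `32p` and the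
  -- compensator `16p`.
  set s := x * q / (2 * (K * L * T)) with hs
  have hs0 : 0 ≤ s := by positivity
  have hE := hy.expMoment_sum_cross_le_one h hb.stable u v s T
  rw [← ENNReal.ofReal_one] at hE
  have hM := measure_le_of_expMoment_le (Finset.measurable_fun_sum _ fun t _ => by
    have h1 := measurable_dotProduct_right v (hy.measurable t)
    have h2 := measurable_dotProduct_right u (measurable_mulVec H (h.measurable ((t : ℤ) + 1)))
    fun_prop) (a := 16 * p) hE
  rw [mul_one] at hM
  refine le_trans (measure_mono fun ω hω => ?_) hM
  obtain ⟨h1, h2⟩ := hω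
  simp only [Set.mem_ofPred_eq]
  have e1 : ∑ t ∈ Finset.range T, (s * (u ⬝ᵥ H *ᵥ ζ ((t : ℤ) + 1) ω) * (v ⬝ᵥ y t ω)
        - K * ((Hᵀ *ᵥ u) ⬝ᵥ (Hᵀ *ᵥ u)) * s ^ 2 * (v ⬝ᵥ y t ω) ^ 2 / 2)
      = s * (∑ t ∈ Finset.range T, (u ⬝ᵥ H *ᵥ ζ ((t : ℤ) + 1) ω) * (v ⬝ᵥ y t ω))
        - K * ((Hᵀ *ᵥ u) ⬝ᵥ (Hᵀ *ᵥ u)) * s ^ 2 / 2 * gramForm y T v ω := by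
    rw [Finset.sum_sub_distrib, gramForm, Finset.mul_sum, Finset.mul_sum]
    congr 1 <;> exact Finset.sum_congr rfl fun t _ => by ring
  rw [e1]
  have h3 : (Hᵀ *ᵥ u) ⬝ᵥ (Hᵀ *ᵥ u) ≤ 4 * L :=
    (hb.le_L_mul u).trans (by nlinarith)
  have h4 : K * ((Hᵀ *ᵥ u) ⬝ᵥ (Hᵀ *ᵥ u)) * s ^ 2 / 2 * gramForm y T v ω
      ≤ K * (4 * L) * s ^ 2 / 2 * (32 * K * (L / m) * T) :=
    mul_le_mul (by gcongr) h2 (gramForm_nonneg _ _ _ _) (by positivity)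
  have h5 := mul_le_mul_of_nonneg_left h1 hs0
  have h6 : s * (64 * K * (L / q) * x) = 32 * p := by
    rw [hs]
    field_simp
    rw [hx2]
    ring
  have h7 : K * (4 * L) * s ^ 2 / 2 * (32 * K * (L / m) * T) = 16 * p := by
    rw [hs, ← hq2]
    field_simp
    rw [hx2]
    ring
  linarith

end Tails

end CommonVAR

open scoped Matrix.Norms.L2Operator

/-! ### Deterministic passage from the lattice to all directions. -/

namespace CommonVAR

section Deterministic

variable {Ω : Type*} {p : ℕ} {A H : Matrix (Fin p) (Fin p) ℝ} {ζ y : ℤ → Ω → Fin p → ℝ}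
  {m l L : ℝ}

lemma dotProduct_sub_self_le (a b : Fin p → ℝ) :
    (a - b) ⬝ᵥ (a - b) ≤ 2 * (a ⬝ᵥ a) + 2 * (b ⬝ᵥ b) := by
  simp only [dotProduct, Finset.mul_sum, ← Finset.sum_add_distrib, Pi.sub_apply]
  exact Finset.sum_le_sum fun i _ => by nlinarith [sq_nonneg (a i + b i)]

/-- Energy estimate along one trajectory of the VAR recursion. -/
lemma SpectralBounds.energy_le (hb : SpectralBounds A H m l L) {ω : Ω} {T : ℕ} (hT : 0 < T)
    (hrec : ∀ t : ℕ, y ((t : ℤ) + 1) ω = A *ᵥ y t ω + H *ᵥ ζ ((t : ℤ) + 1) ω) :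
    m * ∑ t ∈ Finset.range T, y t ω ⬝ᵥ y t ω
      ≤ y 0 ω ⬝ᵥ y 0 ω + 2 * (y T ω ⬝ᵥ y T ω)
        + 2 * L * ∑ t ∈ Finset.range T, ζ ((t : ℤ) + 1) ω ⬝ᵥ ζ ((t : ℤ) + 1) ω := by
  obtain ⟨N, rfl⟩ : ∃ N, T = N + 1 := ⟨T - 1, by omega⟩
  have key := sum_dotProduct_le_of_symbol_ge A hb.symbol (fun t => y t ω) N
  have h1 : ∀ k : ℕ, y ((k + 1 : ℕ) : ℤ) ω - A *ᵥ y k ω = H *ᵥ ζ ((k : ℤ) + 1) ω := fun k => by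
    push_cast
    rw [hrec k, add_sub_cancel_left]
  -- The boundary term of the filter estimate is expressed through the next observation, avoiding
  -- any bound on the norm of `A`.
  have h2 : A *ᵥ y N ω = y ((N + 1 : ℕ) : ℤ) ω - H *ᵥ ζ ((N : ℤ) + 1) ω := by
    rw [← h1 N, sub_sub_cancel]
  simp only [h1] at key
  rw [h2] at key
  have h3 := dotProduct_sub_self_le (y ((N + 1 : ℕ) : ℤ) ω) (H *ᵥ ζ ((N : ℤ) + 1) ω)
  have h4 := hb.noise_le (ζ ((N : ℤ) + 1) ω)
  have h5 : ∑ k ∈ Finset.range N, (H *ᵥ ζ ((k : ℤ) + 1) ω) ⬝ᵥ (H *ᵥ ζ ((k : ℤ) + 1) ω)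
      ≤ L * ∑ k ∈ Finset.range N, ζ ((k : ℤ) + 1) ω ⬝ᵥ ζ ((k : ℤ) + 1) ω := by
    rw [Finset.mul_sum]
    exact Finset.sum_le_sum fun k _ => hb.noise_le _
  have h6 : 0 ≤ L * ∑ k ∈ Finset.range N, ζ ((k : ℤ) + 1) ω ⬝ᵥ ζ ((k : ℤ) + 1) ω :=
    mul_nonneg hb.L_pos.le (Finset.sum_nonneg fun _ _ => dotProduct_self_nonneg _)
  rw [Finset.sum_range_succ (fun t : ℕ => ζ ((t : ℤ) + 1) ω ⬝ᵥ ζ ((t : ℤ) + 1) ω)]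
  simp only [Nat.cast_zero] at key
  linarith

lemma gramForm_smul (T : ℕ) (c : ℝ) (v : Fin p → ℝ) (ω : Ω) :
    gramForm y T (c • v) ω = c ^ 2 * gramForm y T v ω := by
  simp only [gramForm, smul_dotProduct, smul_eq_mul, mul_pow, Finset.mul_sum]

/-- A lower bound for the Gram form on a lattice extends to all directions. -/
lemma le_gramForm_of_lattice {ω : Ω} {T : ℕ} {h β : ℝ} (hh : 0 < h) (hp : p * h ^ 2 ≤ 1)
    (hβ : 0 ≤ β)
    (hlat : ∀ k : Fin p → ℤ, ∑ i, (k i : ℝ) ^ 2 ≤ 4 / h ^ 2 →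
      3 * β * ((fun i => h * (k i : ℝ)) ⬝ᵥ fun i => h * (k i : ℝ))
        ≤ gramForm y T (fun i => h * (k i : ℝ)) ω)
    (hen : h ^ 2 / 4 * ∑ t ∈ Finset.range T, y t ω ⬝ᵥ y t ω ≤ β) (v : Fin p → ℝ) :
    2 * β * (v ⬝ᵥ v) ≤ gramForm y T v ω := by
  -- Rounding is applied to the Gram form minus `3β|u|²`, which is nonnegative on the lattice. Its
  -- diagonal is at most that of the Gram matrix, so rounding loses at most `h²/4` times the energy,
  -- that is `β`, and `2β` survives.
  set K : Matrix (Fin p) (Fin p) ℝ :=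
    ∑ t ∈ Finset.range T, Matrix.vecMulVec (y t ω) (y t ω) - (3 * β) • 1 with hK
  have hQ : ∀ u : Fin p → ℝ, u ⬝ᵥ K *ᵥ u = gramForm y T u ω - 3 * β * (u ⬝ᵥ u) := by
    intro u
    rw [hK, Matrix.sub_mulVec, dotProduct_sub, Matrix.sum_mulVec, Matrix.smul_mulVec,
      Matrix.one_mulVec, dotProduct_smul, smul_eq_mul, gramForm, dotProduct_sum]
    congr 1
    refine Finset.sum_congr rfl fun t _ => ?_
    rw [Matrix.vecMulVec_mulVec, dotProduct_smul, pow_two, dotProduct_comm (y t ω) u]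
    simp
  have key : ∀ e : Fin p → ℝ, e ⬝ᵥ e = 1 → 2 * β ≤ gramForm y T e ω := by
    intro e he
    obtain ⟨k, hk1, hk2⟩ := exists_int_round_quadForm_le hh K
      (fun i => ∑ t ∈ Finset.range T, y t ω i * y t ω i)
      (fun i => Finset.sum_nonneg fun t _ => mul_self_nonneg _)
      (fun i => by
        simp only [hK, Matrix.sub_apply, Matrix.sum_apply, Matrix.vecMulVec_apply,
          Matrix.smul_apply, Matrix.one_apply_eq, smul_eq_mul]
        linarith) e
    have h1 := (sum_int_sq_le_of_round hh hp he.le hk1).2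
    have h2 := hlat k h1
    have h3 : ∑ i, ∑ t ∈ Finset.range T, y t ω i * y t ω i
        = ∑ t ∈ Finset.range T, y t ω ⬝ᵥ y t ω := by
      rw [Finset.sum_comm]; rfl
    rw [hQ, hQ, he, h3] at hk2
    linarith
  rcases (dotProduct_self_nonneg v).eq_or_lt with hv | hv
  · rw [← hv, mul_zero]; exact gramForm_nonneg _ _ _ _
  · set q := Real.sqrt (v ⬝ᵥ v) with hq
    have hq0 : 0 < q := Real.sqrt_pos.2 hv
    have hq2 : q ^ 2 = v ⬝ᵥ v := Real.sq_sqrt hv.le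
    have h1 := key (q⁻¹ • v) (by
      rw [smul_dotProduct, dotProduct_smul, ← hq2, smul_eq_mul, smul_eq_mul]
      field_simp)
    rw [gramForm_smul, inv_pow, hq2, ← div_eq_inv_mul, le_div_iff₀ hv] at h1
    exact h1

/-- A bound for a bilinear form on a lattice yields a bound of the operator norm. -/
lemma l2_opNorm_le_of_lattice {N : Matrix (Fin p) (Fin p) ℝ} {h ν : ℝ} (hh : 0 < h)
    (hp : p * h ^ 2 ≤ 1) (hν : 0 ≤ ν)
    (hlat : ∀ k k' : Fin p → ℤ, ∑ i, (k i : ℝ) ^ 2 ≤ 4 / h ^ 2 →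
      ∑ i, (k' i : ℝ) ^ 2 ≤ 4 / h ^ 2 →
      (fun i => h * (k i : ℝ)) ⬝ᵥ N *ᵥ (fun i => h * (k' i : ℝ)) ≤ ν) : ‖N‖ ≤ ν := by
  have key : ∀ u v : Fin p → ℝ, u ⬝ᵥ u ≤ 1 → v ⬝ᵥ v ≤ 1 → u ⬝ᵥ N *ᵥ v ≤ ν := by
    intro u v hu hv
    -- The bilinear form is linear in each argument, so rounding one argument after the other never
    -- decreases it and no constant is lost.
    obtain ⟨k, hk1, hk2⟩ := exists_int_round_dotProduct_le hh (N *ᵥ v) u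
    obtain ⟨k', hk1', hk2'⟩ := exists_int_round_dotProduct_le hh
      (Nᵀ *ᵥ fun i => h * (k i : ℝ)) v
    rw [dotProduct_comm, dotProduct_comm (N *ᵥ v)] at hk2
    rw [← dotProduct_mulVec_eq, ← dotProduct_mulVec_eq] at hk2'
    exact hk2.trans (hk2'.trans (hlat k k' (sum_int_sq_le_of_round hh hp hu hk1).2
      (sum_int_sq_le_of_round hh hp hv hk1').2))
  have hunit : ∀ v : Fin p → ℝ, 0 < v ⬝ᵥ v →
      ((Real.sqrt (v ⬝ᵥ v))⁻¹ • v) ⬝ᵥ ((Real.sqrt (v ⬝ᵥ v))⁻¹ • v) = 1 := by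
    intro v hv
    have hq0 : 0 < Real.sqrt (v ⬝ᵥ v) := Real.sqrt_pos.2 hv
    rw [smul_dotProduct, dotProduct_smul, smul_eq_mul, smul_eq_mul, ← mul_assoc, ← mul_inv,
      Real.mul_self_sqrt hv.le, inv_mul_cancel₀ hv.ne']
  refine l2_opNorm_le_of_forall N ν hν fun x => ?_
  rcases (dotProduct_self_nonneg x).eq_or_lt with hx | hx
  · rw [dotProduct_self_eq_zero.1 hx.symm]; simp
  rcases (dotProduct_self_nonneg (N *ᵥ x)).eq_or_lt with hNx | hNx
  · rw [← hNx]; positivity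
  have h1 := key _ _ (hunit _ hNx).le (hunit _ hx).le
  rw [Matrix.mulVec_smul, smul_dotProduct, dotProduct_smul, smul_eq_mul, smul_eq_mul] at h1
  set a := Real.sqrt (N *ᵥ x ⬝ᵥ N *ᵥ x) with ha
  set c := Real.sqrt (x ⬝ᵥ x) with hc
  have ha0 : 0 < a := Real.sqrt_pos.2 hNx
  have hc0 : 0 < c := Real.sqrt_pos.2 hx
  have ha2 : a ^ 2 = N *ᵥ x ⬝ᵥ N *ᵥ x := Real.sq_sqrt hNx.le
  have hc2 : c ^ 2 = x ⬝ᵥ x := Real.sq_sqrt hx.le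
  rw [← ha2] at h1 ⊢
  rw [← hc2]
  have h2 : a⁻¹ * (c⁻¹ * a ^ 2) = a / c := by field_simp
  rw [h2, div_le_iff₀ hc0] at h1
  rw [← mul_pow]
  exact pow_le_pow_left₀ ha0.le h1 2

end Deterministic

/-! ### High-probability events: Gram lower bound and noise deviation. -/

section Events

variable {Ω : Type*} [MeasurableSpace Ω] {Pr : Measure Ω} [IsProbabilityMeasure Pr] {p : ℕ}
  {A H : Matrix (Fin p) (Fin p) ℝ} {τ : ℝ≥0} {ζ y : ℤ → Ω → Fin p → ℝ} {m l L : ℝ}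

lemma measure_exists_mem_le {ι : Type*} (S : Finset ι) (B : ι → Set Ω) {b c : ℝ} (hb : 0 ≤ b)
    (hc : (S.card : ℝ) ≤ c) (h : ∀ k ∈ S, Pr (B k) ≤ ENNReal.ofReal b) :
    Pr {ω | ∃ k ∈ S, ω ∈ B k} ≤ ENNReal.ofReal (c * b) := by
  have e : {ω | ∃ k ∈ S, ω ∈ B k} = ⋃ k ∈ S, B k := by ext; simp
  rw [e]
  calc Pr (⋃ k ∈ S, B k) ≤ ∑ k ∈ S, Pr (B k) := measure_biUnion_finset_le _ _
    _ ≤ ∑ k ∈ S, ENNReal.ofReal b := Finset.sum_le_sum h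
    _ = ENNReal.ofReal (S.card * b) := by
        rw [Finset.sum_const, nsmul_eq_mul, ENNReal.ofReal_mul (Nat.cast_nonneg _),
          ENNReal.ofReal_natCast]
    _ ≤ _ := ENNReal.ofReal_le_ofReal (by gcongr)

lemma three_pow_le_exp (p : ℕ) : (3 : ℝ) ^ p ≤ Real.exp (2 * p) := by
  have h1 : (3 : ℝ) ≤ Real.exp 2 := by
    have := Real.add_one_le_exp (2 : ℝ)
    linarith
  calc (3 : ℝ) ^ p ≤ Real.exp 2 ^ p := pow_le_pow_left₀ (by norm_num) h1 p
    _ = _ := by rw [← Real.exp_nat_mul]; congr 1; ring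

lemma IsStationaryVAR.recursion_ae (hy : IsStationaryVAR Pr A H ζ y) :
    ∀ᵐ ω ∂Pr, ∀ t : ℕ, y ((t : ℤ) + 1) ω = A *ᵥ y t ω + H *ᵥ ζ ((t : ℤ) + 1) ω := by
  refine ae_all_iff.2 fun t => ?_
  have := hy.recursion ((t : ℤ) + 1)
  simpa using this

lemma neg_div_add_half_le {K θ P T : ℝ} (hK : 0 < K) (hθK : θ * K ≤ 1) (hP : 1 ≤ P) (hT : 0 < T)
    (hTK : 4 * K ≤ T) : -(T * P / (4 * K)) + P / 2 ≤ -(θ * T / 16) := by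
  have h1 : P / 2 ≤ T * P / (8 * K) := by
    rw [div_le_div_iff₀ (by norm_num) (by positivity)]
    linarith [mul_le_mul_of_nonneg_right hTK (show (0 : ℝ) ≤ P by linarith)]
  have h2 : θ * T / 16 ≤ T * P / (8 * K) := by
    rw [div_le_div_iff₀ (by norm_num) (by positivity)]
    linarith [mul_le_mul_of_nonneg_left hθK hT.le, mul_le_mul_of_nonneg_left hP hT.le]
  have h3 : T * P / (4 * K) = 2 * (T * P / (8 * K)) := by field_simp; norm_num
  rw [h3]
  linarith

/-- Justifies the mesh `h₀² = q²/(9p)`: the prefactor is `h₀²/(4m)`, and after cancellation what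
remains besides `Tl/4` is `(l/L)(1 + 2m)/(3Mx²) ≤ 1`. -/
lemma energy_mesh_le {m l L Mx P T : ℝ} (hm : 0 < m) (hl : 0 < l) (hlL : l ≤ L) (hMx : 1 ≤ Mx)
    (hmMx : m ≤ Mx) (hP : 0 < P) (hT : 0 < T) :
    (l * m / (L * Mx)) ^ 2 / (36 * P * m) * (3 * (T * P * L / m) + 6 * L * T * P)
      ≤ T * l / 4 := by
  have hL : 0 < L := hl.trans_le hlL
  have hMx0 : 0 < Mx := by linarith
  have e : (l * m / (L * Mx)) ^ 2 / (36 * P * m) * (3 * (T * P * L / m) + 6 * L * T * P)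
      = T * l / 4 * ((l / L) * ((1 + 2 * m) / (3 * Mx ^ 2))) := by
    field_simp; ring
  rw [e]
  refine mul_le_of_le_one_right (by positivity) ?_
  have h7 : l / L ≤ 1 := (div_le_one hL).2 hlL
  have h8 : (1 + 2 * m) / (3 * Mx ^ 2) ≤ 1 := by
    rw [div_le_one (by positivity)]
    nlinarith
  exact mul_le_one₀ h7 (by positivity) h8

set_option maxHeartbeats 800000 in
/-- Restricted strong convexity: the Gram matrix is bounded below with high probability. -/
theorem IsStationaryVAR.measure_gramForm_le (hy : IsStationaryVAR Pr A H ζ y)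
    (h : IsInnovation Pr τ ζ) (hb : SpectralBounds A H m l L) (hp : 0 < p) {Mx q : ℝ}
    (hMx : 1 ≤ Mx) (hmMx : m ≤ Mx) (hq : q = l * m / (L * Mx)) {T : ℕ}
    (hT : 608 * p / q ^ 2 ≤ sqScale ((τ : ℝ) ^ 2) * T) :
    Pr {ω | ¬ ∀ v, T * l / 2 * (v ⬝ᵥ v) ≤ gramForm y T v ω}
      ≤ ENNReal.ofReal (4 * Real.exp (-(sqScale ((τ : ℝ) ^ 2) * T / 16))) := by
  have hK := h.one_le_sq hp
  have hm := hb.m_pos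
  have hl := hb.l_pos
  have hL := hb.L_pos
  have hlL := hb.le_L
  have hθ := sqScale_pos hK
  have hθK := sqScale_mul hK
  set K := (τ : ℝ) ^ 2 with hKd
  set θ := sqScale K with hθd
  have hp1 : (1 : ℝ) ≤ p := by exact_mod_cast hp
  have hMx0 : 0 < Mx := by linarith
  have hq0 : 0 < q := by rw [hq]; positivity
  have hq1 : q ≤ 1 := by
    rw [hq, div_le_one (by positivity)]
    exact mul_le_mul hlL hmMx hm.le hL.le
  have hq1' : q ^ 2 ≤ 1 := by nlinarith
  have hT608 : 608 * (p : ℝ) ≤ θ * T := by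
    refine le_trans ?_ hT
    rw [le_div_iff₀ (by positivity)]
    nlinarith
  have hT0' : (0 : ℝ) < T := by
    by_contra! hneg
    nlinarith
  have hT0 : 0 < T := by exact_mod_cast hT0'
  have hTK : 608 * 2048 * K ^ 2 ≤ T := by
    have : 608 * (2048 * K ^ 2) ≤ (θ * T) * (2048 * K ^ 2) := by
      have : (608 : ℝ) ≤ θ * T := by nlinarith
      gcongr
    have e : (θ * T) * (2048 * K ^ 2) = (θ * (2048 * K ^ 2)) * T := by ring
    rw [e, hθK] at this
    linarith
  -- Fine enough for the rounding loss to stay below `Tl/4`, a third of the lattice lower bound per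
  -- unit squared length.
  set h₀ := q / (3 * Real.sqrt p) with hh₀
  have hsp : Real.sqrt p ^ 2 = p := Real.sq_sqrt (by positivity)
  have hsp0 : 0 < Real.sqrt p := Real.sqrt_pos.2 (by positivity)
  have hh0 : 0 < h₀ := by positivity
  have hh2 : h₀ ^ 2 = q ^ 2 / (9 * p) := by
    rw [hh₀, div_pow, mul_pow, hsp]; norm_num
  have hph : p * h₀ ^ 2 ≤ 1 := by
    rw [hh2]
    have : (p : ℝ) * (q ^ 2 / (9 * p)) = q ^ 2 / 9 := by field_simp
    rw [this]; linarith
  obtain ⟨S, hS1, -, hS2⟩ := exists_finset_int_sum_sq_le p (4 / h₀ ^ 2)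
  -- The union bound must be absorbed by half of the exponent `θT/8`; as `608 = 16 * 38`, the
  -- hypothesis on `T` does exactly this.
  have hcard : (S.card : ℝ) ≤ Real.exp (38 * p / q ^ 2) := by
    refine hS2.trans ((mul_le_mul_of_nonneg_right (three_pow_le_exp p)
      (Real.exp_pos _).le).trans ?_)
    rw [← Real.exp_add]
    refine Real.exp_le_exp.2 ?_
    have e : 4 / h₀ ^ 2 = 36 * p / q ^ 2 := by rw [hh2]; field_simp; norm_num
    rw [e, show (38 : ℝ) * p / q ^ 2 = 2 * p / q ^ 2 + 36 * p / q ^ 2 by ring]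
    gcongr
    rw [le_div_iff₀ (by positivity)]
    nlinarith
  set B₁ : Set Ω := {ω | ∃ k ∈ S, ω ∈ {ω | gramForm y T (fun i => h₀ * (k i : ℝ)) ω
    < 3 / 4 * T * l * ((fun i => h₀ * (k i : ℝ)) ⬝ᵥ fun i => h₀ * (k i : ℝ))}} with hB₁
  set B₂ : Set Ω := {ω | 3 * (T : ℝ) * p
    ≤ ∑ t ∈ Finset.range T, ζ ((t : ℤ) + 1) ω ⬝ᵥ ζ ((t : ℤ) + 1) ω} with hB₂
  set B₃ : ℕ → Set Ω := fun s => {ω | T * p / (4 * K) * (4 * (K * (L / m))) ≤ y s ω ⬝ᵥ y s ω}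
    with hB₃
  set b := Real.exp (-(θ * T / 16)) with hbd
  have hb0 : 0 ≤ b := (Real.exp_pos _).le
  have hP₁ : Pr B₁ ≤ ENNReal.ofReal b := by
    refine (measure_exists_mem_le S _ (Real.exp_pos _).le hcard fun k _ =>
      hy.measure_gramForm_lt_le h hb hK _ T).trans (ENNReal.ofReal_le_ofReal ?_)
    rw [← Real.exp_add]
    refine Real.exp_le_exp.2 ?_
    have : 38 * p / q ^ 2 = 608 * p / q ^ 2 / 16 := by ring
    rw [this]
    linarith
  have hP₂ : Pr B₂ ≤ ENNReal.ofReal b := by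
    refine (h.measure_le_sum_sq_le T).trans (ENNReal.ofReal_le_ofReal (Real.exp_le_exp.2 ?_))
    have : 0 < θ * T := by positivity
    nlinarith
  have hP₃ : ∀ s, Pr (B₃ s) ≤ ENNReal.ofReal b := by
    intro s
    refine (hy.measure_le_dotProduct_self_le h hb hK s (T * p / (4 * K))).trans
      (ENNReal.ofReal_le_ofReal (Real.exp_le_exp.2 ?_))
    exact neg_div_add_half_le (by linarith) (by nlinarith) hp1 hT0' (by nlinarith)
  -- The two endpoints and the innovation energy bound the total energy pathwise, hence the rounding
  -- loss; no separate upper bound on the Gram matrix is used.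
  have hsub : {ω | ¬ ∀ v, T * l / 2 * (v ⬝ᵥ v) ≤ gramForm y T v ω}
      ⊆ {ω | ¬ ∀ t : ℕ, y ((t : ℤ) + 1) ω = A *ᵥ y t ω + H *ᵥ ζ ((t : ℤ) + 1) ω}
        ∪ (B₁ ∪ B₂ ∪ B₃ 0 ∪ B₃ T) := by
    intro ω hω
    by_contra hcon
    simp only [Set.mem_union, not_or] at hcon
    obtain ⟨hrec, ⟨⟨h1, h2⟩, h3⟩, h4⟩ := hcon
    simp only [Set.mem_ofPred_eq, not_not] at hrec
    refine hω fun v => ?_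
    have hen := hb.energy_le hT0 hrec
    simp only [hB₂, hB₃, Set.mem_ofPred_eq, not_le] at h2 h3 h4
    have e4 : T * p / (4 * K) * (4 * (K * (L / m))) = T * p * L / m := by
      have hK0 : K ≠ 0 := by linarith
      field_simp
    rw [e4] at h3 h4
    simp only [Nat.cast_zero] at h3
    have h5 : m * ∑ t ∈ Finset.range T, y t ω ⬝ᵥ y t ω
        ≤ 3 * (T * p * L / m) + 6 * L * T * p := by nlinarith
    have h6 : h₀ ^ 2 / 4 * ∑ t ∈ Finset.range T, y t ω ⬝ᵥ y t ω ≤ T * l / 4 := by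
      have e5 : h₀ ^ 2 / 4 * ∑ t ∈ Finset.range T, y t ω ⬝ᵥ y t ω
          = q ^ 2 / (36 * p * m) * (m * ∑ t ∈ Finset.range T, y t ω ⬝ᵥ y t ω) := by
        rw [hh2]; field_simp; norm_num; ring
      rw [e5]
      refine (mul_le_mul_of_nonneg_left h5 (by positivity)).trans ?_
      rw [hq]
      exact energy_mesh_le hm hl hlL hMx hmMx (by positivity) hT0'
    have h9 := le_gramForm_of_lattice (y := y) (ω := ω) (T := T) (β := T * l / 4) hh0 hph
      (by positivity) (fun k hk => ?_) h6 v
    · linarith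
    · by_contra! hlt
      refine h1 ⟨k, hS1 k hk, ?_⟩
      simp only [Set.mem_ofPred_eq]
      linarith
  have hnull : Pr {ω | ¬ ∀ t : ℕ, y ((t : ℤ) + 1) ω = A *ᵥ y t ω + H *ᵥ ζ ((t : ℤ) + 1) ω} = 0 :=
    ae_iff.1 hy.recursion_ae
  calc _ ≤ _ := measure_mono hsub
    _ ≤ 0 + (ENNReal.ofReal b + ENNReal.ofReal b + ENNReal.ofReal b + ENNReal.ofReal b) := by
        refine (measure_union_le _ _).trans (add_le_add hnull.le ?_)
        refine (measure_union_le _ _).trans (add_le_add ?_ (hP₃ T))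
        refine (measure_union_le _ _).trans (add_le_add ?_ (hP₃ 0))
        exact (measure_union_le _ _).trans (add_le_add hP₁ hP₂)
    _ = _ := by
        rw [zero_add, ← ENNReal.ofReal_add hb0 hb0, ← ENNReal.ofReal_add (by positivity) hb0,
          ← ENNReal.ofReal_add (by positivity) hb0]
        congr 1
        ring

/-- Deviation bound: the operator norm of the cross products of noise and regressors. -/
theorem IsStationaryVAR.measure_opNorm_cross_le (hy : IsStationaryVAR Pr A H ζ y)
    (h : IsInnovation Pr τ ζ) (hb : SpectralBounds A H m l L) (hp : 0 < p) {T : ℕ}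
    (hT : 11 * p ≤ T) :
    Pr {ω | ¬ ‖(Matrix.of fun (i : Fin p) (t : Fin T) => (H *ᵥ ζ ((t : ℤ) + 1) ω) i)
          * (dataX y T ω)ᵀ‖ ≤ 64 * (τ : ℝ) ^ 2 * (L / Real.sqrt m) * Real.sqrt (p * T)}
      ≤ ENNReal.ofReal (Real.exp (-p)) := by
  have hK := h.one_le_sq hp
  have hm := hb.m_pos
  have hL := hb.L_pos
  have hp1 : (1 : ℝ) ≤ p := by exact_mod_cast hp
  have hT0 : 0 < T := by omega
  have hT' : 11 * (p : ℝ) ≤ T := by exact_mod_cast hT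
  set K := (τ : ℝ) ^ 2 with hKd
  set ν := 64 * K * (L / Real.sqrt m) * Real.sqrt (p * T) with hν
  have hν0 : 0 ≤ ν := by positivity
  -- Rounding is lossless here, so the mesh need not be fine: there are at most `exp(6p)` points,
  -- and `exp(12p)` pairs against a tail of `exp(-16p)`.
  set h₀ := (Real.sqrt p)⁻¹ with hh₀
  have hsp : Real.sqrt p ^ 2 = p := Real.sq_sqrt (by positivity)
  have hsp0 : 0 < Real.sqrt p := Real.sqrt_pos.2 (by positivity)
  have hh0 : 0 < h₀ := by positivity
  have hh2 : h₀ ^ 2 = (p : ℝ)⁻¹ := by rw [hh₀, inv_pow, hsp]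
  have hph : p * h₀ ^ 2 ≤ 1 := by
    rw [hh2, mul_inv_cancel₀ (by positivity)]
  obtain ⟨S, hS1, hS3, hS2⟩ := exists_finset_int_sum_sq_le p (4 / h₀ ^ 2)
  have e4 : 4 / h₀ ^ 2 = 4 * (p : ℝ) := by rw [hh2]; field_simp
  have hcard : (S.card : ℝ) ≤ Real.exp (6 * p) := by
    refine hS2.trans ((mul_le_mul_of_nonneg_right (three_pow_le_exp p)
      (Real.exp_pos _).le).trans ?_)
    rw [← Real.exp_add, e4]
    exact Real.exp_le_exp.2 (by linarith)
  have hlen : ∀ k ∈ S, (fun i => h₀ * (k i : ℝ)) ⬝ᵥ (fun i => h₀ * (k i : ℝ)) ≤ 4 := by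
    intro k hk
    have h1 := hS3 k hk
    have h2 : (fun i => h₀ * (k i : ℝ)) ⬝ᵥ (fun i => h₀ * (k i : ℝ))
        = h₀ ^ 2 * ∑ i, (k i : ℝ) ^ 2 := by
      rw [dotProduct, Finset.mul_sum]
      exact Finset.sum_congr rfl fun i _ => by ring
    rw [h2]
    rwa [le_div_iff₀ (by positivity), mul_comm] at h1
  set B₁ : Set Ω := {ω | ∃ k ∈ S, ω ∈ {ω | 32 * K * (L / m) * T
    ≤ gramForm y T (fun i => h₀ * (k i : ℝ)) ω}} with hB₁
  -- The tail of the cross products holds jointly with the Gram bound; failure of the latter is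
  -- covered by `B₁`.
  set B₂ : Set Ω := {ω | ∃ k ∈ S ×ˢ S, ω ∈ {ω | ν ≤ ∑ t ∈ Finset.range T,
      ((fun i => h₀ * (k.1 i : ℝ)) ⬝ᵥ H *ᵥ ζ ((t : ℤ) + 1) ω)
        * ((fun i => h₀ * (k.2 i : ℝ)) ⬝ᵥ y t ω) ∧
      gramForm y T (fun i => h₀ * (k.2 i : ℝ)) ω ≤ 32 * K * (L / m) * T}} with hB₂
  have hP₁ : Pr B₁ ≤ ENNReal.ofReal (Real.exp (6 * p) * Real.exp (-T)) :=
    measure_exists_mem_le S _ (Real.exp_pos _).le hcard fun k hk =>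
      hy.measure_le_gramForm_le h hb hK (hlen k hk) hT0
  have hP₂ : Pr B₂ ≤ ENNReal.ofReal (Real.exp (12 * p) * Real.exp (-(16 * p))) := by
    refine measure_exists_mem_le (S ×ˢ S) _ (Real.exp_pos _).le ?_ fun k hk =>
      hy.measure_le_sum_cross_le h hb hK (hlen k.1 (Finset.mem_product.1 hk).1) _ hT0
    rw [Finset.card_product]
    push_cast
    calc (S.card : ℝ) * S.card ≤ Real.exp (6 * p) * Real.exp (6 * p) := by gcongr
      _ = _ := by rw [← Real.exp_add]; congr 1; ring
  have hsub : {ω | ¬ ‖(Matrix.of fun (i : Fin p) (t : Fin T) => (H *ᵥ ζ ((t : ℤ) + 1) ω) i)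
          * (dataX y T ω)ᵀ‖ ≤ ν} ⊆ B₁ ∪ B₂ := by
    intro ω hω
    by_contra hcon
    simp only [Set.mem_union, not_or] at hcon
    obtain ⟨h1, h2⟩ := hcon
    refine hω (l2_opNorm_le_of_lattice hh0 hph hν0 fun k k' hk hk' => ?_)
    have e1 : (fun i => h₀ * (k i : ℝ)) ⬝ᵥ
          ((Matrix.of fun (i : Fin p) (t : Fin T) => (H *ᵥ ζ ((t : ℤ) + 1) ω) i)
            * (dataX y T ω)ᵀ) *ᵥ (fun i => h₀ * (k' i : ℝ))
        = ∑ t ∈ Finset.range T, ((fun i => h₀ * (k i : ℝ)) ⬝ᵥ H *ᵥ ζ ((t : ℤ) + 1) ω)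
          * ((fun i => h₀ * (k' i : ℝ)) ⬝ᵥ y t ω) := by
      rw [← Matrix.mulVec_mulVec, Matrix.dotProduct_mulVec, Finset.sum_range]
      refine Finset.sum_congr rfl fun t _ => ?_
      congr 1
      rw [dotProduct_comm]
      rfl
    rw [e1]
    by_contra! hlt
    refine h2 ⟨(k, k'), Finset.mem_product.2 ⟨hS1 k hk, hS1 k' hk'⟩, hlt.le, ?_⟩
    by_contra! hlt'
    exact h1 ⟨k', hS1 k' hk', hlt'.le⟩
  refine (measure_mono hsub).trans ((measure_union_le _ _).trans ((add_le_add hP₁ hP₂).trans ?_))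
  rw [← Real.exp_add, ← Real.exp_add, ← ENNReal.ofReal_add (Real.exp_pos _).le (Real.exp_pos _).le]
  refine ENNReal.ofReal_le_ofReal ?_
  have h1 : Real.exp (6 * p + -T) ≤ Real.exp (-p + -1) := Real.exp_le_exp.2 (by linarith)
  have h2 : Real.exp (12 * p + -(16 * p)) ≤ Real.exp (-p + -1) := Real.exp_le_exp.2 (by linarith)
  have h3 : Real.exp (-1 : ℝ) ≤ 1 / 2 := by
    have h4 := Real.add_one_le_exp (1 : ℝ)
    have h5 : Real.exp (-1 : ℝ) * Real.exp 1 = 1 := by rw [← Real.exp_add]; simp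
    nlinarith [Real.exp_pos (-1 : ℝ)]
  rw [Real.exp_add (-(p : ℝ)) (-1)] at h1 h2
  nlinarith [Real.exp_pos (-(p : ℝ))]

end Events

end CommonVAR

/-! ### Assembly and the main theorem. -/

namespace CommonVAR

section Assembly

lemma spectralBounds_of_posDef {p : ℕ} {A Cov H : Matrix (Fin p) (Fin p) ℝ} (hp : 0 < p)
    (hA : spectralRadius ℂ (A.map (algebraMap ℝ ℂ)) < 1) (hCov : Cov.PosDef)
    (hH : H.PosSemidef) (hHH : H * H = Cov) :
    SpectralBounds A H (muMin A) (lambdaMin ℝ Cov) (lambdaMax ℝ Cov) := by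
  have hT : Hᵀ = H := by
    have := hH.isHermitian
    rwa [Matrix.IsHermitian, Matrix.conjTranspose_eq_transpose_of_trivial] at this
  refine ⟨hA, muMin_pos A hp hA, fun z hz x => muMin_mul_le A hp z hz x,
    fun z hz x => muMin_mul_le_transpose A hp z hz x, lambdaMin_pos hCov hp,
    lambdaMin_le_lambdaMax hCov.isHermitian hp, ?_, ?_, sqrt_le_lambdaMax_mul hCov hH hHH⟩
  · rw [hT]; exact lambdaMin_mul_le_sqrt hCov hH hHH
  · rw [hT]; exact sqrt_le_lambdaMax_mul hCov hH hHH

variable {Ω : Type*} {p : ℕ}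

lemma transpose_dataX_mulVec_dotProduct_self (y : ℤ → Ω → Fin p → ℝ) (T : ℕ) (v : Fin p → ℝ)
    (ω : Ω) : ((dataX y T ω)ᵀ *ᵥ v) ⬝ᵥ ((dataX y T ω)ᵀ *ᵥ v) = gramForm y T v ω := by
  rw [gramForm, Finset.sum_range]
  refine Finset.sum_congr rfl fun t _ => ?_
  rw [pow_two, dotProduct_comm v]
  rfl

lemma dataY_eq {A H : Matrix (Fin p) (Fin p) ℝ} {ζ y : ℤ → Ω → Fin p → ℝ} {ω : Ω} (T : ℕ)
    (hrec : ∀ t : ℕ, y ((t : ℤ) + 1) ω = A *ᵥ y t ω + H *ᵥ ζ ((t : ℤ) + 1) ω) :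
    dataY y T ω = A * dataX y T ω
      + Matrix.of fun (i : Fin p) (t : Fin T) => (H *ᵥ ζ ((t : ℤ) + 1) ω) i := by
  ext i t
  exact congrFun (hrec t) i

/-- The rate of the reduced-rank estimator in terms of the curvature `α` and of `d_RR`. -/
lemma reducedRank_rate_le {l Mx K M P R T : ℝ} (hl : 0 < l) (hMx : 1 ≤ Mx) (hK : 0 ≤ K)
    (hM : 0 ≤ M) (hR : 0 ≤ R) (hRP : R ≤ P) (hT : 0 < T) :
    2 * Real.sqrt (2 * R) * (64 * K * M * Real.sqrt (P * T)) / (T * l / 2)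
      ≤ 192 * ((l / (2 * Mx))⁻¹ * K * M * Real.sqrt (R * (2 * P - R) / T)) := by
  have hP : 0 ≤ P := hR.trans hRP
  have h1 : Real.sqrt (2 * R) * Real.sqrt (P * T) = Real.sqrt 2 * (T * Real.sqrt (R * P / T)) := by
    rw [← Real.sqrt_mul (by positivity)]
    have e : 2 * R * (P * T) = 2 * (T ^ 2 * (R * P / T)) := by field_simp
    rw [e, Real.sqrt_mul (show (0 : ℝ) ≤ 2 by norm_num), Real.sqrt_mul (sq_nonneg T),
      Real.sqrt_sq hT.le]
  -- `R ≤ P` turns the natural `rp` into the parameter count `r(2p - r)`; next, `Mx ≥ 1` turns `1/l`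
  -- into the inverse curvature.
  have h2 : Real.sqrt (R * P / T) ≤ Real.sqrt (R * (2 * P - R) / T) := by
    refine Real.sqrt_le_sqrt ?_
    gcongr
    linarith
  have h3 : 1 / l ≤ (l / (2 * Mx))⁻¹ / 2 := by
    rw [inv_div, div_div, div_le_div_iff₀ hl (by positivity)]
    nlinarith
  have e2 : 2 * Real.sqrt (2 * R) * (64 * K * M * Real.sqrt (P * T)) / (T * l / 2)
      = 256 * Real.sqrt 2 * (1 / l * K * M * Real.sqrt (R * P / T)) := by
    rw [show 2 * Real.sqrt (2 * R) * (64 * K * M * Real.sqrt (P * T))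
      = 128 * K * M * (Real.sqrt (2 * R) * Real.sqrt (P * T)) by ring, h1]
    field_simp
    ring
  rw [e2]
  calc 256 * Real.sqrt 2 * (1 / l * K * M * Real.sqrt (R * P / T))
      ≤ 256 * (3 / 2) * ((l / (2 * Mx))⁻¹ / 2 * K * M * Real.sqrt (R * (2 * P - R) / T)) := by
        have := sqrt_two_le
        gcongr
    _ = _ := by ring

/-- Used with `s = s₀^(2/3)` and `σ = σ₁^(2/3)`, this inserts the factor `σ/s ≥ 1` and is the only
source of the dependence of `C₁` on `s₀`. -/
lemma rate_mul_le {s σ κ G X a K M w : ℝ} (hs : 0 < s) (hsσ : s ≤ σ) (hκ : 0 ≤ κ) (hG : 0 ≤ G)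
    (ha : 0 ≤ a * K * M * w) (hX : X ≤ 192 * (a * K * M * w)) :
    2884 * κ * G * X ≤ 2884 * 192 / s * σ * κ * G * a * K * M * w := by
  calc 2884 * κ * G * X ≤ 2884 * κ * G * (192 * (a * K * M * w)) := by gcongr
    _ = 2884 * 192 / s * s * (κ * G * (a * K * M * w)) := by
        rw [div_mul_cancel₀ _ hs.ne']; ring
    _ ≤ 2884 * 192 / s * σ * (κ * G * (a * K * M * w)) := by gcongr
    _ = _ := by ring

end Assembly

end CommonVAR

theorem mainTheorem2 :
    ∃ C₀ : ℝ, 0 < C₀ ∧ ∃ C₂ : ℝ, 0 < C₂ ∧ ∀ s₀ : ℝ, 0 < s₀ → ∃ C₁ : ℝ, 0 < C₁ ∧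
      ∀ (Ω : Type*) [MeasurableSpace Ω] (Pr : Measure Ω) [IsProbabilityMeasure Pr]
        (p r d T : ℕ) (_hr : 0 < r) (_hd : d ≤ r)
        -- the transition matrix: rank `r`, stable, with its decomposition
        (A : Matrix (Fin p) (Fin p) ℝ)
        (_hrank : A.rank = r)
        (_hstable : spectralRadius ℂ (A.map (algebraMap ℝ ℂ)) < 1)
        (C : Matrix (Fin p) (Fin d) ℝ) (R P : Matrix (Fin p) (Fin (r - d)) ℝ)
        (D : Matrix (Fin d ⊕ Fin (r - d)) (Fin d ⊕ Fin (r - d)) ℝ)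
        (_hdecomp : CommonVAR.IsCommonDecomposition A C R P D)
        (_hs₀ : s₀ ≤ CommonVAR.sigma A 0)
        -- the smallest canonical angle between the specific subspaces
        (gmin : ℝ) (_hg : 0 < gmin)
        (_hangle : gmin ≤ Real.sin (CommonVAR.canonicalAngle R P 0))
        -- the errors `ε_t = H ζ_t`, where `H` is the square root of the covariance matrix
        (Cov H : Matrix (Fin p) (Fin p) ℝ)
        (_hCov : Cov.PosDef) (_hH : H.PosSemidef) (_hHH : H * H = Cov)
        (τ : ℝ≥0) (ζ y : ℤ → Ω → Fin p → ℝ)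
        (_hζ : CommonVAR.IsInnovation Pr τ ζ)
        (_hy : CommonVAR.IsStationaryVAR Pr A H ζ y)
        -- the scaling parameter of the initialization
        (b : ℝ) (_hb : 0 < b)
        -- the sample size
        (_hT : C₀ * max ((τ : ℝ) ^ 4) ((τ : ℝ) ^ 2) * ((CommonVAR.M₂ A Cov) ^ 2)⁻¹ * (p : ℝ)
          ≤ (T : ℝ)),
        ∃ E : Set Ω, MeasurableSet E ∧
          1 - 2 * Real.exp (-(C₂ * (CommonVAR.M₂ A Cov) ^ 2
                * min ((τ : ℝ) ^ 2)⁻¹ ((τ : ℝ) ^ 4)⁻¹ * (T : ℝ)))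
              - Real.exp (-(C₂ * (p : ℝ))) ≤ Pr.real E ∧
          ∀ ω ∈ E, ∀ A₀ : Matrix (Fin p) (Fin p) ℝ,
            CommonVAR.IsSpectralInit r d b
              (CommonVAR.dataY y T ω) (CommonVAR.dataX y T ω) A₀ →
            CommonVAR.frobNorm (A₀ - A)
              ≤ C₁ * (CommonVAR.sigma A 0) ^ (2 / 3 : ℝ)
                * (CommonVAR.sigma A 0 / CommonVAR.sigma A (r - 1)) ^ 2
                * (gmin ^ 2)⁻¹ * (CommonVAR.alphaRSC A Cov)⁻¹ * (τ : ℝ) ^ 2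
                * CommonVAR.M₁ A Cov * Real.sqrt (CommonVAR.dRR p r / (T : ℝ)) := by
  open CommonVAR in
  -- `2^21 = 2048 * 1024` makes `θT ≥ 1024 p / M₂²`, and `65536 = 32 * 2048` matches the exponent
  -- `θT/32`; 2884 and 192 are the constants of the deterministic bound and of the rate.
  refine ⟨2 ^ 21, by norm_num, 1 / 65536, by norm_num, fun s₀ hs₀ =>
    ⟨2884 * 192 / s₀ ^ (2 / 3 : ℝ), by positivity, ?_⟩⟩
  intro Ω _ Pr _ p r d T hr hd A hrank hstable C R P D hdecomp hsσ g hg hangle Cov H hCov hH hHH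
    τ ζ y hζ hy b hb hT
  have hrp : r ≤ p := by
    rw [← hrank]
    simpa using A.rank_le_card_width
  have hp : 0 < p := hr.trans_le hrp
  have hS := spectralBounds_of_posDef hp hstable hCov hH hHH
  have hK := hζ.one_le_sq hp
  have hMx := one_le_muMax A hp
  have hmMx := muMin_le_muMax A hp
  have hm := hS.m_pos
  have hl := hS.l_pos
  have hL := hS.L_pos
  have hlL := hS.le_L
  have hp1 : (1 : ℝ) ≤ p := by exact_mod_cast hp
  set q := M₂ A Cov with hq
  set K := (τ : ℝ) ^ 2 with hKd
  have hK4 : (τ : ℝ) ^ 4 = K ^ 2 := by rw [hKd]; ring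
  have hK0 : 0 < K := by linarith
  have hKK : K ≤ K ^ 2 := by nlinarith
  have hMx0 : 0 < muMax A := by linarith
  have hq0 : 0 < q := by rw [hq, M₂]; positivity
  have hq1 : q ≤ 1 := by
    rw [hq, M₂, div_le_one (by positivity)]
    exact mul_le_mul hlL hmMx hm.le hL.le
  have hq2 : q ^ 2 ≤ 1 := by nlinarith
  -- Unit variance gives `τ² ≥ 1`, so the maximum is `τ⁴` and the minimum below is `τ⁻⁴`.
  rw [hK4, max_eq_left hKK] at hT
  rw [hK4, min_eq_right (inv_anti₀ hK0 hKK)]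
  have hθ := sqScale_pos hK
  set θ := sqScale K with hθd
  have hθT : 1024 * p / q ^ 2 ≤ θ * T := by
    have e : 1024 * p / q ^ 2 = θ * (2 ^ 21 * K ^ 2 * (q ^ 2)⁻¹ * p) := by
      rw [hθd, sqScale]; field_simp; norm_num
    rw [e]
    gcongr
  have hpq : (p : ℝ) ≤ p / q ^ 2 := by
    rw [le_div_iff₀ (by positivity)]
    nlinarith
  have hθT' : 1024 * (p : ℝ) ≤ θ * T := by
    refine le_trans ?_ hθT
    rw [mul_div_assoc]
    linarith
  have hT0 : (0 : ℝ) < T := by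
    by_contra! hneg
    nlinarith
  have hTp : 11 * p ≤ T := by
    have h1 : θ * T ≤ 1 * T := by
      gcongr
      exact (sqScale_le hK).trans (by norm_num)
    have : 11 * (p : ℝ) ≤ T := by linarith
    exact_mod_cast this
  have hB₁ := hy.measure_gramForm_le hζ hS hp hMx hmMx (q := q) rfl (T := T) (by
    refine le_trans ?_ hθT
    gcongr
    norm_num)
  have hB₂ := hy.measure_opNorm_cross_le hζ hS hp hTp
  have hB₃ := ae_iff.1 hy.recursion_ae
  set B₁ := {ω | ¬ ∀ v, T * lambdaMin ℝ Cov / 2 * (v ⬝ᵥ v) ≤ gramForm y T v ω} with hB₁d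
  set B₂ := {ω | ¬ ‖(Matrix.of fun (i : Fin p) (t : Fin T) => (H *ᵥ ζ ((t : ℤ) + 1) ω) i)
          * (dataX y T ω)ᵀ‖
        ≤ 64 * (τ : ℝ) ^ 2 * (lambdaMax ℝ Cov / Real.sqrt (muMin A)) * Real.sqrt (p * T)} with hB₂d
  set B₃ := {ω | ¬ ∀ t : ℕ, y ((t : ℤ) + 1) ω = A *ᵥ y t ω + H *ᵥ ζ ((t : ℤ) + 1) ω} with hB₃d
  -- Passing to a measurable hull of the same measure avoids checking measurability of the bad
  -- events.
  refine ⟨(toMeasurable Pr (B₁ ∪ B₂ ∪ B₃))ᶜ, (measurableSet_toMeasurable _ _).compl, ?_, ?_⟩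
  · rw [probReal_compl_eq_one_sub (measurableSet_toMeasurable _ _), measureReal_def,
      measure_toMeasurable]
    have h1 : Pr (B₁ ∪ B₂ ∪ B₃)
        ≤ ENNReal.ofReal (4 * Real.exp (-(θ * T / 16)) + Real.exp (-p)) := by
      rw [ENNReal.ofReal_add (by positivity) (by positivity)]
      refine (measure_union_le _ _).trans ?_
      rw [hB₃, add_zero]
      exact (measure_union_le _ _).trans (add_le_add hB₁ hB₂)
    have h2 := ENNReal.toReal_le_of_le_ofReal (by positivity) h1
    -- Half of the exponent pays for reducing the prefactor from 4 to 2, since `θT/32 ≥ 1`.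
    have h3 : 4 * Real.exp (-(θ * T / 16))
        ≤ 2 * Real.exp (-(1 / 65536 * q ^ 2 * (K ^ 2)⁻¹ * T)) := by
      have h4 : Real.exp (-(θ * T / 32)) ≤ Real.exp (-1) :=
        Real.exp_le_exp.2 (by linarith)
      have h5 : Real.exp (-1 : ℝ) ≤ 1 / 2 := by
        have h6 := Real.add_one_le_exp (1 : ℝ)
        have h7 : Real.exp (-1 : ℝ) * Real.exp 1 = 1 := by rw [← Real.exp_add]; simp
        nlinarith [Real.exp_pos (-1 : ℝ)]
      have h8 : Real.exp (-(θ * T / 16)) = Real.exp (-(θ * T / 32)) * Real.exp (-(θ * T / 32)) := by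
        rw [← Real.exp_add]; congr 1; ring
      have h9 : Real.exp (-(θ * T / 32)) ≤ Real.exp (-(1 / 65536 * q ^ 2 * (K ^ 2)⁻¹ * T)) := by
        refine Real.exp_le_exp.2 (neg_le_neg ?_)
        have e : θ * T / 32 = 1 / 65536 * 1 * (K ^ 2)⁻¹ * T := by
          rw [hθd, sqScale]; field_simp; norm_num
        rw [e]
        gcongr
      rw [h8]
      nlinarith [Real.exp_pos (-(θ * T / 32))]
    have h4 : Real.exp (-(p : ℝ)) ≤ Real.exp (-(1 / 65536 * p)) :=
      Real.exp_le_exp.2 (by linarith)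
    linarith
  · intro ω hω A₀ hA₀
    have hω' : ω ∉ B₁ ∪ B₂ ∪ B₃ := fun hmem => hω (subset_toMeasurable _ _ hmem)
    simp only [Set.mem_union, not_or] at hω'
    obtain ⟨⟨h1, h2⟩, h3⟩ := hω'
    simp only [hB₁d, hB₂d, hB₃d, Set.mem_ofPred_eq, not_not] at h1 h2 h3
    have hRR : ∀ A', IsReducedRankEstimator r (dataY y T ω) (dataX y T ω) A' →
        frobNorm (A' - A) ≤ _ := fun A' hA' =>
      frobNorm_reducedRank_sub_le (dataY_eq T h3) hrank.le hA'
        (c := T * lambdaMin ℝ Cov / 2) (by positivity)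
        (fun v => (h1 v).trans (transpose_dataX_mulVec_dotProduct_self y T v ω).ge) h2
    refine (frobNorm_spectralInit_sub_le hr hd hrank hdecomp hg hangle hb hRR hA₀).trans ?_
    have hrate := reducedRank_rate_le (K := K) (M := lambdaMax ℝ Cov / Real.sqrt (muMin A))
      (P := p) (R := r) (T := T) hl hMx hK0.le (by positivity) (Nat.cast_nonneg r)
      (by exact_mod_cast hrp) hT0
    have hσ : s₀ ^ (2 / 3 : ℝ) ≤ sigma A 0 ^ (2 / 3 : ℝ) :=
      Real.rpow_le_rpow hs₀.le hsσ (by norm_num)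
    have hs : 0 < s₀ ^ (2 / 3 : ℝ) := Real.rpow_pos_of_pos hs₀ _
    rw [alphaRSC, M₁, dRR]
    exact rate_mul_le hs hσ (sq_nonneg _) (inv_nonneg.2 (sq_nonneg g)) (by positivity) hrate
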